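/- **Setting.** For $a>0$ let $\lfloor a\rfloor$ denote the largest integer strictly smaller than $a$. Let $R$ be a known $d_x\times d_z$ matrix of full column rank, let $(x_t,\epsilon_t)_{t\ge 1}$ be random variables with $x_t\in\mathcal X$, where $\mathcal X\subset\mathbb R^{d_x}$ is convex and bounded, and $\epsilon_t\in\mathbb R$, and put $z_t=R'x_t$. For each sample size $T$ the responses are $$y_t=x_t'\beta_0+\mathbf 1\{t>\lfloor\tau_0T\rfloor\}\,z_t'\delta_0+\epsilon_t,\qquad t=1,\dots,T,$$ with true slopes $\gamma_0=(\beta_0,\delta_0)\in\mathbb R^{d_x+d_z}$ and true break location $\tau_0$. The set $\mathcal H\subset(0,1)$ of candidate break locations is a Borel set that contains a nondegenerate closed interval to which $\tau_0$ belongs. **Assumption 1 (data generating process).** The process $(x_t,\epsilon_t)_{t\ge1}$ is strictly stationary, and 1. $\delta_0\neq0$; 2. the $\epsilon_t$ are i.i.d. and square integrable, with $E(\epsilon_t\mid x_t)=0$ and $E(\epsilon_t^2\mid x_t)=\sigma_0^2>0$; 3. $\Sigma_X=E[x_tx_t']=\operatorname{plim}_{T\to\infty}\frac1T\sum_{t=1}^Tx_tx_t'$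 exists and is positive definite; 4. for all $0<\tau_1<\tau_2<1$, $$\frac1T\sum_{t=\lfloor\tau_1T\rfloor+1}^{\lfloor\tau_2T\rfloor}x_t\epsilon_t=O_p(T^{-1/2}),\qquad \frac1T\sum_{t=\lfloor\tau_1T\rfloor+1}^{\lfloor\tau_2T\rfloor}x_tx_t'=(\tau_2-\tau_1)\Sigma_X+O_p(T^{-1/2}).$$ **Model and posterior.** For $\theta=(\beta,\delta,\sigma^2)$ with $\sigma^2>0$, the (possibly misspecified) normal likelihood is $$p(Y_T\mid X_T,\theta,\tau)=\prod_{t=1}^T\frac1{\sqrt{2\pi\sigma^2}}\exp\left(-\frac{\left(y_t-x_t'\beta-\mathbf 1\{t>\lfloor\tau T\rfloor\}z_t'\delta\right)^2}{2\sigma^2}\right).$$ For $\tau\in\mathcal H$ let $\theta^*(\tau)$ be the pseudo-true parameter: the value that minimizes, over all $\theta$ with $\sigma^2>0$, the limit as $T\to\infty$ of the Kullback–Leibler divergence per observation of the model $p(\cdot\mid X_T,\theta,\tau)$ from the data generating process (equivalently, $\lim_T T^{-1}E[\log p(Y_T\mid X_T,\theta^*(\tau),\tau)-\log p(Y_T\mid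 X_T,\theta,\tau)]\ge0$ for all such $\theta$). Given a prior probability density $\pi(\theta,\tau)$, put $$L_T(\tau)=\int p(Y_T\mid X_T,\theta,\tau)\,\pi(\theta,\tau)\,d\theta,\qquad \pi_T(\tau)=\frac{L_T(\tau)}{\int_{\mathcal H}L_T(s)\,ds}.$$ **Assumption 2 (parameter space and prior).** 1. $\Theta\subset\mathbb R^{d_x+d_z}\times(0,\infty)$ is compact and convex, and $\theta^*(\tau)\in\operatorname{int}\Theta$ for all $\tau\in\mathcal H$; 2. the prior density $\pi$ vanishes outside $\Theta\times\mathcal H$, and for every $\tau\in\mathcal H$ it is, on the intersection of some neighbourhood of $(\theta^*(\tau),\tau)$ with $\Theta\times\mathcal H$, continuous in $\theta$ and bounded away from $0$ and $\infty$. **Theorem.** Under Assumptions 1 and 2 the marginal posterior density $\pi_T$ is well defined for every $T$ and every sample ($L_T$ is integrable over $\mathcal H$ with positive integral), and it contracts around $\tau_0$ at rate $T^{-1}$: for all $\eta>0$ and $\epsilon>0$ there are $M>0$ and an integer $k>0$ such that for all $T\ge k$ $$P_{\theta_0,\tau_0}\left(\int_{\mathcal H\setminus(\tau_0-M/T,\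 \tau_0+M/T)}\pi_T(\tau)\,d\tau<\eta\right)>1-\epsilon .$$ Here $P_{\theta_0,\tau_0}$ is the law of the data generating process, with $\theta_0=(\gamma_0,\sigma_0^2)$. -/

import Mathlib

open MeasureTheory ProbabilityTheory Filter Set Topology
open scoped Matrix

noncomputable section

namespace BreakModel

/-- The regression parameter `θ = ((β, δ), σ²)`, a point of `ℝ ^ (dx + dz + 1)`. -/
abbrev Param (dx dz : ℕ) : Type := ((Fin dx → ℝ) × (Fin dz → ℝ)) × ℝ

/-- The largest integer strictly smaller than `a`, for `a > 0`. -/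
def strictFloor (a : ℝ) : ℕ := ⌈a⌉₊ - 1

lemma strictFloor_spec {a : ℝ} (ha : 0 < a) :
    (strictFloor a : ℝ) < a ∧ a ≤ (strictFloor a : ℝ) + 1 := by
  have h1 : 1 ≤ ⌈a⌉₊ := Nat.one_le_iff_ne_zero.mpr (Nat.ceil_pos.mpr ha).ne'
  have h2 : (strictFloor a : ℝ) = (⌈a⌉₊ : ℝ) - 1 := by
    unfold strictFloor
    push_cast [Nat.cast_sub h1]
    ring
  have h3 := Nat.le_ceil a
  have h4 := Nat.ceil_lt_add_one ha.le
  constructor <;> linarith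

/-! Observations are indexed from zero: index `t : ℕ` stands for date `t + 1`, so that the sample
of size `T` is `Finset.range T`, and date `t + 1` lies after the break `⌊τ T⌋` exactly when
`strictFloor (τ * T) ≤ t`. -/

/-- The regression function `χ_{τ,t}' γ = x_t' β + 1{t > ⌊τ T⌋} z_t' δ`, where `z_t = R' x_t`. -/
def regMean {dx dz : ℕ} (R : Matrix (Fin dx) (Fin dz) ℝ) (T : ℕ) (τ : ℝ)
    (γ : (Fin dx → ℝ) × (Fin dz → ℝ)) (t : ℕ) (xt : Fin dx → ℝ) : ℝ :=
  xt ⬝ᵥ γ.1 + if strictFloor (τ * T) ≤ t then (Rᵀ *ᵥ xt) ⬝ᵥ γ.2 else 0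

/-- The normal likelihood `p(Y_T | X_T, θ, τ)`. -/
def normalLik {dx dz : ℕ} (R : Matrix (Fin dx) (Fin dz) ℝ) (T : ℕ)
    (y : ℕ → ℝ) (x : ℕ → Fin dx → ℝ) (θ : Param dx dz) (τ : ℝ) : ℝ :=
  ∏ t ∈ Finset.range T, (1 / √(2 * Real.pi * θ.2)) *
    Real.exp (-(y t - regMean R T τ θ.1 t (x t)) ^ 2 / (2 * θ.2))

/-- The marginal likelihood `L_T(τ) = ∫ p(Y_T | X_T, θ, τ) π(θ, τ) dθ`. -/
def margLik {dx dz : ℕ} (R : Matrix (Fin dx) (Fin dz) ℝ) (prior : Param dx dz × ℝ → ℝ) (T : ℕ)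
    (y : ℕ → ℝ) (x : ℕ → Fin dx → ℝ) (τ : ℝ) : ℝ :=
  ∫ θ : Param dx dz, normalLik R T y x θ τ * prior (θ, τ)

/-- The marginal posterior density `π_T(τ) = L_T(τ) / ∫_H L_T`. -/
def margPosterior {dx dz : ℕ} (R : Matrix (Fin dx) (Fin dz) ℝ) (prior : Param dx dz × ℝ → ℝ)
    (H : Set ℝ) (T : ℕ) (y : ℕ → ℝ) (x : ℕ → Fin dx → ℝ) (τ : ℝ) : ℝ :=
  margLik R prior T y x τ / ∫ s in H, margLik R prior T y x s

section Probability

variable {Ω : Type*} [MeasurableSpace Ω]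

/-- The responses in the sample of size `T`, generated with slopes `γ₀` and break `τ₀`. -/
def response {dx dz : ℕ} (R : Matrix (Fin dx) (Fin dz) ℝ) (x : ℕ → Ω → Fin dx → ℝ)
    (ε : ℕ → Ω → ℝ) (γ₀ : (Fin dx → ℝ) × (Fin dz → ℝ)) (τ₀ : ℝ) (T : ℕ) (ω : Ω) (t : ℕ) : ℝ :=
  regMean R T τ₀ γ₀ t (x t ω) + ε t ω

/-- `Y_T = O_p(a_T)` as `T → ∞`. -/
def IsBigOInProb (μ : Measure Ω) (Y : ℕ → Ω → ℝ) (a : ℕ → ℝ) : Prop :=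
  ∀ e : ℝ, 0 < e → ∃ C : ℝ, 0 < C ∧ ∃ k : ℕ, ∀ T ≥ k, μ.real {ω | C * a T < |Y T ω|} < e

/-- The assumptions on the data generating process of the covariates `x` and the errors `ε`, with
true jump `δ₀`, error variance `σ₀sq`, second moment matrix `SigmaX`, and `X` the space in which
the covariates take their values. -/
structure RegularDGP {dx dz : ℕ} (μ : Measure Ω) (X : Set (Fin dx → ℝ))
    (x : ℕ → Ω → Fin dx → ℝ) (ε : ℕ → Ω → ℝ) (δ₀ : Fin dz → ℝ) (σ₀sq : ℝ)
    (SigmaX : Matrix (Fin dx) (Fin dx) ℝ) : Prop where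
  measurable_x : ∀ t, Measurable (x t)
  measurable_err : ∀ t, Measurable (ε t)
  convex_X : Convex ℝ X
  bounded_X : Bornology.IsBounded X
  x_mem : ∀ t, ∀ᵐ ω ∂μ, x t ω ∈ X
  /-- `(x_t, ε_t)` is a strictly stationary process. -/
  stationary : IdentDistrib (fun ω (t : ℕ) => (x (t + 1) ω, ε (t + 1) ω))
    (fun ω (t : ℕ) => (x t ω, ε t ω)) μ μ
  jump_ne_zero : δ₀ ≠ 0
  variance_pos : 0 < σ₀sq
  err_indep : iIndepFun ε μ
  err_identDistrib : ∀ t, IdentDistrib (ε t) (ε 0) μ μ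
  err_memLp : ∀ t, MemLp (ε t) 2 μ
  err_condMean : ∀ t, μ[ε t | MeasurableSpace.comap (x t) inferInstance] =ᵐ[μ] fun _ => 0
  err_condVar : ∀ t, μ[fun ω => ε t ω ^ 2 | MeasurableSpace.comap (x t) inferInstance]
    =ᵐ[μ] fun _ => σ₀sq
  secondMoment : ∀ t i j, ∫ ω, x t ω i * x t ω j ∂μ = SigmaX i j
  secondMoment_plim : ∀ i j, TendstoInMeasure μ
    (fun (T : ℕ) ω => (1 / (T : ℝ)) * ∑ t ∈ Finset.range T, x t ω i * x t ω j)
    atTop (fun _ => SigmaX i j)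
  secondMoment_posDef : SigmaX.PosDef
  partialSum_err : ∀ τ₁ τ₂ : ℝ, 0 < τ₁ → τ₁ < τ₂ → τ₂ < 1 → ∀ i, IsBigOInProb μ
    (fun T ω => (1 / (T : ℝ)) *
      ∑ t ∈ Finset.Ico (strictFloor (τ₁ * T)) (strictFloor (τ₂ * T)), x t ω i * ε t ω)
    (fun T => 1 / √(T : ℝ))
  partialSum_x : ∀ τ₁ τ₂ : ℝ, 0 < τ₁ → τ₁ < τ₂ → τ₂ < 1 → ∀ i j, IsBigOInProb μ
    (fun T ω => (1 / (T : ℝ)) *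
      ∑ t ∈ Finset.Ico (strictFloor (τ₁ * T)) (strictFloor (τ₂ * T)), x t ω i * x t ω j
        - (τ₂ - τ₁) * SigmaX i j)
    (fun T => 1 / √(T : ℝ))

/-- The expectation `E[log p(Y_T | X_T, θ, τ)]` under the data generating process. -/
def meanLogLik {dx dz : ℕ} (μ : Measure Ω) (R : Matrix (Fin dx) (Fin dz) ℝ)
    (x : ℕ → Ω → Fin dx → ℝ) (ε : ℕ → Ω → ℝ) (γ₀ : (Fin dx → ℝ) × (Fin dz → ℝ)) (τ₀ : ℝ)
    (T : ℕ) (θ : Param dx dz) (τ : ℝ) : ℝ :=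
  ∫ ω, Real.log (normalLik R T (response R x ε γ₀ τ₀ T ω) (fun t => x t ω) θ τ) ∂μ

/-- `θ` minimizes, among all parameters with positive variance, the Kullback-Leibler divergence
per observation, as `T → ∞`, of the model with break `τ` from the data generating process. The
divergences of two parameters differ by the difference of their expected log likelihoods, which
is meaningful also when the errors have no density. -/
def IsPseudoTrue {dx dz : ℕ} (μ : Measure Ω) (R : Matrix (Fin dx) (Fin dz) ℝ)
    (x : ℕ → Ω → Fin dx → ℝ) (ε : ℕ → Ω → ℝ) (γ₀ : (Fin dx → ℝ) × (Fin dz → ℝ)) (τ₀ τ : ℝ)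
    (θ : Param dx dz) : Prop :=
  0 < θ.2 ∧ ∀ θ' : Param dx dz, 0 < θ'.2 → ∃ d : ℝ, 0 ≤ d ∧
    Tendsto (fun T : ℕ => (1 / (T : ℝ)) *
      (meanLogLik μ R x ε γ₀ τ₀ T θ τ - meanLogLik μ R x ε γ₀ τ₀ T θ' τ)) atTop (𝓝 d)

/-- The pseudo true parameter value `θ*(τ)`. -/
def pseudoTrue {dx dz : ℕ} (μ : Measure Ω) (R : Matrix (Fin dx) (Fin dz) ℝ)
    (x : ℕ → Ω → Fin dx → ℝ) (ε : ℕ → Ω → ℝ) (γ₀ : (Fin dx → ℝ) × (Fin dz → ℝ)) (τ₀ τ : ℝ) :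
    Param dx dz :=
  Classical.epsilon (IsPseudoTrue μ R x ε γ₀ τ₀ τ)

end Probability

/-- The assumptions on the parameter space `Θ` and on the joint prior density of `(θ, τ)`, where
`θstar τ` is the pseudo true parameter for the break `τ`. -/
structure RegularPrior {dx dz : ℕ} (Θ : Set (Param dx dz)) (H : Set ℝ)
    (prior : Param dx dz × ℝ → ℝ) (θstar : ℝ → Param dx dz) : Prop where
  compact : IsCompact Θ
  convex : Convex ℝ Θ
  variance_pos : ∀ θ ∈ Θ, 0 < θ.2
  star_mem : ∀ τ ∈ H, θstar τ ∈ interior Θ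
  measurable : Measurable prior
  nonneg : ∀ p, 0 ≤ prior p
  total_mass : ∫ p, prior p = 1
  supported : ∀ p, p ∉ Θ ×ˢ H → prior p = 0
  /-- Near `(θ*(τ), τ)` the prior is continuous in `θ` and bounded away from `0` and `∞`. -/
  regular : ∀ τ ∈ H, ∃ W ∈ 𝓝 (θstar τ, τ),
    (∀ s ∈ H, ContinuousOn (fun θ => prior (θ, s)) {θ | θ ∈ Θ ∧ (θ, s) ∈ W}) ∧
    ∃ c C : ℝ, 0 < c ∧ ∀ p ∈ W ∩ Θ ×ˢ H, c ≤ prior p ∧ prior p ≤ C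

end BreakModel

end

noncomputable section

/-! Breaks are compared at the same value of `θ`, so no expansion of the marginal likelihood is
needed. Let `n₀` and `n` be the dates of the true and of a candidate break. For fixed `θ` the two
log likelihoods differ only through the dates between `n` and `n₀`. If `θ` is close to `θ₀ = (γ₀,
σ₀²)`, moving the break to `n` raises the squared residuals there by about `q = (Rδ₀)'Σ(Rδ₀)` per
date on average, and `q > 0` because `R` is injective and `δ₀ ≠ 0`. Hence near `θ₀` the likelihood
decays like `exp (-a T |τ - τ₀|)`.

Let `Z` be the integral over a ball around `θ₀` of the likelihood with break `τ₀`. The breaks with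
`m ≤ T |τ - τ₀| < κ T`, paired with `θ` in the ball, contribute at most a multiple of `Z exp (-a m /
2) / T`. The normalizing integral is at least a multiple of `Z / T`: on an interval of length `1 /
T` at `τ₀` the break moves by at most one date, which costs a bounded factor. So `Z` cancels. For
`θ` outside the ball or `τ` at distance at least `κ`, the log likelihood is lower by `3ζT` than at
the truth, whereas `Z` loses at most `2ζT`; the remainder is of order `T exp (-ζT)`. This is
`margPosterior_setIntegral_le`.

The probabilistic input is `RegularDGP.exists_sampleRegular`: on all segments adjacent to `n₀` that
have at least `M` dates, the centred moments are small relative to the length of the segment, with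
`M` independent of `T`. The rates on fixed fractions of the sample do not say this about short
segments, but stationarity does. Averages of a long block are small in probability, hence in `L¹` by
the second moment bound; Hopf's maximal inequality for the block means (`window_uniform_bound`) then
controls all lengths at once, without mixing or ergodicity. Given a regular sample the rest is
deterministic: `exists_likelihoodSeparated` yields the likelihood bounds, and `pseudoTrue_eq` places
the region where the prior is bounded around the truth. -/

namespace BreakModel

/-! ### Running maxima of partial sums -/

/-- The maximum of `0` and the partial sums of length at most `n` of the sequence `a` from `t`. -/
def runningMax (a : ℕ → ℝ) : ℕ → ℕ → ℝ
  | 0, _ => 0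
  | n + 1, t => max 0 (a t + runningMax a n (t + 1))

lemma runningMax_nonneg (a : ℕ → ℝ) (n t : ℕ) : 0 ≤ runningMax a n t := by
  cases n with
  | zero => exact le_rfl
  | succ n => exact le_max_left _ _

lemma runningMax_le_succ (a : ℕ → ℝ) (n t : ℕ) : runningMax a n t ≤ runningMax a (n + 1) t := by
  induction n generalizing t with
  | zero => exact runningMax_nonneg _ _ _
  | succ n ih =>
    change max 0 (a t + runningMax a n (t + 1)) ≤ max 0 (a t + runningMax a (n + 1) (t + 1))
    have := ih (t + 1)
    gcongr

lemma sum_le_runningMax (a : ℕ → ℝ) {m n : ℕ} (hmn : m ≤ n) (t : ℕ) :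
    ∑ s ∈ Finset.range m, a (t + s) ≤ runningMax a n t := by
  induction n generalizing t m with
  | zero =>
    obtain rfl : m = 0 := by omega
    simp [runningMax]
  | succ n ih =>
    cases m with
    | zero => simpa using runningMax_nonneg a (n + 1) t
    | succ m =>
      rw [Finset.sum_range_succ']
      have h := ih (m := m) (by omega) (t + 1)
      have e : ∑ k ∈ Finset.range m, a (t + (k + 1)) = ∑ k ∈ Finset.range m, a (t + 1 + k) :=
        Finset.sum_congr rfl fun k _ => by congr 1; ring
      rw [e, add_comm]
      exact (add_le_add_right h _).trans (le_max_right _ _)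

lemma runningMax_congr {a b : ℕ → ℝ} {n t t' : ℕ} (h : ∀ s < n, a (t + s) = b (t' + s)) :
    runningMax a n t = runningMax b n t' := by
  induction n generalizing t t' with
  | zero => rfl
  | succ n ih =>
    have h0 := h 0 (by omega)
    have h1 : runningMax a n (t + 1) = runningMax b n (t' + 1) := ih fun s hs => by
      have := h (s + 1) (by omega)
      rwa [show t + (s + 1) = t + 1 + s by ring, show t' + (s + 1) = t' + 1 + s by ring] at this
    simp only [add_zero] at h0
    simp only [runningMax, h0, h1]

lemma measurable_runningMax (n t : ℕ) : Measurable fun a : ℕ → ℝ => runningMax a n t := by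
  induction n generalizing t with
  | zero => exact measurable_const
  | succ n ih => exact measurable_const.max ((measurable_pi_apply t).add (ih (t + 1)))

/-- The pointwise inequality in Garsia's proof of the maximal inequality. A positive maximum is
attained by a nonempty partial sum, which splits into its initial term and a partial sum of the
shifted sequence. -/
lemma runningMax_sub_le (a : ℕ → ℝ) (n : ℕ) :
    runningMax a n 0 - runningMax a n 1 ≤ if 0 < runningMax a n 0 then a 0 else 0 := by
  split_ifs with h
  · cases n with
    | zero => exact absurd h (lt_irrefl _)
    | succ n =>
      have h1 : runningMax a (n + 1) 0 = a 0 + runningMax a n 1 := by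
        change max 0 (a 0 + runningMax a n 1) = _
        change 0 < max 0 (a 0 + runningMax a n 1) at h
        refine max_eq_right ?_
        rcases lt_max_iff.mp h with h | h
        · exact absurd h (lt_irrefl _)
        · exact h.le
      linarith [runningMax_le_succ a n 1]
  · linarith [runningMax_nonneg a n 0, runningMax_nonneg a n 1]

/-! ### Maximal inequality and uniform weak law on finite windows -/

section Stationary

variable {Ω : Type*} [MeasurableSpace Ω] {μ : Measure Ω}

/-- The first `N` terms of the sequence `h` have the same joint law as the `N` terms that follow
the initial one. -/
def ShiftInvariant (μ : Measure Ω) (h : ℕ → Ω → ℝ) (N : ℕ) : Prop :=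
  ∀ F : (ℕ → ℝ) → ℝ, Measurable F → (∀ a b : ℕ → ℝ, (∀ t < N, a t = b t) → F a = F b) →
    IdentDistrib (fun ω => F fun t => h (t + 1) ω) (fun ω => F fun t => h t ω) μ μ

lemma integrable_runningMax {h : ℕ → Ω → ℝ} (hi : ∀ t, Integrable (h t) μ) (n t : ℕ) :
    Integrable (fun ω => runningMax (fun s => h s ω) n t) μ := by
  induction n generalizing t with
  | zero => exact integrable_zero _ _ _
  | succ n ih =>
    have := ((hi t).add (ih (t + 1))).pos_part
    refine this.congr (ae_of_all _ fun ω => ?_)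
    exact max_comm _ _

/-- Hopf's maximal ergodic inequality. -/
lemma maximal_ergodic [IsProbabilityMeasure μ] {h : ℕ → Ω → ℝ} {N : ℕ}
    (hm : ∀ t, Measurable (h t))
    (hi : ∀ t, Integrable (h t) μ) (hs : ShiftInvariant μ h N) {c : ℝ} (hc : 0 < c) :
    μ.real {ω | ∃ m, 1 ≤ m ∧ m ≤ N ∧ c * m < |∑ t ∈ Finset.range m, h t ω|}
      ≤ (∫ ω, |h 0 ω| ∂μ) / c := by
  -- Working with `|h| - c` handles both signs at once: a partial sum of `h` above `c * m` in
  -- absolute value makes a partial sum of `a` positive.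
  set a : Ω → ℕ → ℝ := fun ω t => |h t ω| - c with ha
  have ham : Measurable a := measurable_pi_iff.mpr fun t => (hm t).abs.sub_const c
  have hai : ∀ t, Integrable (fun ω => a ω t) μ := fun t => (hi t).abs.sub (integrable_const c)
  -- The maximum over `N` terms reads only a window of length `N`, so invariance under one shift of
  -- that window suffices.
  have hW : ∫ ω, runningMax (a ω) N 1 ∂μ = ∫ ω, runningMax (a ω) N 0 ∂μ := by
    have hid := hs (fun b => runningMax (fun t => |b t| - c) N 0)
      ((measurable_runningMax N 0).comp
        (measurable_pi_iff.mpr fun t => by fun_prop))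
      (fun b b' hb => runningMax_congr fun s hs => by
        simp only [zero_add]; rw [hb s hs])
    rw [← hid.integral_eq]
    refine integral_congr_ae (ae_of_all _ fun ω => runningMax_congr fun s _ => ?_)
    simp [ha, add_comm]
  set E : Set Ω := {ω | 0 < runningMax (a ω) N 0} with hE
  have hEm : MeasurableSet E := measurableSet_lt measurable_const
    ((measurable_runningMax N 0).comp ham)
  have hI0 := integrable_runningMax hai N 0
  have hI1 := integrable_runningMax hai N 1
  have h1 : 0 ≤ ∫ ω in E, a ω 0 ∂μ := by
    have h2 : ∫ ω, (runningMax (a ω) N 0 - runningMax (a ω) N 1) ∂μ = 0 := by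
      rw [integral_sub hI0 hI1, hW, sub_self]
    rw [← h2, ← integral_indicator hEm]
    refine integral_mono (hI0.sub hI1) ((hai 0).indicator hEm) fun ω => ?_
    have := runningMax_sub_le (a ω) N
    simpa [Set.indicator, hE] using this
  have h2 : ∫ ω in E, a ω 0 ∂μ = ∫ ω in E, |h 0 ω| ∂μ - c * μ.real E := by
    simp only [ha]
    rw [integral_sub (hi 0).abs.integrableOn (integrable_const c)]
    simp [mul_comm]
  have h3 : ∫ ω in E, |h 0 ω| ∂μ ≤ ∫ ω, |h 0 ω| ∂μ :=
    setIntegral_le_integral (hi 0).abs (ae_of_all _ fun ω => abs_nonneg _)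
  rw [le_div_iff₀ hc]
  have h4 : μ.real {ω | ∃ m, 1 ≤ m ∧ m ≤ N ∧ c * m < |∑ t ∈ Finset.range m, h t ω|}
      ≤ μ.real E := by
    refine measureReal_mono ?_
    rintro ω ⟨m, -, hmN, hlt⟩
    have := sum_le_runningMax (a ω) hmN 0
    simp only [ha, zero_add, Finset.sum_sub_distrib, Finset.sum_const, Finset.card_range,
      nsmul_eq_mul] at this
    have h5 := Finset.abs_sum_le_sum_abs (fun t => h t ω) (Finset.range m)
    change 0 < runningMax (a ω) N 0
    simp only [ha]
    linarith
  nlinarith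

/-- The average of `K` consecutive terms. -/
def blockMean (h : ℕ → Ω → ℝ) (K t : ℕ) (ω : Ω) : ℝ :=
  (∑ s ∈ Finset.range K, h (t + s) ω) / K

lemma ShiftInvariant.blockMean {h : ℕ → Ω → ℝ} {N K : ℕ} (hs : ShiftInvariant μ h (N + K)) :
    ShiftInvariant μ (blockMean h K) N := by
  intro F hF hloc
  have := hs (fun b => F fun t => (∑ s ∈ Finset.range K, b (t + s)) / K)
    (hF.comp (measurable_pi_iff.mpr fun t =>
      (Finset.measurable_sum _ fun s _ => measurable_pi_apply (t + s)).div_const _))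
    (fun b b' hb => hloc _ _ fun t ht => by
      congr 1
      refine Finset.sum_congr rfl fun s hs => hb _ ?_
      have := Finset.mem_range.mp hs
      omega)
  convert this using 5 with ω t
  · simp only [BreakModel.blockMean]
    congr 1
    exact Finset.sum_congr rfl fun s _ => by rw [show t + 1 + s = t + s + 1 by ring]
  · rfl

lemma sum_range_shift_sub (a : ℕ → ℝ) (m s : ℕ) :
    ∑ t ∈ Finset.range m, a (t + s) - ∑ t ∈ Finset.range m, a t
      = ∑ t ∈ Finset.range s, a (m + t) - ∑ t ∈ Finset.range s, a t := by
  have h1 := Finset.sum_range_add a m s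
  have h2 := Finset.sum_range_add a s m
  rw [add_comm s m] at h2
  simp only [add_comm s] at h2
  linarith

/-- Averaging over the shifts `s < K` changes a partial sum only at its two ends, by `s` terms at
each. The terms are at most `4cm` at the far end and `2cm` at the near end, which gives the factor
`6`. -/
lemma abs_sum_sub_sum_blockMean_le (a : ℕ → ℝ) {c : ℝ} (hc : 0 ≤ c) {m M K : ℕ} (hK : 1 ≤ K)
    (hKM : K ≤ M) (hMm : M ≤ m) (ha : ∀ t < m + K, |a t| ≤ c * (t + M + 1)) :
    |∑ t ∈ Finset.range m, (∑ s ∈ Finset.range K, a (t + s)) / K - ∑ t ∈ Finset.range m, a t|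
      ≤ 6 * K * c * m := by
  have hK0 : (0 : ℝ) < K := by exact_mod_cast hK
  have h1 : ∑ t ∈ Finset.range m, (∑ s ∈ Finset.range K, a (t + s)) / K
      - ∑ t ∈ Finset.range m, a t
      = (∑ s ∈ Finset.range K,
        (∑ t ∈ Finset.range s, a (m + t) - ∑ t ∈ Finset.range s, a t)) / K := by
    simp only [← sum_range_shift_sub a m]
    rw [← Finset.sum_div, Finset.sum_comm, Finset.sum_sub_distrib, sub_div]
    simp only [Finset.sum_const, Finset.card_range, nsmul_eq_mul]
    field_simp
  have hm1 : (1 : ℝ) ≤ m := by exact_mod_cast hK.trans (hKM.trans hMm)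
  have hKm : (K : ℝ) ≤ m := by exact_mod_cast hKM.trans hMm
  have hMm' : (M : ℝ) ≤ m := by exact_mod_cast hMm
  have h2 : ∀ s ∈ Finset.range K,
      |∑ t ∈ Finset.range s, a (m + t) - ∑ t ∈ Finset.range s, a t| ≤ 6 * K * c * m := by
    intro s hs
    have hsK := Finset.mem_range.mp hs
    have hsK' : (s : ℝ) ≤ K := by exact_mod_cast hsK.le
    have hA : ∀ t ∈ Finset.range s, |a (m + t)| ≤ 4 * c * m := fun t ht => by
      have htK : t < K := (Finset.mem_range.mp ht).trans hsK
      have htK' : (t : ℝ) + 1 ≤ K := by exact_mod_cast htK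
      have := ha (m + t) (by omega)
      push_cast at this
      nlinarith
    have hB : ∀ t ∈ Finset.range s, |a t| ≤ 2 * c * m := fun t ht => by
      have htK : t < K := (Finset.mem_range.mp ht).trans hsK
      have htK' : (t : ℝ) + 1 ≤ K := by exact_mod_cast htK
      have := ha t (by omega)
      nlinarith
    have hA' := (Finset.abs_sum_le_sum_abs (fun t => a (m + t)) (Finset.range s)).trans
      (Finset.sum_le_sum hA)
    have hB' := (Finset.abs_sum_le_sum_abs a (Finset.range s)).trans (Finset.sum_le_sum hB)
    simp only [Finset.sum_const, Finset.card_range, nsmul_eq_mul] at hA' hB'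
    have h3 := abs_sub (∑ t ∈ Finset.range s, a (m + t)) (∑ t ∈ Finset.range s, a t)
    have hcm : 0 ≤ c * m := by positivity
    nlinarith
  rw [h1, abs_div, abs_of_pos hK0, div_le_iff₀ hK0]
  refine ((Finset.abs_sum_le_sum_abs _ _).trans (Finset.sum_le_sum h2)).trans ?_
  simp [mul_comm]

/-- Comparison with a telescoping sum. The bound does not depend on `n`, so the union bound over a
window is uniform in its length. -/
lemma sum_inv_sq_le {M : ℕ} (hM : 1 ≤ M) (n : ℕ) :
    ∑ t ∈ Finset.range n, 1 / ((t : ℝ) + M + 1) ^ 2 ≤ 1 / (M : ℝ) := by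
  have hM0 : (0 : ℝ) < M := by exact_mod_cast hM
  suffices h : ∑ t ∈ Finset.range n, 1 / ((t : ℝ) + M + 1) ^ 2 ≤ 1 / (M : ℝ) - 1 / ((n : ℝ) + M) by
    have : (0 : ℝ) < 1 / ((n : ℝ) + M) := by positivity
    linarith
  induction n with
  | zero => simp
  | succ n ih =>
    rw [Finset.sum_range_succ]
    have h1 : 1 / ((n : ℝ) + M + 1) ^ 2 ≤ 1 / ((n : ℝ) + M) - 1 / ((n + 1 : ℕ) + M) := by
      have e : 1 / ((n : ℝ) + M) - 1 / ((n + 1 : ℕ) + M)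
          = 1 / (((n : ℝ) + M) * (n + M + 1)) := by
        push_cast
        field_simp
        ring
      rw [e]
      apply one_div_le_one_div_of_le
      · positivity
      · have : (0 : ℝ) ≤ n + M := by positivity
        nlinarith
    linarith

lemma measureReal_abs_gt_le [IsProbabilityMeasure μ] {f : Ω → ℝ}
    (hf : Integrable (fun ω => f ω ^ 2) μ) {c : ℝ} (hc : 0 < c) :
    μ.real {ω | c < |f ω|} ≤ (∫ ω, f ω ^ 2 ∂μ) / c ^ 2 := by
  have := mul_meas_ge_le_integral_of_nonneg (ae_of_all μ fun ω => sq_nonneg (f ω)) hf (c ^ 2)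
  rw [le_div_iff₀ (by positivity), mul_comm]
  refine le_trans ?_ this
  refine mul_le_mul_of_nonneg_left (measureReal_mono fun ω hω => ?_) (by positivity)
  change c ^ 2 ≤ f ω ^ 2
  rw [← sq_abs (f ω)]
  exact pow_le_pow_left₀ hc.le (le_of_lt hω) 2

/-- A uniform weak law of large numbers on a window in which the sequence is stationary. -/
lemma window_uniform_bound [IsProbabilityMeasure μ] {h : ℕ → Ω → ℝ} {N M K : ℕ}
    (hm : ∀ t, Measurable (h t)) (hi : ∀ t, Integrable (h t) μ)
    (hi2 : ∀ t, Integrable (fun ω => h t ω ^ 2) μ) {V : ℝ} (hV : ∀ t, ∫ ω, h t ω ^ 2 ∂μ ≤ V)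
    (hs : ShiftInvariant μ h (N + K)) (hK : 1 ≤ K) (hKM : K ≤ M) {c : ℝ} (hc : 0 < c) :
    μ.real {ω | ∃ m, M ≤ m ∧ m ≤ N ∧ c * m < |∑ t ∈ Finset.range m, h t ω|}
      ≤ (∫ ω, |blockMean h K 0 ω| ∂μ) / (c / 2) + V / (c / (12 * K)) ^ 2 / M := by
  have hK0 : (0 : ℝ) < K := by exact_mod_cast hK
  have hV0 : 0 ≤ V := (integral_nonneg fun ω => sq_nonneg _).trans (hV 0)
  -- Chosen so that the boundary error `6 * K * c' * m` is half of the allowance `c * m`; the block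
  -- means receive the other half.
  set c' : ℝ := c / (12 * K) with hc'
  have hc'0 : 0 < c' := by positivity
  have h1 := maximal_ergodic (μ := μ) (h := blockMean h K)
    (fun t => (Finset.measurable_sum _ fun s _ => hm (t + s)).div_const _)
    (fun t => (integrable_finsetSum _ fun s _ => hi (t + s)).div_const _) hs.blockMean
    (half_pos hc)
  -- Chebyshev's inequality at a threshold that grows linearly in `t`: the probabilities are
  -- summable, with sum of order `1 / M`.
  have h2 : μ.real (⋃ t ∈ Finset.range (N + K), {ω | c' * (t + M + 1) < |h t ω|})
      ≤ V / c' ^ 2 / M := by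
    refine (measureReal_biUnion_finset_le _ _).trans ?_
    have h3 : ∀ t ∈ Finset.range (N + K), μ.real {ω | c' * (t + M + 1) < |h t ω|}
        ≤ V / c' ^ 2 * (1 / ((t : ℝ) + M + 1) ^ 2) := fun t _ => by
      refine (measureReal_abs_gt_le (hi2 t) (by positivity)).trans ?_
      rw [div_mul_div_comm, mul_one, mul_pow]
      have := hV t
      gcongr
    refine (Finset.sum_le_sum h3).trans ?_
    rw [← Finset.mul_sum, div_eq_mul_one_div (V / c' ^ 2)]
    exact mul_le_mul_of_nonneg_left (sum_inv_sq_le (hK.trans hKM) _) (by positivity)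
  refine le_trans (measureReal_mono ?_) ((measureReal_union_le _ _).trans (add_le_add h1 h2))
  rintro ω ⟨m, hMm, hmN, hlt⟩
  by_contra hcon
  simp only [mem_union, mem_ofPred_eq, mem_iUnion, Finset.mem_range, not_or, not_exists, not_and,
    not_lt] at hcon
  obtain ⟨hA, hB⟩ := hcon
  have hA := hA m (hK.trans (hKM.trans hMm)) hmN
  have hD := abs_sum_sub_sum_blockMean_le (fun t => h t ω) hc'0.le hK hKM hMm
    (fun t ht => by simpa using hB t (by omega))
  have e : 6 * K * c' * m = c / 2 * m := by
    rw [hc']; field_simp; ring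
  rw [e] at hD
  simp only [blockMean] at hA
  have := abs_sub_abs_le_abs_sub (∑ t ∈ Finset.range m, h t ω)
    (∑ t ∈ Finset.range m, (∑ s ∈ Finset.range K, h (t + s) ω) / K)
  rw [abs_sub_comm] at this
  linarith

end Stationary

/-! ### Stationary sequences with small averages -/

section Stationary

variable {Ω : Type*} [MeasurableSpace Ω] {μ : Measure Ω}

lemma identDistrib_shift {E : Type*} [MeasurableSpace E] {Y : ℕ → Ω → E}
    (hY : ∀ t, Measurable (Y t))
    (hs : IdentDistrib (fun ω (t : ℕ) => Y (t + 1) ω) (fun ω (t : ℕ) => Y t ω) μ μ) (k : ℕ) :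
    IdentDistrib (fun ω (t : ℕ) => Y (t + k) ω) (fun ω (t : ℕ) => Y t ω) μ μ := by
  induction k with
  | zero => exact IdentDistrib.refl (measurable_pi_iff.mpr hY).aemeasurable
  | succ k ih =>
    have h : IdentDistrib (fun ω (t : ℕ) => Y (t + (k + 1)) ω) (fun ω (t : ℕ) => Y (t + k) ω) μ μ :=
      hs.comp (u := fun (y : ℕ → E) (t : ℕ) => y (t + k))
        (measurable_pi_iff.mpr fun t => measurable_pi_apply (t + k))
    exact h.trans ih

/-- A strictly stationary, square integrable real sequence some of whose averages are small
with high probability. -/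
structure StationarySmallMean (μ : Measure Ω) (f : ℕ → Ω → ℝ) : Prop where
  measurable : ∀ t, Measurable (f t)
  stationary : IdentDistrib (fun ω (t : ℕ) => f (t + 1) ω) (fun ω (t : ℕ) => f t ω) μ μ
  sq_integrable : Integrable (fun ω => f 0 ω ^ 2) μ
  small : ∀ δ : ℝ, 0 < δ → ∀ e : ℝ, 0 < e →
    ∃ K : ℕ, 1 ≤ K ∧ μ.real {ω | δ < |blockMean f K 0 ω|} ≤ e

namespace StationarySmallMean

variable {f : ℕ → Ω → ℝ}

lemma identDistrib (hf : StationarySmallMean μ f) (k : ℕ) {F : (ℕ → ℝ) → ℝ} (hF : Measurable F) :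
    IdentDistrib (fun ω => F fun t => f (t + k) ω) (fun ω => F fun t => f t ω) μ μ :=
  (identDistrib_shift hf.measurable hf.stationary k).comp hF

lemma identDistrib_zero (hf : StationarySmallMean μ f) (k : ℕ) :
    IdentDistrib (f k) (f 0) μ μ := by
  simpa using hf.identDistrib k (F := fun a => a 0) (measurable_pi_apply 0)

lemma sq_integrable' (hf : StationarySmallMean μ f) (t : ℕ) :
    Integrable (fun ω => f t ω ^ 2) μ :=
  ((hf.identDistrib_zero t).comp (u := fun y => y ^ 2)
    (by fun_prop)).integrable_iff.mpr hf.sq_integrable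

lemma integral_sq (hf : StationarySmallMean μ f) (t : ℕ) :
    ∫ ω, f t ω ^ 2 ∂μ = ∫ ω, f 0 ω ^ 2 ∂μ :=
  ((hf.identDistrib_zero t).comp (u := fun y => y ^ 2) (by fun_prop)).integral_eq

lemma integrable [IsProbabilityMeasure μ] (hf : StationarySmallMean μ f) (t : ℕ) :
    Integrable (f t) μ :=
  ((memLp_two_iff_integrable_sq (hf.measurable t).aestronglyMeasurable).mpr
    (hf.sq_integrable' t)).integrable (by norm_num)

lemma shiftInvariant_forward (hf : StationarySmallMean μ f) (n₀ N : ℕ) :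
    ShiftInvariant μ (fun t => f (n₀ + t)) N := by
  intro F hF _
  have h1 := hf.identDistrib (n₀ + 1) hF
  have h2 := hf.identDistrib n₀ hF
  convert h1.trans h2.symm using 5 <;> ring

/-- Reversed in time, a shift by one is a shift of the original sequence in the other direction. The
condition on `n₀` keeps the truncated subtraction exact on the window. -/
lemma shiftInvariant_backward (hf : StationarySmallMean μ f) {n₀ N : ℕ} (hN : N + 1 ≤ n₀) :
    ShiftInvariant μ (fun t => f (n₀ - 1 - t)) N := by
  intro F hF hloc
  have h1 := hf.identDistrib 1 (F := fun a => F fun t => a (n₀ - 1 - (t + 1)))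
    (hF.comp (measurable_pi_iff.mpr fun t => measurable_pi_apply _))
  have h2 : (fun ω => F fun t => f (n₀ - 1 - t) ω)
      = fun ω => F fun t => f (n₀ - 1 - (t + 1) + 1) ω := by
    funext ω
    refine hloc _ _ fun t ht => ?_
    rw [show n₀ - 1 - t = n₀ - 1 - (t + 1) + 1 by omega]
  rw [h2]
  exact h1.symm

/-- Block means have second moment at most that of one term, so they are uniformly integrable and
smallness in probability becomes smallness in `L¹`. -/
lemma exists_integral_blockMean_le [IsProbabilityMeasure μ] (hf : StationarySmallMean μ f) {z : ℝ}
    (hz : 0 < z) : ∃ K : ℕ, 1 ≤ K ∧ ∫ ω, |blockMean f K 0 ω| ∂μ ≤ z := by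
  set V : ℝ := ∫ ω, f 0 ω ^ 2 ∂μ with hV
  have hV0 : 0 ≤ V := integral_nonneg fun ω => sq_nonneg _
  set a : ℝ := z / (3 * (V + 1)) with ha
  have ha0 : 0 < a := by positivity
  obtain ⟨K, hK, hsm⟩ := hf.small (z / 3) (by positivity) (a * z / 3) (by positivity)
  refine ⟨K, hK, ?_⟩
  have hK0 : (0 : ℝ) < K := by exact_mod_cast hK
  set g : Ω → ℝ := blockMean f K 0 with hg
  have hgm : Measurable g := (Finset.measurable_sum _ fun s _ => hf.measurable (0 + s)).div_const _
  have hgi : Integrable g μ :=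
    (integrable_finsetSum _ fun s _ => hf.integrable (0 + s)).div_const _
  have hgsq : ∀ ω, g ω ^ 2 ≤ (∑ s ∈ Finset.range K, f s ω ^ 2) / K := fun ω => by
    have h := sq_sum_le_card_mul_sum_sq (s := Finset.range K) (f := fun s => f s ω)
    rw [Finset.card_range] at h
    simp only [hg, blockMean, zero_add, div_pow]
    rw [div_le_div_iff₀ (by positivity) hK0]
    nlinarith
  have hsi : Integrable (fun ω => (∑ s ∈ Finset.range K, f s ω ^ 2) / K) μ :=
    (integrable_finsetSum _ fun s _ => hf.sq_integrable' s).div_const _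
  have hsI : ∫ ω, (∑ s ∈ Finset.range K, f s ω ^ 2) / K ∂μ = V := by
    rw [integral_div, integral_finsetSum _ fun s _ => hf.sq_integrable' s]
    simp only [hf.integral_sq, Finset.sum_const, Finset.card_range, nsmul_eq_mul]
    field_simp
    rfl
  set E : Set Ω := {ω | z / 3 < |g ω|} with hE
  have hEm : MeasurableSet E := measurableSet_lt measurable_const hgm.abs
  -- Off `E` the first term suffices; on `E` use `|g| ≤ a g² + 1 / a`. By the choice of `a` and of
  -- the probability of `E`, each of the three terms has integral at most `z / 3`.
  have hpt : ∀ ω, |g ω| ≤ z / 3 + a * ((∑ s ∈ Finset.range K, f s ω ^ 2) / K)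
      + E.indicator (fun _ => 1 / a) ω := fun ω => by
    have h0 : 0 ≤ a * g ω ^ 2 := by positivity
    have h1 := mul_le_mul_of_nonneg_left (hgsq ω) ha0.le
    by_cases hω : ω ∈ E
    · rw [indicator_of_mem hω]
      have h2 : |g ω| ≤ a * g ω ^ 2 + 1 / a := by
        rw [← sq_abs (g ω)]
        have h3 : 0 ≤ (a * |g ω| - 1) ^ 2 / a := by positivity
        have h4 : (a * |g ω| - 1) ^ 2 / a = a * |g ω| ^ 2 + 1 / a - 2 * |g ω| := by
          field_simp; ring
        linarith [abs_nonneg (g ω)]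
      linarith
    · rw [indicator_of_notMem hω]
      have : |g ω| ≤ z / 3 := not_lt.mp hω
      linarith
  have hind : Integrable (E.indicator fun _ => 1 / a) μ := (integrable_const _).indicator hEm
  have hsum : Integrable
      (fun ω => z / 3 + a * ((∑ s ∈ Finset.range K, f s ω ^ 2) / K)) μ :=
    (integrable_const (z / 3)).add (hsi.const_mul a)
  have h1 : ∫ ω, |g ω| ∂μ ≤ ∫ ω, (z / 3 + a * ((∑ s ∈ Finset.range K, f s ω ^ 2) / K)
      + E.indicator (fun _ => 1 / a) ω) ∂μ := integral_mono hgi.abs (hsum.add hind) hpt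
  rw [integral_add hsum hind, integral_add (integrable_const (z / 3)) (hsi.const_mul a),
    integral_const_mul, hsI, integral_indicator hEm] at h1
  simp only [integral_const, smul_eq_mul, probReal_univ, one_mul,
    measureReal_restrict_apply_univ] at h1
  have h2 : μ.real E * (1 / a) ≤ z / 3 := by
    rw [mul_one_div, div_le_iff₀ ha0]
    linarith
  have h3 : a * V ≤ z / 3 := by
    rw [ha, div_mul_eq_mul_div, div_le_div_iff₀ (by positivity) (by norm_num)]
    nlinarith
  linarith

/-- The threshold `M` is chosen before the window `h` and its length `N`. This uniformity lets the
window start or end at a date that moves with the sample size. -/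
lemma window_bound [IsProbabilityMeasure μ] (hf : StationarySmallMean μ f) {c e : ℝ} (hc : 0 < c)
    (he : 0 < e) : ∃ K : ℕ, ∀ᶠ M : ℕ in atTop, ∀ (h : ℕ → Ω → ℝ) (N : ℕ),
      (∀ t, ∃ s, h t = f s) → ShiftInvariant μ h (N + K) →
      (∫ ω, |blockMean h K 0 ω| ∂μ = ∫ ω, |blockMean f K 0 ω| ∂μ) →
      μ.real {ω | ∃ m, M ≤ m ∧ m ≤ N ∧ c * m < |∑ t ∈ Finset.range m, h t ω|} ≤ e := by
  obtain ⟨K, hK, hKz⟩ := hf.exists_integral_blockMean_le (z := e * c / 4) (by positivity)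
  refine ⟨K, ?_⟩
  set V : ℝ := ∫ ω, f 0 ω ^ 2 ∂μ with hV
  have hlim : Tendsto (fun M : ℕ => V / (c / (12 * K)) ^ 2 / (M : ℝ)) atTop (𝓝 0) :=
    tendsto_const_div_atTop_nhds_zero_nat _
  filter_upwards [hlim.eventually_lt_const (half_pos he), eventually_ge_atTop K]
    with M hM hKM h N hh hs hE
  have hb := window_uniform_bound (h := h) (M := M) (V := V)
    (fun t => by obtain ⟨s, hs⟩ := hh t; rw [hs]; exact hf.measurable s)
    (fun t => by obtain ⟨s, hs⟩ := hh t; rw [hs]; exact hf.integrable s)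
    (fun t => by obtain ⟨s, hs⟩ := hh t; rw [hs]; exact hf.sq_integrable' s)
    (fun t => by obtain ⟨s, hs⟩ := hh t; rw [hs]; exact (hf.integral_sq s).le)
    hs hK hKM hc
  refine hb.trans ?_
  rw [hE]
  have : (∫ ω, |blockMean f K 0 ω| ∂μ) / (c / 2) ≤ e / 2 := by
    rw [div_le_iff₀ (by positivity)]
    linarith
  linarith

/-- The averages over long windows that start at a given date are uniformly small. -/
lemma forward_bound [IsProbabilityMeasure μ] (hf : StationarySmallMean μ f) {c e : ℝ} (hc : 0 < c)
    (he : 0 < e) : ∀ᶠ M : ℕ in atTop, ∀ n₀ N : ℕ,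
      μ.real {ω | ∃ m, M ≤ m ∧ m ≤ N ∧ c * m < |∑ t ∈ Finset.range m, f (n₀ + t) ω|} ≤ e := by
  obtain ⟨K, hK⟩ := hf.window_bound hc he
  filter_upwards [hK] with M hM n₀ N
  refine hM (fun t => f (n₀ + t)) N (fun t => ⟨_, rfl⟩) (hf.shiftInvariant_forward _ _) ?_
  have := (hf.identDistrib n₀ (F := fun a => |(∑ s ∈ Finset.range K, a s) / K|)
    (by fun_prop)).integral_eq
  simpa [blockMean, add_comm] using this

/-- The averages over long windows that end at a given date are uniformly small. -/
lemma backward_bound [IsProbabilityMeasure μ] (hf : StationarySmallMean μ f) {c e : ℝ} (hc : 0 < c)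
    (he : 0 < e) : ∃ D : ℕ, ∀ᶠ M : ℕ in atTop, ∀ n₀ N : ℕ, N + D ≤ n₀ →
      μ.real {ω | ∃ m, M ≤ m ∧ m ≤ N ∧ c * m < |∑ t ∈ Finset.range m, f (n₀ - 1 - t) ω|} ≤ e := by
  obtain ⟨K, hK⟩ := hf.window_bound hc he
  refine ⟨K + 1, ?_⟩
  filter_upwards [hK] with M hM n₀ N hN
  refine hM (fun t => f (n₀ - 1 - t)) N (fun t => ⟨_, rfl⟩)
    (hf.shiftInvariant_backward (by omega)) ?_
  have := (hf.identDistrib (n₀ - K) (F := fun a => |(∑ s ∈ Finset.range K, a s) / K|)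
    (by fun_prop)).integral_eq
  simp only [blockMean, zero_add]
  rw [← this]
  refine integral_congr_ae (ae_of_all _ fun ω => ?_)
  -- The first block read backwards from `n₀` consists of the `K` terms from `n₀ - K` on.
  change |(∑ s ∈ Finset.range K, f (n₀ - 1 - s) ω) / K| = |(∑ s ∈ Finset.range K, f (s + (n₀ - K)) ω) / K|
  rw [← Finset.sum_range_reflect]
  congr 2
  refine Finset.sum_congr rfl fun s hs => ?_
  have := Finset.mem_range.mp hs
  congr 1
  omega

/-- The partial sums of a sample are uniformly small relative to the sample size. -/
lemma sample_bound [IsProbabilityMeasure μ] (hf : StationarySmallMean μ f) {c e : ℝ} (hc : 0 < c)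
    (he : 0 < e) : ∀ᶠ T : ℕ in atTop,
      μ.real {ω | ∃ m, m ≤ T ∧ c * T < |∑ t ∈ Finset.range m, f t ω|} ≤ e := by
  obtain ⟨M, hM⟩ := (hf.forward_bound hc (half_pos he)).exists
  set A : ℝ := ∑ t ∈ Finset.range M, ∫ ω, |f t ω| ∂μ with hA
  have hlim : Tendsto (fun T : ℕ => A / c / (T : ℝ)) atTop (𝓝 0) :=
    tendsto_const_div_atTop_nhds_zero_nat _
  filter_upwards [hlim.eventually_lt_const (half_pos he), eventually_ge_atTop 1] with T hT hT1
  have hT0 : (0 : ℝ) < T := by exact_mod_cast hT1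
  -- Partial sums with fewer than `M` terms are dominated by one fixed integrable variable, so
  -- Markov's inequality makes them negligible against `c * T`.
  have h1 : μ.real {ω | c * T ≤ ∑ t ∈ Finset.range M, |f t ω|} ≤ e / 2 := by
    have := mul_meas_ge_le_integral_of_nonneg (μ := μ)
      (f := fun ω => ∑ t ∈ Finset.range M, |f t ω|)
      (ae_of_all _ fun ω => Finset.sum_nonneg fun t _ => abs_nonneg _)
      (integrable_finsetSum _ fun t _ => (hf.integrable t).abs) (c * T)
    rw [integral_finsetSum _ fun t _ => (hf.integrable t).abs, ← hA, mul_comm,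
      ← le_div_iff₀ (by positivity), ← div_div] at this
    exact this.trans hT.le
  refine le_trans (measureReal_mono ?_)
    ((measureReal_union_le _ _).trans ((add_le_add (hM 0 T) h1).trans_eq (add_halves e)))
  rintro ω ⟨m, hmT, hlt⟩
  have hmT' : (m : ℝ) ≤ T := by exact_mod_cast hmT
  rcases le_or_gt M m with hMm | hmM
  · left
    refine ⟨m, hMm, hmT, ?_⟩
    simp only [zero_add]
    nlinarith
  · right
    change c * T ≤ ∑ t ∈ Finset.range M, |f t ω|
    refine (hlt.le.trans (Finset.abs_sum_le_sum_abs _ _)).trans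
      (Finset.sum_le_sum_of_subset_of_nonneg ?_ fun t _ _ => abs_nonneg _)
    exact Finset.range_mono hmM.le

end StationarySmallMean
end Stationary

/-! ### Moments of the data generating process -/

/-- The deviation of the second moments of covariates and error from their expectations. -/
def momentDev {dx : ℕ} (S : Matrix (Fin dx) (Fin dx) ℝ) :
    (Fin dx × Fin dx) ⊕ Fin dx → (Fin dx → ℝ) × ℝ → ℝ
  | .inl (i, j), p => p.1 i * p.1 j - S i j
  | .inr i, p => p.1 i * p.2

lemma measurable_momentDev {dx : ℕ} (S : Matrix (Fin dx) (Fin dx) ℝ)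
    (q : (Fin dx × Fin dx) ⊕ Fin dx) : Measurable (momentDev S q) := by
  rcases q with ⟨i, j⟩ | i
  · change Measurable fun p : (Fin dx → ℝ) × ℝ => p.1 i * p.1 j - S i j
    fun_prop
  · change Measurable fun p : (Fin dx → ℝ) × ℝ => p.1 i * p.2
    fun_prop

section Probability

variable {Ω : Type*} [MeasurableSpace Ω] {μ : Measure Ω} {dx dz : ℕ} {X : Set (Fin dx → ℝ)}
  {x : ℕ → Ω → Fin dx → ℝ} {ε : ℕ → Ω → ℝ} {δ₀ : Fin dz → ℝ} {σ₀sq : ℝ}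
  {SigmaX : Matrix (Fin dx) (Fin dx) ℝ}

namespace RegularDGP

lemma exists_bound (h : RegularDGP μ X x ε δ₀ σ₀sq SigmaX) :
    ∃ B : ℝ, 0 < B ∧ ∀ᵐ ω ∂μ, ∀ t i, |x t ω i| ≤ B := by
  obtain ⟨B, hB0, hB⟩ := h.bounded_X.exists_pos_norm_le
  refine ⟨B, hB0, ?_⟩
  filter_upwards [ae_all_iff.mpr h.x_mem] with ω hω t i
  exact (norm_le_pi_norm (x t ω) i).trans (hB _ (hω t))

lemma integral_err_sq [IsProbabilityMeasure μ] (h : RegularDGP μ X x ε δ₀ σ₀sq SigmaX) (t : ℕ) :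
    ∫ ω, ε t ω ^ 2 ∂μ = σ₀sq := by
  rw [← integral_condExp (h.measurable_x t).comap_le, integral_congr_ae (h.err_condVar t)]
  simp

lemma integrable_err_sq (h : RegularDGP μ X x ε δ₀ σ₀sq SigmaX) (t : ℕ) :
    Integrable (fun ω => ε t ω ^ 2) μ :=
  (h.err_memLp t).integrable_sq

lemma integrable_coord_mul_coord [IsProbabilityMeasure μ] (h : RegularDGP μ X x ε δ₀ σ₀sq SigmaX)
    (t : ℕ) (i j : Fin dx) : Integrable (fun ω => x t ω i * x t ω j) μ := by
  obtain ⟨B, hB0, hB⟩ := h.exists_bound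
  have hm : ∀ i, Measurable fun ω => x t ω i := fun i =>
    (measurable_pi_apply i).comp (h.measurable_x t)
  refine Integrable.of_bound ((hm i).mul (hm j)).aestronglyMeasurable (B * B) ?_
  filter_upwards [hB] with ω hω
  rw [Real.norm_eq_abs, abs_mul]
  exact mul_le_mul (hω t i) (hω t j) (abs_nonneg _) hB0.le

lemma integrable_coord_mul_err [IsProbabilityMeasure μ] (h : RegularDGP μ X x ε δ₀ σ₀sq SigmaX)
    (t : ℕ) (i : Fin dx) : Integrable (fun ω => x t ω i * ε t ω) μ := by
  obtain ⟨B, hB0, hB⟩ := h.exists_bound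
  have hm : ∀ i, Measurable fun ω => x t ω i := fun i =>
    (measurable_pi_apply i).comp (h.measurable_x t)
  refine ((h.err_memLp t).integrable (by norm_num)).bdd_mul (c := B)
    (hm i).aestronglyMeasurable ?_
  filter_upwards [hB] with ω hω using hω t i

lemma integral_coord_mul_err [IsProbabilityMeasure μ] (h : RegularDGP μ X x ε δ₀ σ₀sq SigmaX)
    (t : ℕ) (i : Fin dx) : ∫ ω, x t ω i * ε t ω ∂μ = 0 := by
  have hle := (h.measurable_x t).comap_le
  have hm : StronglyMeasurable[MeasurableSpace.comap (x t) inferInstance] fun ω => x t ω i :=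
    Measurable.stronglyMeasurable
      ((measurable_pi_apply i).comp (comap_measurable (x t)))
  have h1 := condExp_mul_of_stronglyMeasurable_left hm (h.integrable_coord_mul_err t i)
    ((h.err_memLp t).integrable (by norm_num))
  have h2 : ∫ ω, x t ω i * ε t ω ∂μ
      = ∫ ω, (μ[(fun ω => x t ω i) * ε t | MeasurableSpace.comap (x t) inferInstance]) ω ∂μ :=
    (integral_condExp hle).symm
  rw [h2, integral_congr_ae h1]
  have h3 : (fun ω => x t ω i) * μ[ε t | MeasurableSpace.comap (x t) inferInstance]
      =ᵐ[μ] fun _ => 0 := by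
    filter_upwards [h.err_condMean t] with ω hω
    simp [hω]
  rw [integral_congr_ae h3]
  simp

/-- Boundedness of the covariates gives square integrability. Small averages come from the
probability limit of the second moments, and for `x_t ε_t` from the partial sum rate on one interior
window, moved to the origin by stationarity. -/
lemma stationarySmallMean [IsProbabilityMeasure μ] (h : RegularDGP μ X x ε δ₀ σ₀sq SigmaX)
    (q : (Fin dx × Fin dx) ⊕ Fin dx) :
    StationarySmallMean μ fun t ω => momentDev SigmaX q (x t ω, ε t ω) := by
  obtain ⟨B, hB0, hB⟩ := h.exists_bound
  have hY : ∀ t, Measurable fun ω => (x t ω, ε t ω) := fun t =>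
    (h.measurable_x t).prodMk (h.measurable_err t)
  have hmeas : ∀ t, Measurable fun ω => momentDev SigmaX q (x t ω, ε t ω) := fun t =>
    (measurable_momentDev SigmaX q).comp (hY t)
  have hmap : Measurable fun (y : ℕ → (Fin dx → ℝ) × ℝ) (t : ℕ) => momentDev SigmaX q (y t) :=
    measurable_pi_iff.mpr fun t => (measurable_momentDev SigmaX q).comp (measurable_pi_apply t)
  refine ⟨hmeas, h.stationary.comp hmap, ?_, ?_⟩
  · rcases q with ⟨i, j⟩ | i
    · refine Integrable.of_bound ((hmeas 0).pow_const 2).aestronglyMeasurable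
        ((B * B + |SigmaX i j|) ^ 2) ?_
      filter_upwards [hB] with ω hω
      rw [Real.norm_eq_abs, abs_pow]
      refine pow_le_pow_left₀ (abs_nonneg _) ((abs_sub _ _).trans ?_) 2
      simp only
      rw [abs_mul]
      have := mul_le_mul (hω 0 i) (hω 0 j) (abs_nonneg _) hB0.le
      linarith
    · have h1 := (h.integrable_err_sq 0).const_mul (B ^ 2)
      refine h1.mono' ((hmeas 0).pow_const 2).aestronglyMeasurable ?_
      filter_upwards [hB] with ω hω
      simp only [momentDev]
      rw [Real.norm_eq_abs, mul_pow, abs_mul, abs_pow, abs_pow, sq_abs (ε 0 ω)]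
      have := pow_le_pow_left₀ (abs_nonneg _) (hω 0 i) 2
      gcongr
  · rcases q with ⟨i, j⟩ | i
    · intro δ hδ e he
      have h1 := (tendstoInMeasure_iff_measureReal_dist.mp (h.secondMoment_plim i j)) δ hδ
      obtain ⟨K, hKe, hK⟩ := ((h1.eventually_lt_const he).and (eventually_ge_atTop 1)).exists
      refine ⟨K, hK, le_trans (measureReal_mono fun ω hω => ?_) hKe.le⟩
      have hK0 : (0 : ℝ) < K := by exact_mod_cast hK
      change δ ≤ dist _ _
      rw [Real.dist_eq]
      refine le_of_lt (lt_of_lt_of_eq hω ?_)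
      simp only [blockMean, momentDev, zero_add, Finset.sum_sub_distrib, Finset.sum_const,
        Finset.card_range, nsmul_eq_mul]
      congr 1
      field_simp
    · intro δ hδ e he
      obtain ⟨C, hC0, k, hk⟩ := h.partialSum_err (1 / 3) (2 / 3) (by norm_num) (by norm_num)
        (by norm_num) i e he
      have hlim : Tendsto (fun T : ℕ => C * (1 / √(T : ℝ))) atTop (𝓝 (C * 0)) := by
        refine Tendsto.const_mul C ?_
        simp only [one_div]
        exact (Real.tendsto_sqrt_atTop.comp tendsto_natCast_atTop_atTop).inv_tendsto_atTop
      rw [mul_zero] at hlim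
      -- For `T ≥ 6` the window between `T / 3` and `2T / 3` has at least `T / 6` dates, so a window
      -- mean above `δ` forces the sum divided by `T` above `δ / 6`.
      obtain ⟨T, hT, hTk, hT6⟩ := ((hlim.eventually_lt_const (show 0 < δ / 6 by positivity)).and
        ((eventually_ge_atTop k).and (eventually_ge_atTop 6))).exists
      have hT6' : (6 : ℝ) ≤ T := by exact_mod_cast hT6
      obtain ⟨ha1, ha2⟩ := strictFloor_spec (a := 1 / 3 * (T : ℝ)) (by positivity)
      obtain ⟨hb1, hb2⟩ := strictFloor_spec (a := 2 / 3 * (T : ℝ)) (by positivity)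
      set n₁ := strictFloor (1 / 3 * (T : ℝ)) with hn₁
      set n₂ := strictFloor (2 / 3 * (T : ℝ)) with hn₂
      have hn : n₁ < n₂ := by
        have : (n₁ : ℝ) < n₂ := by linarith
        exact_mod_cast this
      have hKc : ((n₂ - n₁ : ℕ) : ℝ) = n₂ - n₁ := by
        rw [Nat.cast_sub hn.le]
      refine ⟨n₂ - n₁, by omega, ?_⟩
      refine le_trans ?_ (hk T hTk).le
      have hid := (identDistrib_shift hmeas (h.stationary.comp hmap) n₁).comp
        (u := fun a : ℕ → ℝ => |(∑ s ∈ Finset.range (n₂ - n₁), a s) / ((n₂ - n₁ : ℕ) : ℝ)|)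
        (by fun_prop)
      have hmeq := hid.measure_mem_eq (s := Ioi δ) measurableSet_Ioi
      have hset : {ω | δ < |blockMean (fun t ω => momentDev SigmaX (.inr i) (x t ω, ε t ω))
          (n₂ - n₁) 0 ω|} = ((fun a : ℕ → ℝ =>
            |(∑ s ∈ Finset.range (n₂ - n₁), a s) / ((n₂ - n₁ : ℕ) : ℝ)|) ∘ fun ω t =>
              momentDev SigmaX (.inr i) (x t ω, ε t ω)) ⁻¹' Ioi δ := by
        ext ω
        simp [blockMean]
      rw [hset, measureReal_def]
      erw [← hmeq]
      rw [← measureReal_def]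
      refine measureReal_mono fun ω hω => ?_
      have hω' : δ < |(∑ s ∈ Finset.range (n₂ - n₁), x (s + n₁) ω i * ε (s + n₁) ω)
        / ((n₂ - n₁ : ℕ) : ℝ)| := hω
      change C * (1 / √(T : ℝ)) < |1 / (T : ℝ) * ∑ t ∈ Finset.Ico n₁ n₂, x t ω i * ε t ω|
      rw [Finset.sum_Ico_eq_sum_range]
      simp only [add_comm n₁]
      have hK0 : (0 : ℝ) < ((n₂ - n₁ : ℕ) : ℝ) := by rw [hKc]; linarith
      rw [abs_div, abs_of_pos hK0, lt_div_iff₀ hK0, hKc] at hω'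
      rw [abs_mul, abs_of_pos (show (0 : ℝ) < 1 / T by positivity), one_div_mul_eq_div,
        lt_div_iff₀ (by positivity)]
      nlinarith

/-- The errors at any given date are bounded in probability. -/
lemma exists_err_bound [IsProbabilityMeasure μ] (h : RegularDGP μ X x ε δ₀ σ₀sq SigmaX) {e : ℝ}
    (he : 0 < e) : ∃ K : ℝ, 0 < K ∧ ∀ t, μ.real {ω | K < |ε t ω|} ≤ e := by
  have hs := h.variance_pos
  refine ⟨√(σ₀sq / e), by positivity, fun t => ?_⟩
  refine (measureReal_abs_gt_le (h.integrable_err_sq t) (by positivity)).trans_eq ?_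
  rw [h.integral_err_sq, Real.sq_sqrt (by positivity)]
  field_simp

/-- The squared errors have no assumed fourth moment, so Chebyshev's inequality is not available;
independence and the strong law replace it. -/
lemma err_sq_sum_bound [IsProbabilityMeasure μ] (h : RegularDGP μ X x ε δ₀ σ₀sq SigmaX) {c e : ℝ}
    (hc : 0 < c) (he : 0 < e) : ∀ᶠ T : ℕ in atTop,
      μ.real {ω | c * T < |∑ t ∈ Finset.range T, ε t ω ^ 2 - T * σ₀sq|} ≤ e := by
  have h1 := strong_law_ae_real (μ := μ) (fun t ω => ε t ω ^ 2) (h.integrable_err_sq 0)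
    (fun s t hst => (h.err_indep.indepFun hst).comp (φ := fun y => y ^ 2) (ψ := fun y => y ^ 2)
      (by fun_prop) (by fun_prop))
    (fun t => (h.err_identDistrib t).comp (u := fun y => y ^ 2) (by fun_prop))
  have h2 := tendstoInMeasure_of_tendsto_ae (fun T => ((Finset.measurable_sum _ fun t _ =>
    (h.measurable_err t).pow_const 2).div_const _).aestronglyMeasurable) h1
  have h3 := (tendstoInMeasure_iff_measureReal_dist.mp h2) c hc
  filter_upwards [h3.eventually_lt_const he, eventually_ge_atTop 1] with T hT hT1
  have hT0 : (0 : ℝ) < T := by exact_mod_cast hT1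
  refine le_trans (measureReal_mono fun ω hω => ?_) hT.le
  change c ≤ dist _ _
  rw [Real.dist_eq, h.integral_err_sq]
  have hω' : c * T < |∑ t ∈ Finset.range T, ε t ω ^ 2 - T * σ₀sq| := hω
  have e1 : ∑ t ∈ Finset.range T, ε t ω ^ 2 - T * σ₀sq
      = T * ((∑ t ∈ Finset.range T, ε t ω ^ 2) / T - σ₀sq) := by
    field_simp
  rw [e1, abs_mul, abs_of_pos hT0, mul_comm] at hω'
  exact (lt_of_mul_lt_mul_left hω' hT0.le).le

end RegularDGP

end Probability

/-! ### Regular samples have high probability -/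

/-- The moments of a sample of size `T` are within `c` of their expectations, for the whole
sample, its initial segments, and the segments of at least `M` dates adjacent to `n₀`. -/
structure SampleRegular {dx : ℕ} (S : Matrix (Fin dx) (Fin dx) ℝ) (σ₀sq κ c : ℝ) (M T n₀ : ℕ)
    (x : ℕ → Fin dx → ℝ) (ε : ℕ → ℝ) : Prop where
  initial : ∀ q n, n ≤ T → |∑ t ∈ Finset.range n, momentDev S q (x t, ε t)| ≤ c * T
  err_sq : |∑ t ∈ Finset.range T, ε t ^ 2 - T * σ₀sq| ≤ c * T
  after : ∀ q n, n₀ + M ≤ n → n ≤ T →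
    |∑ t ∈ Finset.Ico n₀ n, momentDev S q (x t, ε t)| ≤ c * (n - n₀)
  before : ∀ q n, n + M ≤ n₀ → (n₀ : ℝ) - n ≤ κ * T →
    |∑ t ∈ Finset.Ico n n₀, momentDev S q (x t, ε t)| ≤ c * (n₀ - n)

section Probability

variable {Ω : Type*} [MeasurableSpace Ω] {μ : Measure Ω} {dx dz : ℕ} {X : Set (Fin dx → ℝ)}
  {x : ℕ → Ω → Fin dx → ℝ} {ε : ℕ → Ω → ℝ} {δ₀ : Fin dz → ℝ} {σ₀sq : ℝ}
  {SigmaX : Matrix (Fin dx) (Fin dx) ℝ}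

lemma measureReal_exists_le [IsProbabilityMeasure μ] {ι : Type*} [Fintype ι] {p : ι → Ω → Prop}
    {e : ℝ} (he : 0 ≤ e) (h : ∀ i, μ.real {ω | p i ω} ≤ e / (Fintype.card ι + 1)) :
    μ.real {ω | ∃ i, p i ω} ≤ e := by
  have h1 : {ω | ∃ i, p i ω} = ⋃ i, {ω | p i ω} := by
    ext ω
    simp
  rw [h1]
  refine (measureReal_iUnion_fintype_le _).trans ((Finset.sum_le_sum fun i _ => h i).trans ?_)
  rw [Finset.sum_const, Finset.card_univ, nsmul_eq_mul, mul_div_assoc', div_le_iff₀ (by positivity)]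
  nlinarith

lemma sum_Ico_eq_sum_range_sub {a : ℕ → ℝ} {n m : ℕ} (h : n ≤ m) :
    ∑ t ∈ Finset.Ico n m, a t = ∑ t ∈ Finset.range (m - n), a (m - 1 - t) := by
  rw [Finset.sum_Ico_eq_sum_range, ← Finset.sum_range_reflect]
  refine Finset.sum_congr rfl fun t ht => ?_
  have := Finset.mem_range.mp ht
  congr 1
  omega

lemma RegularDGP.exists_sampleRegular [IsProbabilityMeasure μ]
    (h : RegularDGP μ X x ε δ₀ σ₀sq SigmaX) {τ₀ κ c e : ℝ} (hκ : 0 < κ) (hκτ : κ < τ₀)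
    (hc : 0 < c) (he : 0 < e) : ∃ M : ℕ, ∀ᶠ T : ℕ in atTop,
      μ.real {ω | ¬ SampleRegular SigmaX σ₀sq κ c M T (strictFloor (τ₀ * T)) (fun t => x t ω)
        (fun t => ε t ω)} ≤ e := by
  set ι := (Fin dx × Fin dx) ⊕ Fin dx
  set N : ℝ := (Fintype.card ι : ℝ) + 1 with hN
  have hN0 : 0 < N := by positivity
  have he4 : 0 < e / 4 := by positivity
  have heN : 0 < e / 4 / N := by positivity
  choose D hD using fun q : ι => (h.stationarySmallMean q).backward_bound hc heN
  obtain ⟨M, hMf, hMb⟩ := ((eventually_all.mpr fun q : ι =>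
    (h.stationarySmallMean q).forward_bound hc heN).and (eventually_all.mpr hD)).exists
  refine ⟨M, ?_⟩
  have hlim : Tendsto (fun T : ℕ => (τ₀ - κ) * (T : ℝ)) atTop atTop :=
    tendsto_natCast_atTop_atTop.const_mul_atTop (by linarith)
  filter_upwards [eventually_all.mpr fun q : ι => (h.stationarySmallMean q).sample_bound hc heN,
    h.err_sq_sum_bound hc he4,
    hlim.eventually_ge_atTop (((Finset.univ.sup D : ℕ) : ℝ) + 1),
    eventually_ge_atTop 1] with T hT1 hT2 hT3 hT4
  have hT0 : (0 : ℝ) < T := by exact_mod_cast hT4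
  set n₀ := strictFloor (τ₀ * T) with hn₀
  obtain ⟨hn1, hn2⟩ := strictFloor_spec (a := τ₀ * T) (mul_pos (hκ.trans hκτ) hT0)
  have hA := measureReal_exists_le he4.le hT1
  have hB := measureReal_exists_le he4.le fun q => hMf q n₀ (T - n₀)
  -- The backward windows, of length at most `κT`, end at `n₀ ≥ τ₀T - 1`. As `κ < τ₀`, the reserve
  -- of `D q` dates before them exists for large `T`.
  have hC := measureReal_exists_le he4.le fun q => hMb q n₀ ⌊κ * T⌋₊ (by
    have h1 := Nat.floor_le (show 0 ≤ κ * T by positivity)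
    have h2 : (D q : ℝ) ≤ (Finset.univ.sup D : ℕ) := by
      exact_mod_cast Finset.le_sup (f := D) (Finset.mem_univ q)
    have : ((⌊κ * T⌋₊ + D q : ℕ) : ℝ) ≤ n₀ := by push_cast; linarith
    exact_mod_cast this)
  refine le_trans (measureReal_mono ?_ (measure_ne_top μ _)) ((measureReal_union_le _ _).trans
    (add_le_add ((measureReal_union_le _ _).trans (add_le_add hA hT2))
      ((measureReal_union_le _ _).trans (add_le_add hB hC)))) |>.trans_eq (by ring)
  intro ω hω
  by_contra hcon
  simp only [mem_union, mem_ofPred_eq, not_or, not_exists, not_and, not_lt] at hcon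
  obtain ⟨⟨h1, h2⟩, h3, h4⟩ := hcon
  refine hω ⟨fun q n hn => h1 q n hn, h2, fun q n hn hnT => ?_, fun q n hn hnT => ?_⟩
  · have := h3 q (n - n₀) (by omega) (by omega)
    rw [Finset.sum_Ico_eq_sum_range]
    rwa [Nat.cast_sub (by omega)] at this
  · have hcast : ((n₀ - n : ℕ) : ℝ) = n₀ - n := Nat.cast_sub (by omega)
    have := h4 q (n₀ - n) (by omega) (Nat.le_floor (by rwa [hcast]))
    rw [sum_Ico_eq_sum_range_sub (by omega)]
    rwa [hcast] at this

end Probability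

/-! ### Deterministic likelihood comparisons -/

section Deterministic

variable {dx dz : ℕ}

/-- The quadratic form of the matrix `S`. -/
def quadForm (S : Matrix (Fin dx) (Fin dx) ℝ) (w : Fin dx → ℝ) : ℝ := w ⬝ᵥ S *ᵥ w

lemma quadForm_eq_sum (S : Matrix (Fin dx) (Fin dx) ℝ) (w : Fin dx → ℝ) :
    quadForm S w = ∑ i, ∑ j, w i * w j * S i j := by
  simp only [quadForm, dotProduct, Matrix.mulVec, Finset.mul_sum]
  exact Finset.sum_congr rfl fun i _ => Finset.sum_congr rfl fun j _ => by ring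

lemma quadForm_zero (S : Matrix (Fin dx) (Fin dx) ℝ) : quadForm S 0 = 0 := by
  simp [quadForm]

lemma continuous_quadForm (S : Matrix (Fin dx) (Fin dx) ℝ) : Continuous (quadForm S) := by
  have : quadForm S = fun w => ∑ i, ∑ j, w i * w j * S i j := funext (quadForm_eq_sum S)
  rw [this]
  fun_prop

/-- The change of a squared residual caused by the error `w` in the regression coefficient. -/
def sqDev (x : ℕ → Fin dx → ℝ) (ε : ℕ → ℝ) (w : Fin dx → ℝ) (t : ℕ) : ℝ :=
  (ε t - x t ⬝ᵥ w) ^ 2 - ε t ^ 2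

/-- Expanding the square separates the coefficient error `w` from the random moments. Bounds on
finitely many moments thereby hold uniformly over bounded `w`. -/
lemma sum_sqDev_sub_eq (S : Matrix (Fin dx) (Fin dx) ℝ) (x : ℕ → Fin dx → ℝ) (ε : ℕ → ℝ)
    (w : Fin dx → ℝ) (J : Finset ℕ) :
    ∑ t ∈ J, sqDev x ε w t - J.card * quadForm S w
      = ∑ i, ∑ j, w i * w j * (∑ t ∈ J, momentDev S (.inl (i, j)) (x t, ε t))
        - 2 * ∑ i, w i * ∑ t ∈ J, momentDev S (.inr i) (x t, ε t) := by
  have h1 : ∀ t, sqDev x ε w t - quadForm S w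
      = ∑ i, ∑ j, w i * w j * momentDev S (.inl (i, j)) (x t, ε t)
        - 2 * ∑ i, w i * momentDev S (.inr i) (x t, ε t) := fun t => by
    simp only [sqDev, momentDev, mul_sub, Finset.sum_sub_distrib, ← quadForm_eq_sum]
    have e1 : ∑ i, ∑ j, w i * w j * (x t i * x t j) = (x t ⬝ᵥ w) ^ 2 := by
      rw [sq, dotProduct, Finset.sum_mul_sum]
      exact Finset.sum_congr rfl fun i _ => Finset.sum_congr rfl fun j _ => by ring
    have e2 : ∑ i, w i * (x t i * ε t) = (x t ⬝ᵥ w) * ε t := by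
      rw [dotProduct, Finset.sum_mul]
      exact Finset.sum_congr rfl fun i _ => by ring
    rw [e1, e2]
    ring
  rw [← nsmul_eq_mul, ← Finset.sum_const, ← Finset.sum_sub_distrib, Finset.sum_congr rfl
    fun t _ => h1 t, Finset.sum_sub_distrib, ← Finset.mul_sum]
  congr 1
  · rw [Finset.sum_comm]
    refine Finset.sum_congr rfl fun i _ => ?_
    rw [Finset.sum_comm]
    exact Finset.sum_congr rfl fun j _ => by rw [Finset.mul_sum]
  · rw [Finset.sum_comm]
    congr 1
    exact Finset.sum_congr rfl fun i _ => by rw [Finset.mul_sum]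

lemma abs_sum_sqDev_sub_le {S : Matrix (Fin dx) (Fin dx) ℝ} {x : ℕ → Fin dx → ℝ} {ε : ℕ → ℝ}
    {w : Fin dx → ℝ} {J : Finset ℕ} {s B : ℝ}
    (hJ : ∀ q, |∑ t ∈ J, momentDev S q (x t, ε t)| ≤ s) (hw : ∑ i, |w i| ≤ B) (hs : 0 ≤ s) :
    |∑ t ∈ J, sqDev x ε w t - J.card * quadForm S w| ≤ s * (B ^ 2 + 2 * B) := by
  rw [sum_sqDev_sub_eq]
  have hB : 0 ≤ ∑ i, |w i| := Finset.sum_nonneg fun i _ => abs_nonneg _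
  have h1 : |∑ i, ∑ j, w i * w j * (∑ t ∈ J, momentDev S (.inl (i, j)) (x t, ε t))|
      ≤ s * (∑ i, |w i|) ^ 2 := by
    rw [sq, Finset.sum_mul_sum, Finset.mul_sum]
    refine (Finset.abs_sum_le_sum_abs _ _).trans (Finset.sum_le_sum fun i _ => ?_)
    rw [Finset.mul_sum]
    refine (Finset.abs_sum_le_sum_abs _ _).trans (Finset.sum_le_sum fun j _ => ?_)
    rw [abs_mul, abs_mul, mul_comm s]
    exact mul_le_mul_of_nonneg_left (hJ _) (by positivity)
  have h2 : |∑ i, w i * ∑ t ∈ J, momentDev S (.inr i) (x t, ε t)| ≤ s * ∑ i, |w i| := by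
    rw [Finset.mul_sum]
    refine (Finset.abs_sum_le_sum_abs _ _).trans (Finset.sum_le_sum fun i _ => ?_)
    rw [abs_mul, mul_comm s]
    exact mul_le_mul_of_nonneg_left (hJ _) (by positivity)
  have h3 : (∑ i, |w i|) ^ 2 ≤ B ^ 2 := pow_le_pow_left₀ hB hw 2
  have h4 := mul_le_mul_of_nonneg_left h3 hs
  have h5 := mul_le_mul_of_nonneg_left hw hs
  refine (abs_sub _ _).trans ?_
  rw [abs_mul, abs_two]
  nlinarith

/-- The error in the coefficient of `x_t`, where `a` and `a₀` tell whether the date `t` lies after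
the break of the model and after the true break. -/
def coefDev (R : Matrix (Fin dx) (Fin dz) ℝ) (γ₀ γ : (Fin dx → ℝ) × (Fin dz → ℝ)) (a a₀ : Bool) :
    Fin dx → ℝ :=
  γ.1 - γ₀.1 + (if a then R *ᵥ γ.2 else 0) - if a₀ then R *ᵥ γ₀.2 else 0

lemma continuous_coefDev (R : Matrix (Fin dx) (Fin dz) ℝ) (γ₀ : (Fin dx → ℝ) × (Fin dz → ℝ))
    (a a₀ : Bool) : Continuous fun γ => coefDev R γ₀ γ a a₀ := by
  unfold coefDev
  cases a <;> simp only [Bool.false_eq_true, if_false, if_true] <;> fun_prop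

/-- The residual sum of squares of the model with slopes `γ` and break after `n` dates. -/
def rss (R : Matrix (Fin dx) (Fin dz) ℝ) (T n₀ : ℕ) (γ₀ : (Fin dx → ℝ) × (Fin dz → ℝ))
    (x : ℕ → Fin dx → ℝ) (ε : ℕ → ℝ) (γ : (Fin dx → ℝ) × (Fin dz → ℝ)) (n : ℕ) : ℝ :=
  ∑ t ∈ Finset.range T, (ε t - x t ⬝ᵥ coefDev R γ₀ γ (n ≤ t) (n₀ ≤ t)) ^ 2

/-- The log likelihood of the parameter `θ` and a break after `n` dates. -/
def logLik (R : Matrix (Fin dx) (Fin dz) ℝ) (T n₀ : ℕ) (γ₀ : (Fin dx → ℝ) × (Fin dz → ℝ))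
    (x : ℕ → Fin dx → ℝ) (ε : ℕ → ℝ) (θ : Param dx dz) (n : ℕ) : ℝ :=
  -(T / 2 * Real.log (2 * Real.pi * θ.2)) - rss R T n₀ γ₀ x ε θ.1 n / (2 * θ.2)

lemma normalLik_eq_exp_logLik (R : Matrix (Fin dx) (Fin dz) ℝ) (T : ℕ)
    (γ₀ : (Fin dx → ℝ) × (Fin dz → ℝ)) (τ₀ τ : ℝ) (x : ℕ → Fin dx → ℝ) (ε : ℕ → ℝ)
    {θ : Param dx dz} (hθ : 0 < θ.2) :
    normalLik R T (fun t => regMean R T τ₀ γ₀ t (x t) + ε t) x θ τ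
      = Real.exp (logLik R T (strictFloor (τ₀ * T)) γ₀ x ε θ (strictFloor (τ * T))) := by
  have hpos : 0 < 2 * Real.pi * θ.2 := by positivity
  have h1 : 1 / √(2 * Real.pi * θ.2) = Real.exp (-(1 / 2 * Real.log (2 * Real.pi * θ.2))) := by
    rw [Real.exp_neg, one_div, Real.sqrt_eq_rpow, Real.rpow_def_of_pos hpos, mul_comm]
  unfold normalLik logLik rss
  rw [h1, Finset.prod_mul_distrib, Finset.prod_const, Finset.card_range, ← Real.exp_nat_mul,
    ← Real.exp_sum, ← Real.exp_add, Finset.sum_div]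
  congr 1
  have h2 : ∀ t, regMean R T τ₀ γ₀ t (x t) + ε t - regMean R T τ θ.1 t (x t)
      = ε t - x t ⬝ᵥ coefDev R γ₀ θ.1 (strictFloor (τ * T) ≤ t) (strictFloor (τ₀ * T) ≤ t) := by
    intro t
    have hR : ∀ v : Fin dz → ℝ, (Rᵀ *ᵥ x t) ⬝ᵥ v = x t ⬝ᵥ R *ᵥ v := fun v => by
      rw [Matrix.mulVec_transpose, Matrix.dotProduct_mulVec]
    unfold regMean coefDev
    simp only [hR, decide_eq_true_eq, dotProduct_add, dotProduct_sub]
    split_ifs <;> (try simp only [dotProduct_zero]) <;> ring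
  simp only [h2, neg_div, Finset.sum_neg_distrib]
  ring

variable {R : Matrix (Fin dx) (Fin dz) ℝ} {γ₀ γ : (Fin dx → ℝ) × (Fin dz → ℝ)}
  {x : ℕ → Fin dx → ℝ} {ε : ℕ → ℝ} {T n n₀ : ℕ}

lemma rss_sub_eq_sum_sqDev :
    rss R T n₀ γ₀ x ε γ n - ∑ t ∈ Finset.range T, ε t ^ 2
      = ∑ t ∈ Finset.range T, sqDev x ε (coefDev R γ₀ γ (n ≤ t) (n₀ ≤ t)) t := by
  simp only [rss, sqDev, Finset.sum_sub_distrib]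

lemma sum_sqDev_Ico {k l : ℕ} {a a₀ : Bool} (h : ∀ t, k ≤ t → t < l → (n ≤ t ↔ a = true))
    (h₀ : ∀ t, k ≤ t → t < l → (n₀ ≤ t ↔ a₀ = true)) :
    ∑ t ∈ Finset.Ico k l, sqDev x ε (coefDev R γ₀ γ (n ≤ t) (n₀ ≤ t)) t
      = ∑ t ∈ Finset.Ico k l, sqDev x ε (coefDev R γ₀ γ a a₀) t := by
  refine Finset.sum_congr rfl fun t ht => ?_
  obtain ⟨h1, h2⟩ := Finset.mem_Ico.mp ht
  simp only [h t h1 h2, h₀ t h1 h2, Bool.decide_eq_true]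

lemma rss_sub_eq_of_le (hn : n₀ ≤ n) (hT : n ≤ T) :
    rss R T n₀ γ₀ x ε γ n - ∑ t ∈ Finset.range T, ε t ^ 2
      = ∑ t ∈ Finset.Ico 0 n₀, sqDev x ε (coefDev R γ₀ γ false false) t
        + ∑ t ∈ Finset.Ico n₀ n, sqDev x ε (coefDev R γ₀ γ false true) t
        + ∑ t ∈ Finset.Ico n T, sqDev x ε (coefDev R γ₀ γ true true) t := by
  rw [rss_sub_eq_sum_sqDev, Finset.range_eq_Ico, ← Finset.sum_Ico_consecutive _ (Nat.zero_le n) hT,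
    ← Finset.sum_Ico_consecutive _ (Nat.zero_le n₀) hn,
    sum_sqDev_Ico (k := 0) (a := false) (a₀ := false) (by simp; omega) (by simp),
    sum_sqDev_Ico (k := n₀) (a := false) (a₀ := true) (by simp) (by simp; omega),
    sum_sqDev_Ico (k := n) (a := true) (a₀ := true) (by simp; omega) (by simp; omega)]

lemma rss_sub_eq_of_ge (hn : n ≤ n₀) (hT : n₀ ≤ T) :
    rss R T n₀ γ₀ x ε γ n - ∑ t ∈ Finset.range T, ε t ^ 2
      = ∑ t ∈ Finset.Ico 0 n, sqDev x ε (coefDev R γ₀ γ false false) t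
        + ∑ t ∈ Finset.Ico n n₀, sqDev x ε (coefDev R γ₀ γ true false) t
        + ∑ t ∈ Finset.Ico n₀ T, sqDev x ε (coefDev R γ₀ γ true true) t := by
  rw [rss_sub_eq_sum_sqDev, Finset.range_eq_Ico, ← Finset.sum_Ico_consecutive _ (Nat.zero_le n₀) hT,
    ← Finset.sum_Ico_consecutive _ (Nat.zero_le n) hn,
    sum_sqDev_Ico (k := 0) (a := false) (a₀ := false) (by simp) (by simp; omega),
    sum_sqDev_Ico (k := n) (a := true) (a₀ := false) (by simp; omega) (by simp),
    sum_sqDev_Ico (k := n₀) (a := true) (a₀ := true) (by simp; omega) (by simp; omega)]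

lemma rss_sub_rss_of_le (hn : n₀ ≤ n) (hT : n ≤ T) :
    rss R T n₀ γ₀ x ε γ n - rss R T n₀ γ₀ x ε γ n₀
      = ∑ t ∈ Finset.Ico n₀ n, sqDev x ε (coefDev R γ₀ γ false true) t
        - ∑ t ∈ Finset.Ico n₀ n, sqDev x ε (coefDev R γ₀ γ true true) t := by
  have h1 := rss_sub_eq_of_le (R := R) (γ₀ := γ₀) (γ := γ) (x := x) (ε := ε) hn hT
  have h2 := rss_sub_eq_of_le (R := R) (γ₀ := γ₀) (γ := γ) (x := x) (ε := ε) le_rfl (hn.trans hT)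
  have h3 := Finset.sum_Ico_consecutive (sqDev x ε (coefDev R γ₀ γ true true)) hn hT
  simp only [Finset.Ico_self, Finset.sum_empty] at h2
  linarith

lemma rss_sub_rss_of_ge (hn : n ≤ n₀) (hT : n₀ ≤ T) :
    rss R T n₀ γ₀ x ε γ n - rss R T n₀ γ₀ x ε γ n₀
      = ∑ t ∈ Finset.Ico n n₀, sqDev x ε (coefDev R γ₀ γ true false) t
        - ∑ t ∈ Finset.Ico n n₀, sqDev x ε (coefDev R γ₀ γ false false) t := by
  have h1 := rss_sub_eq_of_ge (R := R) (γ₀ := γ₀) (γ := γ) (x := x) (ε := ε) hn hT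
  have h2 := rss_sub_eq_of_ge (R := R) (γ₀ := γ₀) (γ := γ) (x := x) (ε := ε) le_rfl hT
  have h3 := Finset.sum_Ico_consecutive (sqDev x ε (coefDev R γ₀ γ false false))
    (Nat.zero_le n) hn
  simp only [Finset.Ico_self, Finset.sum_empty] at h2
  linarith

lemma rss_true : rss R T n₀ γ₀ x ε γ₀ n₀ = ∑ t ∈ Finset.range T, ε t ^ 2 := by
  unfold rss coefDev
  refine Finset.sum_congr rfl fun t _ => ?_
  split_ifs <;> simp

/-- The limit, per observation, of the divergence between centred normal densities. -/
def varLoss (σ₀sq v : ℝ) : ℝ := 1 / 2 * Real.log (v / σ₀sq) + 1 / 2 * (σ₀sq / v - 1)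

/-- The three terms are the loss from a wrong variance, the sampling error of the squared errors,
and the excess of the residual sum of squares. -/
lemma logLik_true_sub_logLik {σ₀sq : ℝ} (hσ : 0 < σ₀sq) {θ : Param dx dz} (hθ : 0 < θ.2) :
    logLik R T n₀ γ₀ x ε (γ₀, σ₀sq) n₀ - logLik R T n₀ γ₀ x ε θ n
      = T * varLoss σ₀sq θ.2
        + (∑ t ∈ Finset.range T, ε t ^ 2 - T * σ₀sq) * (1 / (2 * θ.2) - 1 / (2 * σ₀sq))
        + (rss R T n₀ γ₀ x ε θ.1 n - ∑ t ∈ Finset.range T, ε t ^ 2) / (2 * θ.2) := by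
  simp only [logLik, rss_true, varLoss]
  rw [Real.log_div hθ.ne' hσ.ne', Real.log_mul (by positivity) hθ.ne',
    Real.log_mul (by positivity) hσ.ne']
  field_simp
  ring

variable {S : Matrix (Fin dx) (Fin dx) ℝ} {σ₀sq κ c s₁ B : ℝ} {M : ℕ} {θ : Param dx dz}

lemma SampleRegular.const_mul_nonneg (h : SampleRegular S σ₀sq κ c M T n₀ x ε) : 0 ≤ c * T :=
  (abs_nonneg _).trans h.err_sq

lemma SampleRegular.abs_sum_sqDev_Ico_sub_le (h : SampleRegular S σ₀sq κ c M T n₀ x ε)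
    {w : Fin dx → ℝ} (hw : ∑ i, |w i| ≤ B) {k l : ℕ} (hkl : k ≤ l) (hl : l ≤ T) :
    |∑ t ∈ Finset.Ico k l, sqDev x ε w t - ((l : ℝ) - k) * quadForm S w|
      ≤ 2 * (c * T) * (B ^ 2 + 2 * B) := by
  have h0 := h.const_mul_nonneg
  have h1 := abs_sum_sqDev_sub_le (S := S) (x := x) (ε := ε) (w := w) (J := Finset.Ico k l)
    -- A segment is a difference of two initial segments, hence the factor `2`.
    (s := 2 * (c * T)) (fun q => by
      rw [Finset.sum_Ico_eq_sub _ hkl]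
      have := h.initial q l hl
      have := h.initial q k (hkl.trans hl)
      exact (abs_sub _ _).trans (by linarith)) hw (by linarith)
  rwa [Nat.card_Ico, Nat.cast_sub hkl] at h1

/-- The constant in the uniform approximation of the log likelihood. -/
def errorConst (σ₀sq s₁ B : ℝ) : ℝ := 1 / (2 * s₁) + 1 / (2 * σ₀sq) + 3 * (B ^ 2 + 2 * B) / s₁

lemma SampleRegular.abs_logLik_sub_le (h : SampleRegular S σ₀sq κ c M T n₀ x ε) (hσ : 0 < σ₀sq)
    (hs : 0 < s₁) (hθ : s₁ ≤ θ.2) (hB : 0 ≤ B) {D : ℝ}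
    (hD : |rss R T n₀ γ₀ x ε θ.1 n - ∑ t ∈ Finset.range T, ε t ^ 2 - D|
      ≤ 6 * (c * T) * (B ^ 2 + 2 * B)) :
    |logLik R T n₀ γ₀ x ε (γ₀, σ₀sq) n₀ - logLik R T n₀ γ₀ x ε θ n
      - (T * varLoss σ₀sq θ.2 + D / (2 * θ.2))| ≤ c * T * errorConst σ₀sq s₁ B := by
  have hθ0 : 0 < θ.2 := hs.trans_le hθ
  have h0 := h.const_mul_nonneg
  rw [logLik_true_sub_logLik hσ hθ0]
  have e : ∀ p q r : ℝ, p + q + r / (2 * θ.2) - (p + D / (2 * θ.2))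
      = q + (r - D) * (1 / (2 * θ.2)) := fun p q r => by
    field_simp; ring
  rw [e]
  have hi : 1 / (2 * θ.2) ≤ 1 / (2 * s₁) := by gcongr
  have hi0 : 0 < 1 / (2 * θ.2) := by positivity
  have hj0 : 0 < 1 / (2 * σ₀sq) := by positivity
  have h1 : |(∑ t ∈ Finset.range T, ε t ^ 2 - T * σ₀sq) * (1 / (2 * θ.2) - 1 / (2 * σ₀sq))|
      ≤ c * T * (1 / (2 * s₁) + 1 / (2 * σ₀sq)) := by
    rw [abs_mul]
    refine mul_le_mul h.err_sq ((abs_sub _ _).trans ?_) (abs_nonneg _) h0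
    rw [abs_of_pos hi0, abs_of_pos hj0]
    linarith
  have h2 : |(rss R T n₀ γ₀ x ε θ.1 n - ∑ t ∈ Finset.range T, ε t ^ 2 - D) * (1 / (2 * θ.2))|
      ≤ 6 * (c * T) * (B ^ 2 + 2 * B) * (1 / (2 * s₁)) := by
    rw [abs_mul, abs_of_pos hi0]
    exact mul_le_mul hD hi hi0.le (by positivity)
  refine ((abs_add_le _ _).trans (add_le_add h1 h2)).trans_eq ?_
  unfold errorConst
  field_simp
  ring

lemma SampleRegular.abs_logLik_sub_le_of_le (h : SampleRegular S σ₀sq κ c M T n₀ x ε)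
    (hσ : 0 < σ₀sq) (hs : 0 < s₁) (hθ : s₁ ≤ θ.2) (hB : 0 ≤ B)
    (hw : ∀ a a₀, ∑ i, |coefDev R γ₀ θ.1 a a₀ i| ≤ B) (hn : n₀ ≤ n) (hT : n ≤ T) :
    |logLik R T n₀ γ₀ x ε (γ₀, σ₀sq) n₀ - logLik R T n₀ γ₀ x ε θ n
      - (T * varLoss σ₀sq θ.2 + (n₀ * quadForm S (coefDev R γ₀ θ.1 false false)
        + (n - n₀) * quadForm S (coefDev R γ₀ θ.1 false true)
        + (T - n) * quadForm S (coefDev R γ₀ θ.1 true true)) / (2 * θ.2))|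
      ≤ c * T * errorConst σ₀sq s₁ B := by
  refine h.abs_logLik_sub_le hσ hs hθ hB ?_
  rw [rss_sub_eq_of_le hn hT]
  have h1 := abs_le.mp (h.abs_sum_sqDev_Ico_sub_le (hw false false) (Nat.zero_le n₀) (hn.trans hT))
  have h2 := abs_le.mp (h.abs_sum_sqDev_Ico_sub_le (hw false true) hn hT)
  have h3 := abs_le.mp (h.abs_sum_sqDev_Ico_sub_le (hw true true) hT le_rfl)
  rw [Nat.cast_zero, sub_zero] at h1
  rw [abs_le]
  constructor <;> linarith

lemma SampleRegular.abs_logLik_sub_le_of_ge (h : SampleRegular S σ₀sq κ c M T n₀ x ε)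
    (hσ : 0 < σ₀sq) (hs : 0 < s₁) (hθ : s₁ ≤ θ.2) (hB : 0 ≤ B)
    (hw : ∀ a a₀, ∑ i, |coefDev R γ₀ θ.1 a a₀ i| ≤ B) (hn : n ≤ n₀) (hT : n₀ ≤ T) :
    |logLik R T n₀ γ₀ x ε (γ₀, σ₀sq) n₀ - logLik R T n₀ γ₀ x ε θ n
      - (T * varLoss σ₀sq θ.2 + (n * quadForm S (coefDev R γ₀ θ.1 false false)
        + (n₀ - n) * quadForm S (coefDev R γ₀ θ.1 true false)
        + (T - n₀) * quadForm S (coefDev R γ₀ θ.1 true true)) / (2 * θ.2))|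
      ≤ c * T * errorConst σ₀sq s₁ B := by
  refine h.abs_logLik_sub_le hσ hs hθ hB ?_
  rw [rss_sub_eq_of_ge hn hT]
  have h1 := abs_le.mp (h.abs_sum_sqDev_Ico_sub_le (hw false false) (Nat.zero_le n) (hn.trans hT))
  have h2 := abs_le.mp (h.abs_sum_sqDev_Ico_sub_le (hw true false) hn hT)
  have h3 := abs_le.mp (h.abs_sum_sqDev_Ico_sub_le (hw true true) hT le_rfl)
  rw [Nat.cast_zero, sub_zero] at h1
  rw [abs_le]
  constructor <;> linarith

lemma logLik_sub_logLik_eq :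
    logLik R T n₀ γ₀ x ε θ n₀ - logLik R T n₀ γ₀ x ε θ n
      = (rss R T n₀ γ₀ x ε θ.1 n - rss R T n₀ γ₀ x ε θ.1 n₀) / (2 * θ.2) := by
  unfold logLik
  ring

lemma SampleRegular.le_logLik_sub_of_le (h : SampleRegular S σ₀sq κ c M T n₀ x ε) (hc : 0 ≤ c)
    (hθ : 0 < θ.2) (hw : ∀ a a₀, ∑ i, |coefDev R γ₀ θ.1 a a₀ i| ≤ B) (hn : n₀ + M ≤ n)
    (hT : n ≤ T) :
    (n - n₀) * (quadForm S (coefDev R γ₀ θ.1 false true)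
      - quadForm S (coefDev R γ₀ θ.1 true true) - 2 * c * (B ^ 2 + 2 * B)) / (2 * θ.2)
      ≤ logLik R T n₀ γ₀ x ε θ n₀ - logLik R T n₀ γ₀ x ε θ n := by
  have hle : n₀ ≤ n := by omega
  have hle' : (n₀ : ℝ) ≤ n := by exact_mod_cast hle
  rw [logLik_sub_logLik_eq, rss_sub_rss_of_le hle hT]
  have hs : 0 ≤ c * ((n : ℝ) - n₀) := mul_nonneg hc (by linarith)
  have h1 := abs_le.mp (abs_sum_sqDev_sub_le (fun q => h.after q n hn hT) (hw false true) hs)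
  have h2 := abs_le.mp (abs_sum_sqDev_sub_le (fun q => h.after q n hn hT) (hw true true) hs)
  rw [Nat.card_Ico, Nat.cast_sub hle] at h1 h2
  gcongr
  linarith

lemma SampleRegular.le_logLik_sub_of_ge (h : SampleRegular S σ₀sq κ c M T n₀ x ε) (hc : 0 ≤ c)
    (hθ : 0 < θ.2) (hw : ∀ a a₀, ∑ i, |coefDev R γ₀ θ.1 a a₀ i| ≤ B) (hn : n + M ≤ n₀)
    (hκ : (n₀ : ℝ) - n ≤ κ * T) (hT : n₀ ≤ T) :
    (n₀ - n) * (quadForm S (coefDev R γ₀ θ.1 true false)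
      - quadForm S (coefDev R γ₀ θ.1 false false) - 2 * c * (B ^ 2 + 2 * B)) / (2 * θ.2)
      ≤ logLik R T n₀ γ₀ x ε θ n₀ - logLik R T n₀ γ₀ x ε θ n := by
  have hle : n ≤ n₀ := by omega
  have hle' : (n : ℝ) ≤ n₀ := by exact_mod_cast hle
  rw [logLik_sub_logLik_eq, rss_sub_rss_of_ge hle hT]
  have hs : 0 ≤ c * ((n₀ : ℝ) - n) := mul_nonneg hc (by linarith)
  have h1 := abs_le.mp (abs_sum_sqDev_sub_le (fun q => h.before q n hn hκ) (hw true false) hs)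
  have h2 := abs_le.mp (abs_sum_sqDev_sub_le (fun q => h.before q n hn hκ) (hw false false) hs)
  rw [Nat.card_Ico, Nat.cast_sub hle] at h1 h2
  gcongr
  linarith

lemma abs_dotProduct_le {v w : Fin dx → ℝ} {b : ℝ} (hv : ∀ i, |v i| ≤ b) (hw : ∑ i, |w i| ≤ B)
    (hb : 0 ≤ b) : |v ⬝ᵥ w| ≤ b * B := by
  refine le_trans ?_ (mul_le_mul_of_nonneg_left hw hb)
  rw [Finset.mul_sum]
  refine (Finset.abs_sum_le_sum_abs _ _).trans (Finset.sum_le_sum fun i _ => ?_)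
  rw [abs_mul]
  exact mul_le_mul_of_nonneg_right (hv i) (abs_nonneg _)

lemma sqDev_sub_sqDev_le {v w : Fin dx → ℝ} {b K : ℝ} {t : ℕ} (hx : ∀ i, |x t i| ≤ b)
    (hb : 0 ≤ b) (hv : ∑ i, |v i| ≤ B) (hε : |ε t| ≤ K) :
    sqDev x ε v t - sqDev x ε w t ≤ (K + b * B) ^ 2 := by
  have h1 := abs_dotProduct_le hx hv hb
  have h2 : |ε t - x t ⬝ᵥ v| ≤ K + b * B := (abs_sub _ _).trans (by linarith)
  have h3 := sq_le_sq' (abs_le.mp h2).1 (abs_le.mp h2).2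
  unfold sqDev
  nlinarith [sq_nonneg (ε t - x t ⬝ᵥ w)]

/-- The log likelihood changes little when the break moves by at most one date. -/
lemma logLik_sub_logLik_le_of_near {b K : ℝ} (hs : 0 < s₁) (hθ : s₁ ≤ θ.2)
    (hw : ∀ a a₀, ∑ i, |coefDev R γ₀ θ.1 a a₀ i| ≤ B) (hx : ∀ t i, |x t i| ≤ b) (hb : 0 ≤ b)
    (hε : |ε n₀| ≤ K) (hε' : |ε (n₀ - 1)| ≤ K) (hn : n ≤ n₀ + 1) (hn' : n₀ ≤ n + 1) (hT : n ≤ T)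
    (hT₀ : n₀ ≤ T) :
    logLik R T n₀ γ₀ x ε θ n₀ - logLik R T n₀ γ₀ x ε θ n ≤ (K + b * B) ^ 2 / (2 * s₁) := by
  have hθ0 : 0 < θ.2 := hs.trans_le hθ
  rw [logLik_sub_logLik_eq]
  have key : rss R T n₀ γ₀ x ε θ.1 n - rss R T n₀ γ₀ x ε θ.1 n₀ ≤ (K + b * B) ^ 2 := by
    rcases lt_trichotomy n n₀ with h | rfl | h
    · obtain rfl : n₀ = n + 1 := by omega
      rw [rss_sub_rss_of_ge h.le hT₀]
      -- A break one date early misplaces the index `n₀ - 1`; one date late misplaces `n₀`. Hence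
      -- the error bounds at these two indices.
      simp only [Nat.Ico_succ_singleton, Finset.sum_singleton]
      exact sqDev_sub_sqDev_le (hx n) hb (hw _ _) hε'
    · rw [sub_self]
      positivity
    · obtain rfl : n = n₀ + 1 := by omega
      rw [rss_sub_rss_of_le h.le hT]
      simp only [Nat.Ico_succ_singleton, Finset.sum_singleton]
      exact sqDev_sub_sqDev_le (hx n₀) hb (hw _ _) hε
  calc _ ≤ (K + b * B) ^ 2 / (2 * θ.2) := by gcongr
    _ ≤ _ := by gcongr

end Deterministic

/-! ### Linear algebra of the regression coefficients -/

section LinearAlgebra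

variable {dx dz : ℕ} {S : Matrix (Fin dx) (Fin dx) ℝ} {R : Matrix (Fin dx) (Fin dz) ℝ}

lemma quadForm_pos (hS : S.PosDef) {w : Fin dx → ℝ} (hw : w ≠ 0) : 0 < quadForm S w := by
  simpa [quadForm] using hS.dotProduct_mulVec_pos hw

lemma quadForm_nonneg (hS : S.PosDef) (w : Fin dx → ℝ) : 0 ≤ quadForm S w := by
  rcases eq_or_ne w 0 with rfl | hw
  · rw [quadForm_zero]
  · exact (quadForm_pos hS hw).le

/-- Half of the parallelogram identity. With `v - w = R δ₀` it says that one coefficient vector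
cannot fit both regimes. -/
lemma quadForm_sub_le (hS : S.PosDef) (v w : Fin dx → ℝ) :
    quadForm S (v - w) ≤ 2 * (quadForm S v + quadForm S w) := by
  have h := quadForm_nonneg hS (v + w)
  simp only [quadForm, Matrix.mulVec_add, Matrix.mulVec_sub, dotProduct_add, dotProduct_sub,
    add_dotProduct, sub_dotProduct] at h ⊢
  linarith

lemma mulVec_injective_of_rank_eq (hR : R.rank = dz) : Function.Injective (R *ᵥ ·) := by
  have h1 := LinearMap.finrank_range_add_finrank_ker R.mulVecLin
  rw [Module.finrank_fin_fun] at h1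
  have h2 : Module.finrank ℝ (LinearMap.range R.mulVecLin) = dz := hR
  have h3 : Module.finrank ℝ (LinearMap.ker R.mulVecLin) = 0 := by omega
  exact LinearMap.ker_eq_bot.mp (Submodule.finrank_eq_zero.mp h3)

lemma coefDev_ff (γ₀ γ : (Fin dx → ℝ) × (Fin dz → ℝ)) :
    coefDev R γ₀ γ false false = γ.1 - γ₀.1 := by
  simp [coefDev]

lemma coefDev_tt (γ₀ γ : (Fin dx → ℝ) × (Fin dz → ℝ)) :
    coefDev R γ₀ γ true true = γ.1 - γ₀.1 + R *ᵥ (γ.2 - γ₀.2) := by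
  simp [coefDev, Matrix.mulVec_sub, add_sub_assoc]

lemma coefDev_ff_sub_ft (γ₀ γ : (Fin dx → ℝ) × (Fin dz → ℝ)) :
    coefDev R γ₀ γ false false - coefDev R γ₀ γ false true = R *ᵥ γ₀.2 := by
  simp [coefDev]

lemma coefDev_tf_sub_tt (γ₀ γ : (Fin dx → ℝ) × (Fin dz → ℝ)) :
    coefDev R γ₀ γ true false - coefDev R γ₀ γ true true = R *ᵥ γ₀.2 := by
  simp [coefDev]

lemma eq_of_coefDev_eq_zero (hR : R.rank = dz) {γ₀ γ : (Fin dx → ℝ) × (Fin dz → ℝ)}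
    (h1 : coefDev R γ₀ γ false false = 0) (h2 : coefDev R γ₀ γ true true = 0) : γ = γ₀ := by
  rw [coefDev_ff] at h1
  rw [coefDev_tt, h1, zero_add] at h2
  have h3 : γ.2 - γ₀.2 = 0 := mulVec_injective_of_rank_eq hR (by simpa using h2)
  exact Prod.ext (sub_eq_zero.mp h1) (sub_eq_zero.mp h3)

end LinearAlgebra

/-! ### Divergence caused by a wrong variance -/

section VarLoss

variable {σ₀sq v : ℝ}

/-- With `u = σ₀² / v` this is half of `u - 1 - log u`, which is nonnegative and vanishes only at `u
= 1`. -/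
lemma varLoss_eq (hσ : 0 < σ₀sq) (hv : 0 < v) :
    varLoss σ₀sq v = 1 / 2 * (σ₀sq / v - 1 - Real.log (σ₀sq / v)) := by
  rw [varLoss, Real.log_div hv.ne' hσ.ne', Real.log_div hσ.ne' hv.ne']
  ring

lemma varLoss_nonneg (hσ : 0 < σ₀sq) (hv : 0 < v) : 0 ≤ varLoss σ₀sq v := by
  rw [varLoss_eq hσ hv]
  have := Real.log_le_sub_one_of_pos (div_pos hσ hv)
  linarith

lemma varLoss_pos (hσ : 0 < σ₀sq) (hv : 0 < v) (h : v ≠ σ₀sq) : 0 < varLoss σ₀sq v := by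
  rw [varLoss_eq hσ hv]
  have := Real.log_lt_sub_one_of_pos (div_pos hσ hv) fun h' =>
    h ((div_eq_one_iff_eq hv.ne').mp h').symm
  linarith

lemma varLoss_self (hσ : 0 < σ₀sq) : varLoss σ₀sq σ₀sq = 0 := by
  simp [varLoss, hσ.ne']

end VarLoss

/-! ### The pseudo-true parameter at the true break -/

section PseudoTrue

variable {dx dz : ℕ}

/-- The limiting divergence per observation of the model with the true break location, up to a
weighting of the observations before and after the break by `p` and `p'`. -/
def limLoss (S : Matrix (Fin dx) (Fin dx) ℝ) (R : Matrix (Fin dx) (Fin dz) ℝ)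
    (γ₀ : (Fin dx → ℝ) × (Fin dz → ℝ)) (σ₀sq p p' : ℝ) (θ : Param dx dz) : ℝ :=
  varLoss σ₀sq θ.2 + (p * quadForm S (coefDev R γ₀ θ.1 false false)
    + p' * quadForm S (coefDev R γ₀ θ.1 true true)) / (2 * θ.2)

lemma limLoss_nonneg {S : Matrix (Fin dx) (Fin dx) ℝ} (hS : S.PosDef)
    {R : Matrix (Fin dx) (Fin dz) ℝ}
    (γ₀ : (Fin dx → ℝ) × (Fin dz → ℝ)) {σ₀sq p p' : ℝ} (hσ : 0 < σ₀sq) (hp : 0 ≤ p) (hp' : 0 ≤ p')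
    {θ : Param dx dz} (hθ : 0 < θ.2) : 0 ≤ limLoss S R γ₀ σ₀sq p p' θ := by
  have h1 := varLoss_nonneg hσ hθ
  have h2 := quadForm_nonneg hS (coefDev R γ₀ θ.1 false false)
  have h3 := quadForm_nonneg hS (coefDev R γ₀ θ.1 true true)
  unfold limLoss
  positivity

/-- Identification: the variance loss vanishes only at `σ₀²`. With positive weights on both regimes,
the quadratic forms vanish together only at `γ₀`, by the rank of `R`. -/
lemma limLoss_pos {S : Matrix (Fin dx) (Fin dx) ℝ} (hS : S.PosDef) {R : Matrix (Fin dx) (Fin dz) ℝ}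
    (hR : R.rank = dz) (γ₀ : (Fin dx → ℝ) × (Fin dz → ℝ)) {σ₀sq p p' : ℝ} (hσ : 0 < σ₀sq)
    (hp : 0 < p) (hp' : 0 < p') {θ : Param dx dz} (hθ : 0 < θ.2) (hne : θ ≠ (γ₀, σ₀sq)) :
    0 < limLoss S R γ₀ σ₀sq p p' θ := by
  have h1 := varLoss_nonneg hσ hθ
  have h2 := quadForm_nonneg hS (coefDev R γ₀ θ.1 false false)
  have h3 := quadForm_nonneg hS (coefDev R γ₀ θ.1 true true)
  unfold limLoss
  by_cases hv : θ.2 = σ₀sq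
  · have hγ : θ.1 ≠ γ₀ := fun h => hne (Prod.ext h hv)
    have h4 : 0 < p * quadForm S (coefDev R γ₀ θ.1 false false)
        + p' * quadForm S (coefDev R γ₀ θ.1 true true) := by
      by_cases h5 : coefDev R γ₀ θ.1 false false = 0
      · have h6 : coefDev R γ₀ θ.1 true true ≠ 0 := fun h6 => hγ (eq_of_coefDev_eq_zero hR h5 h6)
        have := quadForm_pos hS h6
        positivity
      · have := quadForm_pos hS h5
        positivity
    positivity
  · have := varLoss_pos hσ hθ hv
    positivity

lemma limLoss_true (S : Matrix (Fin dx) (Fin dx) ℝ) (R : Matrix (Fin dx) (Fin dz) ℝ)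
    (γ₀ : (Fin dx → ℝ) × (Fin dz → ℝ)) {σ₀sq : ℝ} (p p' : ℝ) (hσ : 0 < σ₀sq) :
    limLoss S R γ₀ σ₀sq p p' (γ₀, σ₀sq) = 0 := by
  simp [limLoss, varLoss_self hσ, coefDev_ff, coefDev_tt, quadForm_zero]

lemma continuousAt_limLoss (S : Matrix (Fin dx) (Fin dx) ℝ) (R : Matrix (Fin dx) (Fin dz) ℝ)
    (γ₀ : (Fin dx → ℝ) × (Fin dz → ℝ)) {σ₀sq : ℝ} (p p' : ℝ) (hσ : 0 < σ₀sq) {θ : Param dx dz}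
    (hθ : 0 < θ.2) : ContinuousAt (limLoss S R γ₀ σ₀sq p p') θ := by
  have h1 : ∀ a a₀, Continuous fun θ : Param dx dz => quadForm S (coefDev R γ₀ θ.1 a a₀) :=
    fun a a₀ => (continuous_quadForm S).comp ((continuous_coefDev R γ₀ a a₀).comp continuous_fst)
  have h2 : ContinuousAt (fun θ : Param dx dz => θ.2) θ := continuous_snd.continuousAt
  unfold limLoss varLoss
  refine ContinuousAt.add (ContinuousAt.add ?_ ?_) (ContinuousAt.div ?_ ?_ (by positivity))
  · exact continuousAt_const.mul ((h2.div_const _).log (by positivity))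
  · exact continuousAt_const.mul ((continuousAt_const.div h2 hθ.ne').sub continuousAt_const)
  · exact ((continuous_const.mul (h1 _ _)).add (continuous_const.mul (h1 _ _))).continuousAt
  · exact continuousAt_const.mul h2

variable {Ω : Type*} [MeasurableSpace Ω] {μ : Measure Ω} {X : Set (Fin dx → ℝ)}
  {x : ℕ → Ω → Fin dx → ℝ} {ε : ℕ → Ω → ℝ} {σ₀sq : ℝ} {S : Matrix (Fin dx) (Fin dx) ℝ}
  {R : Matrix (Fin dx) (Fin dz) ℝ} {γ₀ : (Fin dx → ℝ) × (Fin dz → ℝ)} {δ₀ : Fin dz → ℝ}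

lemma RegularDGP.integrable_momentDev [IsProbabilityMeasure μ]
    (h : RegularDGP μ X x ε δ₀ σ₀sq S) (q : (Fin dx × Fin dx) ⊕ Fin dx) (t : ℕ) :
    Integrable (fun ω => momentDev S q (x t ω, ε t ω)) μ :=
  (h.stationarySmallMean q).integrable t

lemma RegularDGP.integral_momentDev [IsProbabilityMeasure μ]
    (h : RegularDGP μ X x ε δ₀ σ₀sq S) (q : (Fin dx × Fin dx) ⊕ Fin dx) (t : ℕ) :
    ∫ ω, momentDev S q (x t ω, ε t ω) ∂μ = 0 := by
  rcases q with ⟨i, j⟩ | i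
  · simp only [momentDev]
    rw [integral_sub (h.integrable_coord_mul_coord t i j) (integrable_const _), h.secondMoment]
    simp
  · exact h.integral_coord_mul_err t i

lemma sqDev_eq (x : ℕ → Fin dx → ℝ) (ε : ℕ → ℝ) (w : Fin dx → ℝ) (t : ℕ) :
    sqDev x ε w t = ∑ i, ∑ j, w i * w j * momentDev S (.inl (i, j)) (x t, ε t)
        - 2 * ∑ i, w i * momentDev S (.inr i) (x t, ε t) + quadForm S w := by
  have := sum_sqDev_sub_eq S x ε w {t}
  simp only [Finset.sum_singleton, Finset.card_singleton, Nat.cast_one, one_mul] at this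
  linarith

lemma RegularDGP.integrable_integral_sqDev [IsProbabilityMeasure μ]
    (h : RegularDGP μ X x ε δ₀ σ₀sq S) (w : Fin dx → ℝ) (t : ℕ) :
    Integrable (fun ω => sqDev (fun t => x t ω) (fun t => ε t ω) w t) μ ∧
      ∫ ω, sqDev (fun t => x t ω) (fun t => ε t ω) w t ∂μ = quadForm S w := by
  simp only [sqDev_eq (S := S)]
  have h1 : ∀ i j, Integrable
      (fun ω => w i * w j * momentDev S (.inl (i, j)) (x t ω, ε t ω)) μ :=
    fun i j => (h.integrable_momentDev _ t).const_mul _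
  have h2 : ∀ i, Integrable (fun ω => w i * momentDev S (.inr i) (x t ω, ε t ω)) μ :=
    fun i => (h.integrable_momentDev _ t).const_mul _
  have h3 : Integrable
      (fun ω => ∑ i, ∑ j, w i * w j * momentDev S (.inl (i, j)) (x t ω, ε t ω)) μ :=
    integrable_finsetSum _ fun i _ => integrable_finsetSum _ fun j _ => h1 i j
  have h4 : Integrable (fun ω => 2 * ∑ i, w i * momentDev S (.inr i) (x t ω, ε t ω)) μ :=
    (integrable_finsetSum _ fun i _ => h2 i).const_mul 2
  have h5 : Integrable
      (fun ω => ∑ i, ∑ j, w i * w j * momentDev S (.inl (i, j)) (x t ω, ε t ω)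
        - 2 * ∑ i, w i * momentDev S (.inr i) (x t ω, ε t ω)) μ := h3.sub h4
  refine ⟨h5.add (integrable_const _), ?_⟩
  rw [integral_add h5 (integrable_const _), integral_sub h3 h4, integral_const_mul,
    integral_finsetSum _ fun i _ => integrable_finsetSum _ fun j _ => h1 i j,
    integral_finsetSum _ fun i _ => h2 i]
  simp only [integral_finsetSum _ fun j _ => h1 _ j, integral_const_mul, h.integral_momentDev]
  simp

lemma meanLogLik_eq [IsProbabilityMeasure μ] (h : RegularDGP μ X x ε δ₀ σ₀sq S) {τ₀ : ℝ}
    (T : ℕ) (hT : strictFloor (τ₀ * T) ≤ T) {θ : Param dx dz} (hθ : 0 < θ.2) :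
    meanLogLik μ R x ε γ₀ τ₀ T θ τ₀ = -(T / 2 * Real.log (2 * Real.pi * θ.2))
      - (T * σ₀sq + (strictFloor (τ₀ * T) * quadForm S (coefDev R γ₀ θ.1 false false)
        + (T - strictFloor (τ₀ * T)) * quadForm S (coefDev R γ₀ θ.1 true true))) / (2 * θ.2) := by
  set n₀ := strictFloor (τ₀ * T) with hn₀
  have h0 : ∀ ω, Real.log (normalLik R T (response R x ε γ₀ τ₀ T ω) (fun t => x t ω) θ τ₀)
      = -(T / 2 * Real.log (2 * Real.pi * θ.2)) - (∑ t ∈ Finset.range T, ε t ω ^ 2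
        + (∑ t ∈ Finset.Ico 0 n₀,
            sqDev (fun t => x t ω) (fun t => ε t ω) (coefDev R γ₀ θ.1 false false) t
          + ∑ t ∈ Finset.Ico n₀ T,
            sqDev (fun t => x t ω) (fun t => ε t ω) (coefDev R γ₀ θ.1 true true) t)) / (2 * θ.2) := by
    intro ω
    have h1 := normalLik_eq_exp_logLik R T γ₀ τ₀ τ₀ (fun t => x t ω) (fun t => ε t ω) hθ
    have h2 := rss_sub_eq_of_le (R := R) (γ₀ := γ₀) (γ := θ.1) (x := fun t => x t ω)
      (ε := fun t => ε t ω) (le_refl n₀) hT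
    simp only [Finset.Ico_self, Finset.sum_empty, add_zero] at h2
    change Real.log (normalLik R T
      (fun t => regMean R T τ₀ γ₀ t (x t ω) + ε t ω) (fun t => x t ω) θ τ₀) = _
    rw [h1, Real.log_exp, logLik, ← h2]
    ring
  have hA : Integrable (fun ω => ∑ t ∈ Finset.range T, ε t ω ^ 2) μ :=
    integrable_finsetSum _ fun t _ => h.integrable_err_sq t
  have hB : ∀ (J : Finset ℕ) w,
      Integrable (fun ω => ∑ t ∈ J, sqDev (fun t => x t ω) (fun t => ε t ω) w t) μ ∧
        ∫ ω, ∑ t ∈ J, sqDev (fun t => x t ω) (fun t => ε t ω) w t ∂μ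
          = J.card * quadForm S w := fun J w => by
    refine ⟨integrable_finsetSum _ fun t _ => (h.integrable_integral_sqDev w t).1, ?_⟩
    rw [integral_finsetSum _ fun t _ => (h.integrable_integral_sqDev w t).1]
    simp only [(h.integrable_integral_sqDev w _).2]
    simp
  unfold meanLogLik
  simp only [h0]
  have hC := (hB (Finset.Ico 0 n₀) (coefDev R γ₀ θ.1 false false))
  have hD := (hB (Finset.Ico n₀ T) (coefDev R γ₀ θ.1 true true))
  have hE : Integrable (fun ω => ∑ t ∈ Finset.Ico 0 n₀,
        sqDev (fun t => x t ω) (fun t => ε t ω) (coefDev R γ₀ θ.1 false false) t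
      + ∑ t ∈ Finset.Ico n₀ T,
        sqDev (fun t => x t ω) (fun t => ε t ω) (coefDev R γ₀ θ.1 true true) t) μ :=
    hC.1.add hD.1
  have hF : Integrable (fun ω => (∑ t ∈ Finset.range T, ε t ω ^ 2 + (∑ t ∈ Finset.Ico 0 n₀,
        sqDev (fun t => x t ω) (fun t => ε t ω) (coefDev R γ₀ θ.1 false false) t
      + ∑ t ∈ Finset.Ico n₀ T,
        sqDev (fun t => x t ω) (fun t => ε t ω) (coefDev R γ₀ θ.1 true true) t)) / (2 * θ.2)) μ :=
    (hA.add hE).div_const _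
  rw [integral_sub (integrable_const _) hF, integral_div, integral_add hA hE, integral_add hC.1 hD.1, hC.2, hD.2,
    integral_finsetSum _ fun t _ => h.integrable_err_sq t]
  simp [h.integral_err_sq, Nat.cast_sub hT]

lemma tendsto_strictFloor_div {τ₀ : ℝ} (hτ : 0 < τ₀) :
    Tendsto (fun T : ℕ => (strictFloor (τ₀ * T) : ℝ) / T) atTop (𝓝 τ₀) := by
  have h1 : Tendsto (fun T : ℕ => τ₀ - 1 / (T : ℝ)) atTop (𝓝 τ₀) := by
    simpa using tendsto_const_nhds.sub (tendsto_one_div_atTop_nhds_zero_nat (𝕜 := ℝ))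
  refine tendsto_of_tendsto_of_tendsto_of_le_of_le' h1 tendsto_const_nhds ?_ ?_ <;>
    filter_upwards [eventually_ge_atTop 1] with T hT <;>
    have hT0 : (0 : ℝ) < T := by exact_mod_cast hT
  · rw [le_div_iff₀ hT0, sub_mul, one_div_mul_cancel hT0.ne']
    linarith [(strictFloor_spec (mul_pos hτ hT0)).2]
  · rw [div_le_iff₀ hT0]
    exact (strictFloor_spec (mul_pos hτ hT0)).1.le

lemma strictFloor_mul_le {τ : ℝ} (hτ : 0 < τ) (hτ1 : τ < 1) {T : ℕ} (hT : 1 ≤ T) :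
    strictFloor (τ * T) ≤ T := by
  have hT0 : (0 : ℝ) < T := by exact_mod_cast hT
  have h1 := (strictFloor_spec (mul_pos hτ hT0)).1
  have : (strictFloor (τ * T) : ℝ) ≤ T := by nlinarith
  exact_mod_cast this

lemma tendsto_meanLogLik_sub [IsProbabilityMeasure μ] (h : RegularDGP μ X x ε δ₀ σ₀sq S) {τ₀ : ℝ}
    (hτ : 0 < τ₀) (hτ1 : τ₀ < 1) {θ : Param dx dz} (hθ : 0 < θ.2) :
    Tendsto (fun T : ℕ => (1 / (T : ℝ)) * (meanLogLik μ R x ε γ₀ τ₀ T (γ₀, σ₀sq) τ₀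
      - meanLogLik μ R x ε γ₀ τ₀ T θ τ₀)) atTop (𝓝 (limLoss S R γ₀ σ₀sq τ₀ (1 - τ₀) θ)) := by
  have hσ := h.variance_pos
  have h1 := tendsto_strictFloor_div hτ
  have h2 : Tendsto (fun T : ℕ => limLoss S R γ₀ σ₀sq ((strictFloor (τ₀ * T) : ℝ) / T)
      (1 - (strictFloor (τ₀ * T) : ℝ) / T) θ) atTop (𝓝 (limLoss S R γ₀ σ₀sq τ₀ (1 - τ₀) θ)) := by
    unfold limLoss
    exact tendsto_const_nhds.add (((h1.mul_const _).add
      ((tendsto_const_nhds.sub h1).mul_const _)).div_const _)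
  refine h2.congr' ?_
  filter_upwards [eventually_ge_atTop 1] with T hT
  have hT0 : (0 : ℝ) < T := by exact_mod_cast hT
  have hle := strictFloor_mul_le hτ hτ1 hT
  rw [meanLogLik_eq h T hle hθ, meanLogLik_eq h T hle hσ]
  simp only [limLoss, varLoss, coefDev_ff γ₀ γ₀, coefDev_tt γ₀ γ₀, sub_self, Matrix.mulVec_zero,
    add_zero, quadForm_zero, mul_zero]
  rw [Real.log_div hθ.ne' hσ.ne', Real.log_mul (by positivity) hθ.ne',
    Real.log_mul (by positivity) hσ.ne']
  field_simp
  ring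

/-- The truth is a minimizer because `limLoss` is nonnegative. A different minimizer would have
expected log likelihood strictly below that of the truth in the limit, contrary to its own
minimality. -/
lemma pseudoTrue_eq [IsProbabilityMeasure μ] (h : RegularDGP μ X x ε δ₀ σ₀sq S)
    (hR : R.rank = dz) {τ₀ : ℝ} (hτ : 0 < τ₀) (hτ1 : τ₀ < 1) :
    pseudoTrue μ R x ε γ₀ τ₀ τ₀ = (γ₀, σ₀sq) := by
  have hex : IsPseudoTrue μ R x ε γ₀ τ₀ τ₀ (γ₀, σ₀sq) :=
    ⟨h.variance_pos, fun θ' hθ' => ⟨_, limLoss_nonneg h.secondMoment_posDef γ₀ h.variance_pos hτ.le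
      (by linarith) hθ', tendsto_meanLogLik_sub h hτ hτ1 hθ'⟩⟩
  obtain ⟨hpos, hmin⟩ := Classical.epsilon_spec (p := IsPseudoTrue μ R x ε γ₀ τ₀ τ₀) ⟨_, hex⟩
  change 0 < (pseudoTrue μ R x ε γ₀ τ₀ τ₀).2 at hpos
  by_contra hne
  obtain ⟨d, hd, hlim⟩ := hmin (γ₀, σ₀sq) h.variance_pos
  have h1 := (tendsto_meanLogLik_sub (R := R) (γ₀ := γ₀) h hτ hτ1 hpos).neg
  have h2 : d = -limLoss S R γ₀ σ₀sq τ₀ (1 - τ₀) (pseudoTrue μ R x ε γ₀ τ₀ τ₀) := by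
    refine tendsto_nhds_unique hlim (h1.congr fun T => ?_)
    rw [← mul_neg, neg_sub]
    rfl
  have h3 := limLoss_pos h.secondMoment_posDef hR γ₀ h.variance_pos hτ
    (show 0 < 1 - τ₀ by linarith) hpos hne
  linarith

end PseudoTrue

/-! ### Separation of the likelihood -/

section Separation

variable {dx dz : ℕ} {S : Matrix (Fin dx) (Fin dx) ℝ} {R : Matrix (Fin dx) (Fin dz) ℝ}
  {γ₀ : (Fin dx → ℝ) × (Fin dz → ℝ)} {σ₀sq : ℝ} {Θ : Set (Param dx dz)}

/-- The likelihood at the true parameter exceeds that at parameters outside the ball of radius `r`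
or at breaks further than `κ` away by a factor `exp (3 ζ T)`, is at most `exp (2 ζ T)` times that
at parameters in the ball of radius `r'`, and at parameters in the ball of radius `r` the
likelihood decays at rate `a` in the number of dates between the break and the true one. -/
structure LikelihoodSeparated (R : Matrix (Fin dx) (Fin dz) ℝ)
    (γ₀ : (Fin dx → ℝ) × (Fin dz → ℝ)) (σ₀sq τ₀ : ℝ) (Θ : Set (Param dx dz))
    (r r' κ ζ a : ℝ) (M T : ℕ) (x : ℕ → Fin dx → ℝ) (ε : ℕ → ℝ) : Prop where
  far : ∀ θ ∈ Θ, ∀ τ : ℝ, 0 < τ → τ < 1 → θ ∉ Metric.ball (γ₀, σ₀sq) r ∨ κ ≤ |τ - τ₀| →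
    logLik R T (strictFloor (τ₀ * T)) γ₀ x ε θ (strictFloor (τ * T)) ≤
      logLik R T (strictFloor (τ₀ * T)) γ₀ x ε (γ₀, σ₀sq) (strictFloor (τ₀ * T)) - 3 * ζ * T
  near : ∀ θ ∈ Θ, θ ∈ Metric.ball (γ₀, σ₀sq) r' →
    logLik R T (strictFloor (τ₀ * T)) γ₀ x ε (γ₀, σ₀sq) (strictFloor (τ₀ * T)) - 2 * ζ * T ≤
      logLik R T (strictFloor (τ₀ * T)) γ₀ x ε θ (strictFloor (τ₀ * T))
  decay : ∀ θ ∈ Θ, θ ∈ Metric.ball (γ₀, σ₀sq) r → ∀ τ : ℝ, |τ - τ₀| < κ →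
    M + 1 ≤ |τ - τ₀| * T →
    logLik R T (strictFloor (τ₀ * T)) γ₀ x ε θ (strictFloor (τ * T)) ≤
      logLik R T (strictFloor (τ₀ * T)) γ₀ x ε θ (strictFloor (τ₀ * T))
        - a * (|τ - τ₀| * T - 1)

lemma exists_coefDev_bound (hΘ : IsCompact Θ) :
    ∃ B : ℝ, 0 ≤ B ∧ ∀ θ ∈ Θ, ∀ a a₀, ∑ i, |coefDev R γ₀ θ.1 a a₀ i| ≤ B := by
  have hc : ∀ p : Bool × Bool, ∃ B : ℝ, ∀ θ ∈ Θ, ‖∑ i, |coefDev R γ₀ θ.1 p.1 p.2 i|‖ ≤ B :=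
    fun p => hΘ.exists_bound_of_continuousOn (Continuous.continuousOn (continuous_finsetSum _
      fun i _ => ((continuous_apply i).comp
        ((continuous_coefDev R γ₀ p.1 p.2).comp continuous_fst)).abs))
  choose B hB using hc
  refine ⟨∑ p, |B p|, Finset.sum_nonneg fun p _ => abs_nonneg _, fun θ hθ a a₀ => ?_⟩
  refine (le_abs_self _).trans ((hB (a, a₀) θ hθ).trans ((le_abs_self _).trans ?_))
  exact Finset.single_le_sum (f := fun p => |B p|) (fun p _ => abs_nonneg _) (Finset.mem_univ _)

lemma exists_variance_bounds (hΘ : IsCompact Θ) (hpos : ∀ θ ∈ Θ, 0 < θ.2) (hne : Θ.Nonempty) :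
    ∃ s₁ s₂ : ℝ, 0 < s₁ ∧ 0 < s₂ ∧ ∀ θ ∈ Θ, s₁ ≤ θ.2 ∧ θ.2 ≤ s₂ := by
  obtain ⟨θ₁, h1, hmin⟩ := hΘ.exists_isMinOn hne continuous_snd.continuousOn
  obtain ⟨θ₂, h2, hmax⟩ := hΘ.exists_isMaxOn hne continuous_snd.continuousOn
  exact ⟨θ₁.2, θ₂.2, hpos _ h1, hpos _ h2, fun θ hθ => ⟨hmin hθ, hmax hθ⟩⟩

lemma exists_limLoss_lower_bound (hS : S.PosDef) (hR : R.rank = dz) (hσ : 0 < σ₀sq)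
    (hΘ : IsCompact Θ) (hpos : ∀ θ ∈ Θ, 0 < θ.2) {κ r : ℝ} (hκ : 0 < κ) (hr : 0 < r) :
    ∃ ζ : ℝ, 0 < ζ ∧ ∀ θ ∈ Θ, θ ∉ Metric.ball (γ₀, σ₀sq) r → ζ ≤ limLoss S R γ₀ σ₀sq κ κ θ := by
  have hK : IsCompact (Θ \ Metric.ball (γ₀, σ₀sq) r) := hΘ.diff Metric.isOpen_ball
  rcases (Θ \ Metric.ball (γ₀, σ₀sq) r).eq_empty_or_nonempty with he | hne
  · exact ⟨1, one_pos, fun θ h1 h2 => absurd (he ▸ ⟨h1, h2⟩ : θ ∈ (∅ : Set _)) (by simp)⟩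
  · obtain ⟨θ₁, h1, hmin⟩ := hK.exists_isMinOn hne (f := limLoss S R γ₀ σ₀sq κ κ)
      fun θ hθ => (continuousAt_limLoss S R γ₀ κ κ hσ (hpos θ hθ.1)).continuousWithinAt
    refine ⟨_, limLoss_pos hS hR γ₀ hσ hκ hκ (hpos _ h1.1) ?_, fun θ h2 h3 => hmin ⟨h2, h3⟩⟩
    rintro rfl
    exact h1.2 (Metric.mem_ball_self hr)

lemma quadForm_neg (v : Fin dx → ℝ) : quadForm S (-v) = quadForm S v := by
  simp [quadForm, Matrix.mulVec_neg]

/-- At `γ₀` both gaps equal the full quadratic form of `R δ₀`; continuity retains half of it nearby.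
-/
lemma eventually_quadForm_gap (hS : S.PosDef) (hδ : R *ᵥ γ₀.2 ≠ 0) :
    ∀ᶠ θ : Param dx dz in 𝓝 (γ₀, σ₀sq),
      quadForm S (R *ᵥ γ₀.2) / 2 ≤ quadForm S (coefDev R γ₀ θ.1 false true)
        - quadForm S (coefDev R γ₀ θ.1 true true) ∧
      quadForm S (R *ᵥ γ₀.2) / 2 ≤ quadForm S (coefDev R γ₀ θ.1 true false)
        - quadForm S (coefDev R γ₀ θ.1 false false) := by
  have hq := quadForm_pos hS hδ
  have h1 : ∀ a a₀, Continuous fun θ : Param dx dz => quadForm S (coefDev R γ₀ θ.1 a a₀) :=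
    fun a a₀ => (continuous_quadForm S).comp ((continuous_coefDev R γ₀ a a₀).comp continuous_fst)
  have e1 : coefDev R γ₀ γ₀ false true = -(R *ᵥ γ₀.2) := by simp [coefDev]
  have e2 : coefDev R γ₀ γ₀ true false = R *ᵥ γ₀.2 := by simp [coefDev]
  have e3 : coefDev R γ₀ γ₀ false false = 0 := by simp [coefDev]
  have e4 : coefDev R γ₀ γ₀ true true = 0 := by simp [coefDev]
  refine Filter.Eventually.and ?_ ?_
  · refine ((h1 _ _).sub (h1 _ _)).continuousAt.eventually_const_le ?_
    simp only [Pi.sub_apply, e1, e4, quadForm_neg, quadForm_zero]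
    linarith
  · refine ((h1 _ _).sub (h1 _ _)).continuousAt.eventually_const_le ?_
    simp only [Pi.sub_apply, e2, e3, quadForm_zero]
    linarith

lemma errorConst_pos {s₁ B : ℝ} (hσ : 0 < σ₀sq) (hs : 0 < s₁) (hB : 0 ≤ B) :
    0 < errorConst σ₀sq s₁ B := by
  unfold errorConst
  positivity

variable {κ c s₁ s₂ B ζ τ₀ : ℝ} {M T : ℕ} {x : ℕ → Fin dx → ℝ} {ε : ℕ → ℝ} {θ : Param dx dz}

/-- At least `κT / 2` dates are assigned to the wrong regime, and at least as many dates of the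
other true regime share the same fitted coefficient. The two true coefficients differ by `R δ₀`, so
for every `θ` one of these groups is badly fitted. -/
lemma SampleRegular.logLik_le_of_far_break
    (h : SampleRegular S σ₀sq (2 * κ) c M T (strictFloor (τ₀ * T)) x ε) (hS : S.PosDef)
    (hσ : 0 < σ₀sq) (hs : 0 < s₁) (hθ : s₁ ≤ θ.2) (hθ' : θ.2 ≤ s₂) (hB : 0 ≤ B)
    (hw : ∀ a a₀, ∑ i, |coefDev R γ₀ θ.1 a a₀ i| ≤ B) (hκ : 0 < κ) (hκ₀ : 4 * κ ≤ τ₀)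
    (hκ₁ : 4 * κ ≤ 1 - τ₀) (hT : 2 ≤ κ * T) (hc : c * errorConst σ₀sq s₁ B ≤ ζ)
    (hζ : 4 * ζ ≤ κ * quadForm S (R *ᵥ γ₀.2) / (8 * s₂)) {τ : ℝ} (hτ : 0 < τ) (hτ1 : τ < 1)
    (hfar : κ ≤ |τ - τ₀|) :
    logLik R T (strictFloor (τ₀ * T)) γ₀ x ε θ (strictFloor (τ * T)) ≤
      logLik R T (strictFloor (τ₀ * T)) γ₀ x ε (γ₀, σ₀sq) (strictFloor (τ₀ * T)) - 3 * ζ * T := by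
  have hT0 : (0 : ℝ) < T := by
    by_contra hcon
    nlinarith
  have hT1 : 1 ≤ T := by exact_mod_cast hT0
  have hθ0 : 0 < θ.2 := hs.trans_le hθ
  have hτ₀ : 0 < τ₀ := by linarith
  have hleT := strictFloor_mul_le hτ hτ1 hT1
  have hleT₀ := strictFloor_mul_le hτ₀ (by linarith) hT1
  obtain ⟨hn1, hn2⟩ := strictFloor_spec (mul_pos hτ hT0)
  obtain ⟨hm1, hm2⟩ := strictFloor_spec (mul_pos hτ₀ hT0)
  set n := strictFloor (τ * T)
  set n₀ := strictFloor (τ₀ * T)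
  have hv := varLoss_nonneg hσ hθ0
  set ff := quadForm S (coefDev R γ₀ θ.1 false false) with hff
  set ft := quadForm S (coefDev R γ₀ θ.1 false true) with hft
  set tf := quadForm S (coefDev R γ₀ θ.1 true false) with htf
  set tt := quadForm S (coefDev R γ₀ θ.1 true true) with htt
  set q := quadForm S (R *ᵥ γ₀.2) with hq
  have hff0 : 0 ≤ ff := quadForm_nonneg hS _
  have hft0 : 0 ≤ ft := quadForm_nonneg hS _
  have htf0 : 0 ≤ tf := quadForm_nonneg hS _
  have htt0 : 0 ≤ tt := quadForm_nonneg hS _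
  have hq1 : q ≤ 2 * (ff + ft) := by
    have := quadForm_sub_le hS (coefDev R γ₀ θ.1 false false) (coefDev R γ₀ θ.1 false true)
    rwa [coefDev_ff_sub_ft] at this
  have hq2 : q ≤ 2 * (tf + tt) := by
    have := quadForm_sub_le hS (coefDev R γ₀ θ.1 true false) (coefDev R γ₀ θ.1 true true)
    rwa [coefDev_tf_sub_tt] at this
  have hq0 : 0 ≤ q := quadForm_nonneg hS _
  have hcT : c * T * errorConst σ₀sq s₁ B ≤ ζ * T := by
    have := mul_le_mul_of_nonneg_right hc hT0.le
    linarith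
  have hmul₀ : 4 * κ * T ≤ τ₀ * T := mul_le_mul_of_nonneg_right hκ₀ hT0.le
  have hmul₁ : 4 * κ * T ≤ (1 - τ₀) * T := mul_le_mul_of_nonneg_right hκ₁ hT0.le
  have key : ∀ D : ℝ, κ * T / 4 * q ≤ D → 4 * ζ * T ≤ D / (2 * θ.2) := fun D hD => by
    have h1 : κ * T / 4 * q / (2 * s₂) ≤ D / (2 * θ.2) := by
      have : 0 ≤ κ * T / 4 * q := by positivity
      gcongr
      linarith
    have h2 := mul_le_mul_of_nonneg_right hζ hT0.le
    have h3 : κ * T / 4 * q / (2 * s₂) = κ * q / (8 * s₂) * T := by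
      have : 0 < s₂ := hθ0.trans_le hθ'
      field_simp
      ring
    linarith
  have hvT : 0 ≤ T * varLoss σ₀sq θ.2 := by positivity
  rcases le_abs.mp hfar with hd | hd
  · have hd' := mul_le_mul_of_nonneg_right hd hT0.le
    rw [sub_mul] at hd'
    have hnn : κ * T / 2 ≤ (n : ℝ) - n₀ := by linarith
    have hle : n₀ ≤ n := by
      have : (n₀ : ℝ) ≤ n := by nlinarith
      exact_mod_cast this
    have hb := abs_le.mp (h.abs_logLik_sub_le_of_le hσ hs hθ hB hw hle hleT)
    have hTn : (0 : ℝ) ≤ T - n := by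
      have : (n : ℝ) ≤ T := by exact_mod_cast hleT
      linarith
    have hn₀ : κ * T / 2 ≤ (n₀ : ℝ) := by linarith
    have := key (n₀ * ff + (n - n₀) * ft + (T - n) * tt) (by
      have h1 := mul_le_mul_of_nonneg_right hn₀ hff0
      have h2 := mul_le_mul_of_nonneg_right hnn hft0
      have h3 := mul_nonneg hTn htt0
      have h4 : κ * T / 4 * q ≤ κ * T / 4 * (2 * (ff + ft)) :=
        mul_le_mul_of_nonneg_left hq1 (by positivity)
      linarith)
    linarith
  · have hd' := mul_le_mul_of_nonneg_right hd hT0.le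
    rw [neg_sub, sub_mul] at hd'
    have hnn : κ * T / 2 ≤ (n₀ : ℝ) - n := by linarith
    have hle : n ≤ n₀ := by
      have : (n : ℝ) ≤ n₀ := by nlinarith
      exact_mod_cast this
    have hb := abs_le.mp (h.abs_logLik_sub_le_of_ge hσ hs hθ hB hw hle hleT₀)
    have hTn : κ * T / 2 ≤ (T : ℝ) - n₀ := by linarith
    have := key (n * ff + (n₀ - n) * tf + (T - n₀) * tt) (by
      have h1 := mul_nonneg (Nat.cast_nonneg (α := ℝ) n) hff0
      have h2 := mul_le_mul_of_nonneg_right hnn htf0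
      have h3 := mul_le_mul_of_nonneg_right hTn htt0
      have h4 : κ * T / 4 * q ≤ κ * T / 4 * (2 * (tf + tt)) :=
        mul_le_mul_of_nonneg_left hq2 (by positivity)
      linarith)
    linarith

/-- For a break within `κ` of the true one, at least `κT` dates lie before both breaks and `κT`
after both. Their contributions alone give `limLoss` with both weights equal to `κ`. -/
lemma SampleRegular.logLik_le_of_far_param
    (h : SampleRegular S σ₀sq (2 * κ) c M T (strictFloor (τ₀ * T)) x ε) (hS : S.PosDef)
    (hσ : 0 < σ₀sq) (hs : 0 < s₁) (hθ : s₁ ≤ θ.2) (hB : 0 ≤ B)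
    (hw : ∀ a a₀, ∑ i, |coefDev R γ₀ θ.1 a a₀ i| ≤ B) (hκ : 0 < κ) (hκ₀ : 4 * κ ≤ τ₀)
    (hκ₁ : 4 * κ ≤ 1 - τ₀) (hT : 2 ≤ κ * T) (hc : c * errorConst σ₀sq s₁ B ≤ ζ)
    (hζ : 4 * ζ ≤ limLoss S R γ₀ σ₀sq κ κ θ) {τ : ℝ} (hτ : 0 < τ) (hτ1 : τ < 1)
    (hnear : |τ - τ₀| ≤ κ) :
    logLik R T (strictFloor (τ₀ * T)) γ₀ x ε θ (strictFloor (τ * T)) ≤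
      logLik R T (strictFloor (τ₀ * T)) γ₀ x ε (γ₀, σ₀sq) (strictFloor (τ₀ * T)) - 3 * ζ * T := by
  have hT0 : (0 : ℝ) < T := by
    by_contra hcon
    nlinarith
  have hT1 : 1 ≤ T := by exact_mod_cast hT0
  have hθ0 : 0 < θ.2 := hs.trans_le hθ
  have hτ₀ : 0 < τ₀ := by linarith
  have hleT := strictFloor_mul_le hτ hτ1 hT1
  have hleT₀ := strictFloor_mul_le hτ₀ (by linarith) hT1
  obtain ⟨hn1, hn2⟩ := strictFloor_spec (mul_pos hτ hT0)
  obtain ⟨hm1, hm2⟩ := strictFloor_spec (mul_pos hτ₀ hT0)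
  set n := strictFloor (τ * T)
  set n₀ := strictFloor (τ₀ * T)
  unfold limLoss at hζ
  set ff := quadForm S (coefDev R γ₀ θ.1 false false) with hff
  set ft := quadForm S (coefDev R γ₀ θ.1 false true) with hft
  set tf := quadForm S (coefDev R γ₀ θ.1 true false) with htf
  set tt := quadForm S (coefDev R γ₀ θ.1 true true) with htt
  have hff0 : 0 ≤ ff := quadForm_nonneg hS _
  have hft0 : 0 ≤ ft := quadForm_nonneg hS _
  have htf0 : 0 ≤ tf := quadForm_nonneg hS _
  have htt0 : 0 ≤ tt := quadForm_nonneg hS _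
  have hcT : c * T * errorConst σ₀sq s₁ B ≤ ζ * T := by
    have := mul_le_mul_of_nonneg_right hc hT0.le
    linarith
  have hmul₀ : 4 * κ * T ≤ τ₀ * T := mul_le_mul_of_nonneg_right hκ₀ hT0.le
  have hmul₁ : 4 * κ * T ≤ (1 - τ₀) * T := mul_le_mul_of_nonneg_right hκ₁ hT0.le
  have key : ∀ D : ℝ, κ * T * (ff + tt) ≤ D →
      4 * ζ * T ≤ T * varLoss σ₀sq θ.2 + D / (2 * θ.2) := fun D hD => by
    have h1 : κ * T * (ff + tt) / (2 * θ.2) ≤ D / (2 * θ.2) := by gcongr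
    have h2 := mul_le_mul_of_nonneg_right hζ hT0.le
    have h3 : (varLoss σ₀sq θ.2 + (κ * ff + κ * tt) / (2 * θ.2)) * T
        = T * varLoss σ₀sq θ.2 + κ * T * (ff + tt) / (2 * θ.2) := by
      field_simp
    linarith
  obtain ⟨hd1, hd2⟩ := abs_le.mp hnear
  have hd1' := mul_le_mul_of_nonneg_right hd1 hT0.le
  have hd2' := mul_le_mul_of_nonneg_right hd2 hT0.le
  rw [sub_mul] at hd1' hd2'
  rcases le_total n₀ n with hle | hle
  · have hle' : (n₀ : ℝ) ≤ n := by exact_mod_cast hle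
    have hb := abs_le.mp (h.abs_logLik_sub_le_of_le hσ hs hθ hB hw hle hleT)
    have := key (n₀ * ff + (n - n₀) * ft + (T - n) * tt) (by
      have h1 := mul_le_mul_of_nonneg_right (show κ * T ≤ n₀ by linarith) hff0
      have h2 := mul_nonneg (show (0 : ℝ) ≤ n - n₀ by linarith) hft0
      have h3 := mul_le_mul_of_nonneg_right (show κ * T ≤ (T : ℝ) - n by linarith) htt0
      linarith)
    linarith
  · have hle' : (n : ℝ) ≤ n₀ := by exact_mod_cast hle
    have hb := abs_le.mp (h.abs_logLik_sub_le_of_ge hσ hs hθ hB hw hle hleT₀)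
    have := key (n * ff + (n₀ - n) * tf + (T - n₀) * tt) (by
      have h1 := mul_le_mul_of_nonneg_right (show κ * T ≤ n by linarith) hff0
      have h2 := mul_nonneg (show (0 : ℝ) ≤ n₀ - n by linarith) htf0
      have h3 := mul_le_mul_of_nonneg_right (show κ * T ≤ (T : ℝ) - n₀ by linarith) htt0
      linarith)
    linarith

lemma SampleRegular.le_logLik_of_near_param {n₀ : ℕ}
    (h : SampleRegular S σ₀sq κ c M T n₀ x ε) (hS : S.PosDef)
    (hσ : 0 < σ₀sq) (hs : 0 < s₁) (hθ : s₁ ≤ θ.2) (hB : 0 ≤ B)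
    (hw : ∀ a a₀, ∑ i, |coefDev R γ₀ θ.1 a a₀ i| ≤ B) (hn : n₀ ≤ T)
    (hc : c * errorConst σ₀sq s₁ B ≤ ζ) (hζ : limLoss S R γ₀ σ₀sq 1 1 θ ≤ ζ) :
    logLik R T n₀ γ₀ x ε (γ₀, σ₀sq) n₀ - 2 * ζ * T ≤ logLik R T n₀ γ₀ x ε θ n₀ := by
  have hT0 : (0 : ℝ) ≤ T := Nat.cast_nonneg T
  have hn' : (n₀ : ℝ) ≤ T := by exact_mod_cast hn
  have hn0 : (0 : ℝ) ≤ n₀ := Nat.cast_nonneg n₀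
  have hθ0 : 0 < θ.2 := hs.trans_le hθ
  have hb := abs_le.mp (h.abs_logLik_sub_le_of_le hσ hs hθ hB hw le_rfl hn)
  unfold limLoss at hζ
  set ff := quadForm S (coefDev R γ₀ θ.1 false false) with hff
  set tt := quadForm S (coefDev R γ₀ θ.1 true true) with htt
  have hff0 : 0 ≤ ff := quadForm_nonneg hS _
  have htt0 : 0 ≤ tt := quadForm_nonneg hS _
  rw [sub_self, zero_mul, add_zero] at hb
  have hcT : c * T * errorConst σ₀sq s₁ B ≤ ζ * T := by
    have := mul_le_mul_of_nonneg_right hc hT0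
    linarith
  have h1 : (n₀ * ff + (T - n₀) * tt) / (2 * θ.2) ≤ T * (ff + tt) / (2 * θ.2) := by
    gcongr
    nlinarith
  have h2 := mul_le_mul_of_nonneg_right hζ hT0
  have h3 : (varLoss σ₀sq θ.2 + (1 * ff + 1 * tt) / (2 * θ.2)) * T
      = T * varLoss σ₀sq θ.2 + T * (ff + tt) / (2 * θ.2) := by
    field_simp
  linarith

/-- Of the gap `q / 2` per date, sampling error consumes at most `q / 4`. The `1` subtracted from
`|τ - τ₀| * T` pays for rounding the breaks to dates. -/
lemma SampleRegular.logLik_le_of_near_break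
    (h : SampleRegular S σ₀sq (2 * κ) c M T (strictFloor (τ₀ * T)) x ε)
    (hs : 0 < θ.2) (hθ' : θ.2 ≤ s₂)
    (hw : ∀ a a₀, ∑ i, |coefDev R γ₀ θ.1 a a₀ i| ≤ B) (hκ : 0 < κ) (hκ₀ : 4 * κ ≤ τ₀)
    (hκ₁ : 4 * κ ≤ 1 - τ₀) (hT : 2 ≤ κ * T) (hc : 0 ≤ c) {q : ℝ} (hq : 0 ≤ q)
    (hcq : 2 * c * (B ^ 2 + 2 * B) ≤ q / 4)
    (hq1 : q / 2 ≤ quadForm S (coefDev R γ₀ θ.1 false true)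
        - quadForm S (coefDev R γ₀ θ.1 true true))
    (hq2 : q / 2 ≤ quadForm S (coefDev R γ₀ θ.1 true false)
        - quadForm S (coefDev R γ₀ θ.1 false false)) {τ : ℝ} (hnear : |τ - τ₀| < κ)
    (hM : M + 1 ≤ |τ - τ₀| * T) :
    logLik R T (strictFloor (τ₀ * T)) γ₀ x ε θ (strictFloor (τ * T)) ≤
      logLik R T (strictFloor (τ₀ * T)) γ₀ x ε θ (strictFloor (τ₀ * T))
        - q / (8 * s₂) * (|τ - τ₀| * T - 1) := by
  have hT0 : (0 : ℝ) < T := by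
    by_contra hcon
    nlinarith
  have hT1 : 1 ≤ T := by exact_mod_cast hT0
  have hτ₀ : 0 < τ₀ := by linarith
  obtain ⟨hd1, hd2⟩ := abs_lt.mp hnear
  have hτ : 0 < τ := by linarith
  have hτ1 : τ < 1 := by linarith
  have hleT := strictFloor_mul_le hτ hτ1 hT1
  have hleT₀ := strictFloor_mul_le hτ₀ (by linarith) hT1
  obtain ⟨hn1, hn2⟩ := strictFloor_spec (mul_pos hτ hT0)
  obtain ⟨hm1, hm2⟩ := strictFloor_spec (mul_pos hτ₀ hT0)
  set n := strictFloor (τ * T)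
  set n₀ := strictFloor (τ₀ * T)
  have hd1' := mul_lt_mul_of_pos_right hd1 hT0
  have key : ∀ m g : ℝ, |τ - τ₀| * T - 1 ≤ m → q / 2 ≤ g →
      q / (8 * s₂) * (|τ - τ₀| * T - 1) ≤ m * (g - 2 * c * (B ^ 2 + 2 * B)) / (2 * θ.2) := by
    intro m g hm hg
    have h0 : 0 ≤ |τ - τ₀| * T - 1 := by
      have := Nat.cast_nonneg (α := ℝ) M
      linarith
    calc q / (8 * s₂) * (|τ - τ₀| * T - 1) = (|τ - τ₀| * T - 1) * (q / 4) / (2 * s₂) := by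
          have : 0 < s₂ := hs.trans_le hθ'
          field_simp
          ring
      _ ≤ (|τ - τ₀| * T - 1) * (q / 4) / (2 * θ.2) := by
          have : 0 ≤ (|τ - τ₀| * T - 1) * (q / 4) := by positivity
          gcongr
      _ ≤ _ := by
          gcongr <;> linarith
  rcases le_total τ₀ τ with hle | hle
  · rw [abs_of_nonneg (sub_nonneg.mpr hle)] at hM key ⊢
    have hnn : (τ - τ₀) * T - 1 ≤ (n : ℝ) - n₀ := by linarith
    have hMn : n₀ + M ≤ n := by
      have : ((n₀ + M : ℕ) : ℝ) ≤ n := by push_cast; linarith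
      exact_mod_cast this
    have h1 := h.le_logLik_sub_of_le hc hs hw hMn hleT
    have h2 := key _ _ hnn hq1
    linarith
  · rw [abs_of_nonpos (sub_nonpos.mpr hle), neg_sub] at hM key ⊢
    have hnn : (τ₀ - τ) * T - 1 ≤ (n₀ : ℝ) - n := by linarith
    have hMn : n + M ≤ n₀ := by
      have : ((n + M : ℕ) : ℝ) ≤ n₀ := by push_cast; linarith
      exact_mod_cast this
    -- Rounding gives `n₀ - n < κT + 1`, and `κT ≥ 2` brings this below `2κT`; this is why the
    -- sample is regular with `2 * κ`.
    have h1 := h.le_logLik_sub_of_ge hc hs hw hMn (by linarith) hleT₀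
    have h2 := key _ _ hnn hq2
    linarith

lemma exists_likelihoodSeparated (hS : S.PosDef) (hR : R.rank = dz) (hδ : γ₀.2 ≠ 0)
    (hσ : 0 < σ₀sq) (hΘ : IsCompact Θ) (hpos : ∀ θ ∈ Θ, 0 < θ.2)
    (hθ₀ : (γ₀, σ₀sq) ∈ Θ) {V : Set (Param dx dz)} (hV : V ∈ 𝓝 (γ₀, σ₀sq))
    (hκ : 0 < κ) (hκ₀ : 4 * κ ≤ τ₀) (hκ₁ : 4 * κ ≤ 1 - τ₀) :
    ∃ r r' c ζ a : ℝ, 0 < r ∧ 0 < r' ∧ r' ≤ r ∧ 0 < c ∧ 0 < ζ ∧ 0 < a ∧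
      Metric.ball (γ₀, σ₀sq) r ⊆ V ∧ ∀ (M T : ℕ) (x : ℕ → Fin dx → ℝ) (ε : ℕ → ℝ), 2 ≤ κ * T →
        SampleRegular S σ₀sq (2 * κ) c M T (strictFloor (τ₀ * T)) x ε →
        LikelihoodSeparated R γ₀ σ₀sq τ₀ Θ r r' κ ζ a M T x ε := by
  have hRδ : R *ᵥ γ₀.2 ≠ 0 := fun h =>
    hδ (mulVec_injective_of_rank_eq hR (by simpa using h))
  have hq := quadForm_pos hS hRδ
  set q := quadForm S (R *ᵥ γ₀.2) with hqdef
  obtain ⟨s₁, s₂, hs₁, hs₂, hs⟩ := exists_variance_bounds hΘ hpos ⟨_, hθ₀⟩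
  obtain ⟨B, hB, hw⟩ := exists_coefDev_bound (R := R) (γ₀ := γ₀) hΘ
  obtain ⟨r, hr, hrV⟩ := Metric.mem_nhds_iff.mp
    (Filter.inter_mem hV (eventually_quadForm_gap (σ₀sq := σ₀sq) hS hRδ))
  obtain ⟨ζ₁, hζ₁, hζ⟩ := exists_limLoss_lower_bound (γ₀ := γ₀) hS hR hσ hΘ hpos hκ hr
  -- The limiting loss is at least `4ζ` outside the neighbourhood. Sampling error takes up to `ζ`,
  -- leaving `3ζ`; inside the smaller ball loss and sampling error are at most `ζ` each, giving
  -- `2ζ`.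
  set ζ := min ζ₁ (κ * q / (8 * s₂)) / 4 with hζdef
  have hζ0 : 0 < ζ := by positivity
  have hζa : 4 * ζ ≤ ζ₁ := by
    rw [hζdef]
    linarith [min_le_left ζ₁ (κ * q / (8 * s₂))]
  have hζb : 4 * ζ ≤ κ * q / (8 * s₂) := by
    rw [hζdef]
    linarith [min_le_right ζ₁ (κ * q / (8 * s₂))]
  have hnear : ∀ᶠ θ in 𝓝 (γ₀, σ₀sq), limLoss S R γ₀ σ₀sq 1 1 θ ≤ ζ :=
    (continuousAt_limLoss S R γ₀ 1 1 hσ hσ).eventually_le_const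
      (by rw [limLoss_true S R γ₀ 1 1 hσ]; exact hζ0)
  obtain ⟨r₁, hr₁, hr₁ζ⟩ := Metric.eventually_nhds_iff_ball.mp hnear
  have hE := errorConst_pos hσ hs₁ hB
  -- The first bound controls the global approximation, the second the per-date gap. The added `1`
  -- keeps the denominator positive when `B = 0`.
  set c := min (ζ / errorConst σ₀sq s₁ B) (q / (8 * (B ^ 2 + 2 * B) + 1)) with hcdef
  have hc0 : 0 < c := by positivity
  have hc1 : c * errorConst σ₀sq s₁ B ≤ ζ := (le_div_iff₀ hE).mp (min_le_left _ _)
  have hc2 : 2 * c * (B ^ 2 + 2 * B) ≤ q / 4 := by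
    have h1 : c * (8 * (B ^ 2 + 2 * B) + 1) ≤ q :=
      (le_div_iff₀ (by positivity)).mp (min_le_right _ _)
    linarith
  refine ⟨r, min r r₁, c, ζ, q / (8 * s₂), hr, lt_min hr hr₁, min_le_left _ _, hc0, hζ0,
    by positivity, fun θ hθ => (hrV hθ).1, fun M T x ε hT h => ⟨?_, ?_, ?_⟩⟩
  · intro θ hθ τ hτ hτ1 hfar
    rcases le_or_gt κ |τ - τ₀| with hk | hk
    · exact h.logLik_le_of_far_break hS hσ hs₁ (hs θ hθ).1 (hs θ hθ).2 hB (hw θ hθ) hκ hκ₀ hκ₁ hT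
        hc1 hζb hτ hτ1 hk
    · exact h.logLik_le_of_far_param hS hσ hs₁ (hs θ hθ).1 hB (hw θ hθ) hκ hκ₀ hκ₁ hT
        hc1 (hζa.trans (hζ θ hθ (hfar.resolve_right (not_le.mpr hk)))) hτ hτ1 hk.le
  · intro θ hθ hball
    have hT1 : 1 ≤ T := by
      by_contra hcon
      obtain rfl : T = 0 := by omega
      norm_num at hT
    exact h.le_logLik_of_near_param hS hσ hs₁ (hs θ hθ).1 hB (hw θ hθ)
      (strictFloor_mul_le (by linarith) (by linarith) hT1) hc1
      (hr₁ζ θ (Metric.ball_subset_ball (min_le_right _ _) hball))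
  · intro θ hθ hball τ hτ hM
    obtain ⟨h1, h2⟩ := (hrV hball).2
    exact h.logLik_le_of_near_break (hpos θ hθ) (hs θ hθ).2 (hw θ hθ) hκ hκ₀ hκ₁ hT hc0.le hq.le
      hc2 h1 h2 hτ hM

end Separation

/-! ### Integral bounds -/

section Integration

lemma integral_exp_neg_mul_abs_sub {b : ℝ} (hb : 0 < b) (τ₀ : ℝ) :
    ∫ τ : ℝ, Real.exp (-(b * |τ - τ₀|)) = 2 / b := by
  rw [integral_sub_right_eq_self (fun τ => Real.exp (-(b * |τ|))) τ₀,
    integral_comp_abs (f := fun u => Real.exp (-(b * u)))]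
  have := integral_exp_mul_Ioi (a := -b) (by linarith) 0
  simp only [neg_mul] at this
  rw [this]
  simp
  ring

lemma integrable_exp_neg_mul_abs_sub {b : ℝ} (hb : 0 < b) (τ₀ : ℝ) :
    Integrable fun τ : ℝ => Real.exp (-(b * |τ - τ₀|)) := by
  by_contra h
  have h1 := integral_exp_neg_mul_abs_sub hb τ₀
  rw [integral_undef h] at h1
  have : 0 < 2 / b := by positivity
  linarith

variable {α : Type*} [MeasurableSpace α] {ν : Measure α} [SFinite ν] {f : α × ℝ → ℝ}

lemma setIntegral_integral_eq (hf : Integrable f (ν.prod volume)) (A : Set ℝ) :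
    ∫ τ in A, ∫ θ, f (θ, τ) ∂ν = ∫ z, f z ∂(ν.prod (volume.restrict A)) := by
  refine (integral_prod_symm f ?_).symm
  rw [← Measure.restrict_univ (μ := ν), Measure.prod_restrict]
  exact hf.restrict

/-- The first part of the majorant is a product, whose `τ` integral is at most `D * (2 / b)`; the
second is a multiple of a density. -/
lemma setIntegral_le_of_exp_decay (hf : Integrable f (ν.prod volume)) {p : α × ℝ → ℝ} {g : α → ℝ}
    (hp : Integrable p (ν.prod volume)) (hp0 : ∀ z, 0 ≤ p z) (hp1 : ∫ z, p z ∂(ν.prod volume) = 1)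
    (hg : Integrable g ν) (hg0 : ∀ θ, 0 ≤ g θ) {A : Set ℝ} (hA : MeasurableSet A)
    {b D E τ₀ : ℝ} (hb : 0 < b) (hD : 0 ≤ D) (hE : 0 ≤ E)
    (h : ∀ θ, ∀ τ ∈ A, f (θ, τ) ≤ g θ * (D * Real.exp (-(b * |τ - τ₀|))) + E * p (θ, τ)) :
    ∫ τ in A, ∫ θ, f (θ, τ) ∂ν ≤ (∫ θ, g θ ∂ν) * (D * (2 / b)) + E := by
  have hexp : Integrable fun τ => D * Real.exp (-(b * |τ - τ₀|)) :=
    (integrable_exp_neg_mul_abs_sub hb τ₀).const_mul D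
  have hres : ν.prod (volume.restrict A) = (ν.prod volume).restrict (univ ×ˢ A) := by
    conv_lhs => rw [← Measure.restrict_univ (μ := ν), Measure.prod_restrict]
  have hgd : Integrable (fun z : α × ℝ => g z.1 * (D * Real.exp (-(b * |z.2 - τ₀|))))
      (ν.prod volume) := hg.mul_prod hexp
  have hmaj : Integrable (fun z : α × ℝ => g z.1 * (D * Real.exp (-(b * |z.2 - τ₀|))) + E * p z)
      (ν.prod volume) := hgd.add (hp.const_mul E)
  rw [setIntegral_integral_eq hf, hres]
  calc ∫ z in univ ×ˢ A, f z ∂(ν.prod volume)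
      ≤ ∫ z in univ ×ˢ A, (g z.1 * (D * Real.exp (-(b * |z.2 - τ₀|))) + E * p z)
          ∂(ν.prod volume) :=
        setIntegral_mono_on hf.integrableOn hmaj.integrableOn (MeasurableSet.univ.prod hA)
          fun z hz => h z.1 z.2 hz.2
    _ ≤ ∫ z, (g z.1 * (D * Real.exp (-(b * |z.2 - τ₀|))) + E * p z) ∂(ν.prod volume) :=
        setIntegral_le_integral hmaj (ae_of_all _ fun z =>
          add_nonneg (mul_nonneg (hg0 _) (by positivity)) (mul_nonneg hE (hp0 z)))
    _ = _ := by
        rw [integral_add hgd (hp.const_mul E), integral_const_mul, hp1, mul_one,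
          integral_prod_mul g fun τ => D * Real.exp (-(b * |τ - τ₀|)), integral_const_mul,
          integral_exp_neg_mul_abs_sub hb]

lemma le_setIntegral_of_le (hf : Integrable f (ν.prod volume)) (hf0 : ∀ z, 0 ≤ f z) {g : α → ℝ}
    (hg : Integrable g ν) {I H : Set ℝ} (hI : MeasurableSet I) (hIH : I ⊆ H)
    (hIfin : volume I ≠ ⊤) {k : ℝ} (h : ∀ θ, ∀ τ ∈ I, k * g θ ≤ f (θ, τ)) :
    k * (∫ θ, g θ ∂ν) * volume.real I ≤ ∫ τ in H, ∫ θ, f (θ, τ) ∂ν := by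
  have hL : Integrable (fun τ => ∫ θ, f (θ, τ) ∂ν) := hf.integral_prod_right
  have hL0 : ∀ τ, 0 ≤ ∫ θ, f (θ, τ) ∂ν := fun τ => integral_nonneg fun θ => hf0 _
  calc k * (∫ θ, g θ ∂ν) * volume.real I = ∫ τ in I, ∫ θ, k * g θ ∂ν := by
        rw [setIntegral_const, integral_const_mul, smul_eq_mul, mul_comm]
    _ ≤ ∫ τ in I, ∫ θ, f (θ, τ) ∂ν := by
        refine setIntegral_mono_ae_restrict (integrableOn_const hIfin) hL.integrableOn ?_
        filter_upwards [ae_restrict_of_ae hf.prod_left_ae, ae_restrict_mem hI] with τ hτ hτI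
        exact integral_mono (hg.const_mul k) hτ fun θ => h θ τ hτI
    _ ≤ _ := setIntegral_mono_set hL.integrableOn (ae_of_all _ hL0) hIH.eventuallyLE

end Integration

/-! ### The marginal likelihood is well defined -/

section Likelihood

variable {dx dz : ℕ} {R : Matrix (Fin dx) (Fin dz) ℝ} {T : ℕ} {y : ℕ → ℝ} {x : ℕ → Fin dx → ℝ}
  {Θ : Set (Param dx dz)} {H : Set ℝ} {prior : Param dx dz × ℝ → ℝ} {θstar : ℝ → Param dx dz}

lemma measurable_strictFloor : Measurable strictFloor :=
  (measurable_of_countable fun n : ℕ => n - 1).comp Nat.measurable_ceil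

lemma measurable_normalLik :
    Measurable fun p : Param dx dz × ℝ => normalLik R T y x p.1 p.2 := by
  have hdot : ∀ {n : ℕ} (v : Fin n → ℝ), Measurable fun w : Fin n → ℝ => v ⬝ᵥ w := fun v => by
    unfold dotProduct
    fun_prop
  have hs : ∀ t, MeasurableSet {p : Param dx dz × ℝ | strictFloor (p.2 * T) ≤ t} := fun t =>
    measurableSet_le (measurable_strictFloor.comp (measurable_snd.mul_const _)) measurable_const
  have hm : ∀ t, Measurable fun p : Param dx dz × ℝ => regMean R T p.2 p.1.1 t (x t) := fun t => by
    unfold regMean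
    exact ((hdot _).comp (by fun_prop)).add
      (Measurable.ite (hs t) ((hdot _).comp (by fun_prop)) measurable_const)
  unfold normalLik
  refine Finset.measurable_prod _ fun t _ => ?_
  have := hm t
  fun_prop

lemma normalLik_nonneg (θ : Param dx dz) (τ : ℝ) : 0 ≤ normalLik R T y x θ τ :=
  Finset.prod_nonneg fun t _ => by positivity

lemma normalLik_pos {θ : Param dx dz} (hθ : 0 < θ.2) (τ : ℝ) : 0 < normalLik R T y x θ τ :=
  Finset.prod_pos fun t _ => by positivity

lemma normalLik_le {s₁ : ℝ} (hs : 0 < s₁) {θ : Param dx dz} (hθ : s₁ ≤ θ.2) (τ : ℝ) :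
    normalLik R T y x θ τ ≤ (1 / √(2 * Real.pi * s₁)) ^ T := by
  have hθ0 : 0 < θ.2 := hs.trans_le hθ
  unfold normalLik
  refine (Finset.prod_le_prod (fun t _ => by positivity) fun t _ => ?_).trans_eq
    (by rw [Finset.prod_const, Finset.card_range])
  refine (mul_le_of_le_one_right (by positivity) (Real.exp_le_one_iff.mpr ?_)).trans ?_
  · exact div_nonpos_of_nonpos_of_nonneg (neg_nonpos.mpr (sq_nonneg _)) (by positivity)
  · gcongr

namespace RegularPrior

lemma integrable (h : RegularPrior Θ H prior θstar) : Integrable prior := by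
  by_contra hcon
  have := h.total_mass
  rw [integral_undef hcon] at this
  exact zero_ne_one this

lemma eq_zero_of_notMem (h : RegularPrior Θ H prior θstar) {θ : Param dx dz} (hθ : θ ∉ Θ) (τ : ℝ) :
    prior (θ, τ) = 0 :=
  h.supported _ fun hp => hθ hp.1

lemma nonempty (h : RegularPrior Θ H prior θstar) : Θ.Nonempty := by
  by_contra hcon
  rw [not_nonempty_iff_eq_empty] at hcon
  have h1 : prior = 0 := funext fun p => h.supported p (by simp [hcon])
  have := h.total_mass
  rw [h1] at this
  simp at this

/-- On the compact `Θ` the variance is bounded away from `0`, so the likelihood is bounded there and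
the prior is an integrable majorant up to a constant. -/
lemma integrable_normalLik_mul (h : RegularPrior Θ H prior θstar) :
    Integrable fun p : Param dx dz × ℝ => normalLik R T y x p.1 p.2 * prior p := by
  obtain ⟨s₁, s₂, hs₁, -, hs⟩ := exists_variance_bounds h.compact h.variance_pos h.nonempty
  refine (h.integrable.const_mul ((1 / √(2 * Real.pi * s₁)) ^ T)).mono'
    (measurable_normalLik.mul h.measurable).aestronglyMeasurable (ae_of_all _ fun p => ?_)
  rw [Real.norm_of_nonneg (mul_nonneg (normalLik_nonneg _ _) (h.nonneg p))]
  by_cases hp : p.1 ∈ Θ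
  · exact mul_le_mul_of_nonneg_right (normalLik_le hs₁ (hs _ hp).1 _) (h.nonneg p)
  · rw [show prior p = 0 from h.eq_zero_of_notMem hp p.2]
    simp

lemma margLik_integrable (h : RegularPrior Θ H prior θstar) : Integrable (margLik R prior T y x) :=
  (h.integrable_normalLik_mul (R := R) (T := T) (y := y) (x := x)).integral_prod_right

/-- The likelihood is strictly positive on `Θ`, so a zero integral would make the prior vanish
almost everywhere, against its total mass. -/
lemma margLik_setIntegral_pos (h : RegularPrior Θ H prior θstar) :
    0 < ∫ τ in H, margLik R prior T y x τ := by
  have hf := h.integrable_normalLik_mul (R := R) (T := T) (y := y) (x := x)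
  have h1 : ∫ τ in H, margLik R prior T y x τ = ∫ τ, margLik R prior T y x τ := by
    refine setIntegral_eq_integral_of_forall_compl_eq_zero fun τ hτ => ?_
    unfold margLik
    simp [fun θ => h.supported (θ, τ) fun hp => hτ hp.2]
  have h2 : ∫ τ, margLik R prior T y x τ
      = ∫ p : Param dx dz × ℝ, normalLik R T y x p.1 p.2 * prior p :=
    (integral_prod_symm _ hf).symm
  have hnn : ∀ p : Param dx dz × ℝ, 0 ≤ normalLik R T y x p.1 p.2 * prior p := fun p =>
    mul_nonneg (normalLik_nonneg _ _) (h.nonneg p)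
  rw [h1, h2]
  refine lt_of_le_of_ne (integral_nonneg hnn) fun h0 => ?_
  have h3 := (integral_eq_zero_iff_of_nonneg hnn hf).mp h0.symm
  have h4 : prior =ᵐ[volume] fun _ => 0 := by
    filter_upwards [h3] with p hp
    by_cases hpΘ : p.1 ∈ Θ
    · exact (mul_eq_zero.mp hp).resolve_left (normalLik_pos (h.variance_pos _ hpΘ) _).ne'
    · exact h.eq_zero_of_notMem hpΘ p.2
  have h5 := h.total_mass
  rw [integral_congr_ae h4] at h5
  simp at h5

end RegularPrior
end Likelihood

/-! ### Posterior mass away from the true break -/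

section Contraction

variable {dx dz : ℕ} {R : Matrix (Fin dx) (Fin dz) ℝ} {γ₀ : (Fin dx → ℝ) × (Fin dz → ℝ)}
  {σ₀sq τ₀ : ℝ} {Θ : Set (Param dx dz)} {H : Set ℝ} {prior : Param dx dz × ℝ → ℝ}
  {θstar : ℝ → Param dx dz}

/-- The bound on the posterior mass of the breaks at a distance of at least `m / T` in a sample
in which the likelihood is separated. -/
lemma margPosterior_setIntegral_le (h : RegularPrior Θ H prior θstar) (hH : MeasurableSet H)
    (hH01 : H ⊆ Ioo 0 1) {r r' κ ζ a : ℝ} {M T : ℕ} {x : ℕ → Fin dx → ℝ} {ε : ℕ → ℝ}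
    (hsep : LikelihoodSeparated R γ₀ σ₀sq τ₀ Θ r r' κ ζ a M T x ε) (hT : 1 ≤ T) (hr' : 0 < r')
    (hrr : r' ≤ r) (ha : 0 < a) (hball : Metric.ball (γ₀, σ₀sq) r ⊆ Θ)
    {lo hi : ℝ} (hlo : 0 < lo) (hhi : 0 ≤ hi)
    (hprior : ∀ θ ∈ Metric.ball (γ₀, σ₀sq) r, ∀ τ ∈ H, |τ - τ₀| < κ →
      lo ≤ prior (θ, τ) ∧ prior (θ, τ) ≤ hi)
    {I : Set ℝ} (hI : MeasurableSet I) (hIH : I ⊆ H) (hIvol : volume.real I = 1 / T)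
    (hIκ : ∀ τ ∈ I, |τ - τ₀| < κ) {K : ℝ}
    (hK : ∀ θ ∈ Metric.ball (γ₀, σ₀sq) r, ∀ τ ∈ I,
      logLik R T (strictFloor (τ₀ * T)) γ₀ x ε θ (strictFloor (τ₀ * T)) - K ≤
        logLik R T (strictFloor (τ₀ * T)) γ₀ x ε θ (strictFloor (τ * T)))
    {m : ℝ} (hm : M + 1 ≤ m) :
    ∫ τ in H \ Ioo (τ₀ - m / T) (τ₀ + m / T), margPosterior R prior H T
        (fun t => regMean R T τ₀ γ₀ t (x t) + ε t) x τ
      ≤ 4 * hi * Real.exp a * Real.exp K / (a * lo) * Real.exp (-(a / 2 * m))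
        + Real.exp K / (lo * volume.real (Metric.ball (γ₀, σ₀sq) r')) *
          (T * Real.exp (-(ζ * T))) := by
  have hT0 : (0 : ℝ) < T := by exact_mod_cast hT
  set y : ℕ → ℝ := fun t => regMean R T τ₀ γ₀ t (x t) + ε t with hy
  set n₀ := strictFloor (τ₀ * T) with hn₀
  set θ₀ : Param dx dz := (γ₀, σ₀sq) with hθ₀
  set L := margLik R prior T y x with hL
  set f : Param dx dz × ℝ → ℝ := fun p => normalLik R T y x p.1 p.2 * prior p with hf
  set P₀ := Real.exp (logLik R T n₀ γ₀ x ε θ₀ n₀) with hP₀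
  have hlik : ∀ θ ∈ Θ, ∀ τ, normalLik R T y x θ τ
      = Real.exp (logLik R T n₀ γ₀ x ε θ (strictFloor (τ * T))) := fun θ hθ τ =>
    normalLik_eq_exp_logLik R T γ₀ τ₀ τ x ε (h.variance_pos θ hθ)
  have hfi : Integrable f := h.integrable_normalLik_mul
  have hf0 : ∀ p, 0 ≤ f p := fun p => mul_nonneg (normalLik_nonneg _ _) (h.nonneg p)
  set g : Param dx dz → ℝ :=
    (Metric.ball θ₀ r).indicator fun θ => normalLik R T y x θ τ₀ with hg
  have hg0 : ∀ θ, 0 ≤ g θ := fun θ => indicator_nonneg (fun θ _ => normalLik_nonneg θ τ₀) θ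
  obtain ⟨s₁, s₂, hs₁, -, hs⟩ := exists_variance_bounds h.compact h.variance_pos h.nonempty
  have hgi : Integrable g := by
    rw [hg, integrable_indicator_iff measurableSet_ball]
    refine Measure.integrableOn_of_bounded (M := (1 / √(2 * Real.pi * s₁)) ^ T)
      Metric.isBounded_ball.measure_lt_top.ne
      (measurable_normalLik.comp (measurable_id.prodMk measurable_const)).aestronglyMeasurable ?_
    filter_upwards [ae_restrict_mem measurableSet_ball] with θ hθ
    rw [Real.norm_of_nonneg (normalLik_nonneg _ _)]
    exact normalLik_le hs₁ (hs θ (hball hθ)).1 τ₀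
  set Z := ∫ θ, g θ with hZ
  set v := volume.real (Metric.ball θ₀ r') with hv
  have hv0 : 0 < v := ENNReal.toReal_pos
    (Metric.measure_ball_pos volume θ₀ hr').ne' Metric.isBounded_ball.measure_lt_top.ne
  have hZle : P₀ * Real.exp (-(2 * ζ * T)) * v ≤ Z := by
    have h1 : ∫ θ in Metric.ball θ₀ r', P₀ * Real.exp (-(2 * ζ * T)) ≤ Z := by
      rw [← integral_indicator measurableSet_ball, hZ]
      refine integral_mono ((integrable_indicator_iff measurableSet_ball).mpr
        (integrableOn_const Metric.isBounded_ball.measure_lt_top.ne)) hgi fun θ => ?_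
      by_cases hθ : θ ∈ Metric.ball θ₀ r'
      · have hθr := Metric.ball_subset_ball hrr hθ
        simp only [indicator_of_mem hθ, hg, indicator_of_mem hθr]
        rw [hlik θ (hball hθr), hP₀, ← Real.exp_add]
        exact Real.exp_le_exp.mpr (by linarith [hsep.near θ (hball hθr) hθ])
      · simpa only [indicator_of_notMem hθ] using hg0 θ
    rwa [setIntegral_const, smul_eq_mul, mul_comm] at h1
  have hP₀0 : 0 < P₀ := Real.exp_pos _
  have hZ0 : 0 < Z := lt_of_lt_of_le (by positivity) hZle
  -- On `I` the likelihood at `τ` is at least `exp (-K)` times that at `τ₀` for the same `θ`, so the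
  -- `θ` integral is again `Z`.
  have hden : lo * Real.exp (-K) * Z * (1 / T) ≤ ∫ τ in H, L τ := by
    rw [← hIvol]
    refine le_setIntegral_of_le hfi hf0 hgi hI hIH (fun htop => ?_) fun θ τ hτ => ?_
    · rw [measureReal_def, htop, ENNReal.toReal_top] at hIvol
      have : 0 < 1 / (T : ℝ) := by positivity
      linarith
    · by_cases hθ : θ ∈ Metric.ball θ₀ r
      · simp only [hg, indicator_of_mem hθ, hf]
        rw [hlik θ (hball hθ), hlik θ (hball hθ), mul_assoc, mul_comm, ← Real.exp_add]
        refine mul_le_mul (Real.exp_le_exp.mpr ?_) (hprior θ hθ τ (hIH hτ) (hIκ τ hτ)).1 hlo.le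
          (Real.exp_pos _).le
        linarith [hK θ hθ τ hτ]
      · simp only [hg, indicator_of_notMem hθ, mul_zero]
        exact hf0 _
  set A := H \ Ioo (τ₀ - m / T) (τ₀ + m / T) with hA
  have hAm : MeasurableSet A := hH.diff measurableSet_Ioo
  have hAd : ∀ τ ∈ A, m ≤ |τ - τ₀| * T := fun τ hτ => by
    rw [← div_le_iff₀ hT0]
    by_contra hcon
    have := abs_lt.mp (not_le.mp hcon)
    exact hτ.2 ⟨by linarith, by linarith⟩
  -- Half of the decay rate gives the factor `exp (-(a / 2 * m))` on `A`; the other half is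
  -- integrated over `τ` and supplies the `1 / T` that matches the denominator.
  have hnum : ∫ τ in A, L τ ≤ Z * (hi * Real.exp a * Real.exp (-(a / 2 * m)) * (2 / (a / 2 * T)))
      + P₀ * Real.exp (-(3 * ζ * T)) := by
    refine setIntegral_le_of_exp_decay (τ₀ := τ₀) hfi h.integrable h.nonneg h.total_mass hgi hg0
      hAm (by positivity) (by positivity) (by positivity) fun θ τ hτ => ?_
    have hτ01 := hH01 hτ.1
    have hfar : θ ∈ Θ → θ ∉ Metric.ball θ₀ r ∨ κ ≤ |τ - τ₀| →
        f (θ, τ) ≤ P₀ * Real.exp (-(3 * ζ * T)) * prior (θ, τ) := fun hθ hor => by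
      simp only [hf]
      rw [hlik θ hθ, hP₀, ← Real.exp_add]
      refine mul_le_mul_of_nonneg_right (Real.exp_le_exp.mpr ?_) (h.nonneg _)
      linarith [hsep.far θ hθ τ hτ01.1 hτ01.2 hor]
    have hnn1 : 0 ≤ g θ * (hi * Real.exp a * Real.exp (-(a / 2 * m))
        * Real.exp (-(a / 2 * T * |τ - τ₀|))) := mul_nonneg (hg0 θ) (by positivity)
    have hnn2 : 0 ≤ P₀ * Real.exp (-(3 * ζ * T)) * prior (θ, τ) :=
      mul_nonneg (by positivity) (h.nonneg _)
    by_cases hθ : θ ∈ Θ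
    · by_cases hor : θ ∉ Metric.ball θ₀ r ∨ κ ≤ |τ - τ₀|
      · linarith [hfar hθ hor]
      · rw [not_or, not_not, not_le] at hor
        obtain ⟨hθr, hτκ⟩ := hor
        have hd := hAd τ hτ
        have hdec := hsep.decay θ hθ hθr τ hτκ (hm.trans hd)
        have hmain : f (θ, τ) ≤ g θ * (hi * Real.exp a * Real.exp (-(a / 2 * m))
            * Real.exp (-(a / 2 * T * |τ - τ₀|))) := by
          simp only [hg, indicator_of_mem hθr, hf]
          rw [hlik θ hθ, hlik θ hθ]
          have e : Real.exp (logLik R T n₀ γ₀ x ε θ (strictFloor (τ₀ * T))) *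
              (hi * Real.exp a * Real.exp (-(a / 2 * m)) * Real.exp (-(a / 2 * T * |τ - τ₀|)))
              = Real.exp (logLik R T n₀ γ₀ x ε θ n₀ + a + -(a / 2 * m)
                + -(a / 2 * T * |τ - τ₀|)) * hi := by
            rw [Real.exp_add, Real.exp_add, Real.exp_add, ← hn₀]
            ring
          rw [e]
          refine mul_le_mul (Real.exp_le_exp.mpr ?_) (hprior θ hθr τ hτ.1 hτκ).2 (h.nonneg _)
            (Real.exp_pos _).le
          have := mul_le_mul_of_nonneg_left hd (half_pos ha).le
          linarith
        linarith
    · have : f (θ, τ) = 0 := by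
        simp only [hf, h.eq_zero_of_notMem hθ, mul_zero]
      linarith
  have hint : ∫ τ in A, margPosterior R prior H T y x τ = (∫ τ in A, L τ) / ∫ τ in H, L τ := by
    simp only [margPosterior]
    rw [integral_div]
  have hden0 : 0 < lo * Real.exp (-K) * Z * (1 / T) := by positivity
  rw [hint]
  refine (div_le_div₀ (by positivity) hnum hden0 hden).trans ?_
  -- The lower bound on `Z` turns the far contribution into a multiple of `Z`, so that `Z` cancels
  -- from the whole quotient.
  have hE : P₀ * Real.exp (-(3 * ζ * T)) ≤ Z * (Real.exp (-(ζ * T)) / v) := by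
    have h1 := mul_le_mul_of_nonneg_right hZle
      (show 0 ≤ Real.exp (-(ζ * T)) / v by positivity)
    refine le_trans (le_of_eq ?_) h1
    have : Real.exp (-(3 * ζ * T)) = Real.exp (-(2 * ζ * T)) * Real.exp (-(ζ * T)) := by
      rw [← Real.exp_add]
      congr 1
      ring
    rw [this]
    field_simp
  rw [div_le_iff₀ hden0]
  refine (add_le_add_right hE _).trans (le_of_eq ?_)
  rw [Real.exp_neg K]
  field_simp
  ring

/-- The true break may be an endpoint of the interval, so a one-sided interval is taken: to the
right if there is room, otherwise to the left. -/
lemma exists_subset_near {a b : ℝ} (hab : a < b) (hτ₀ : τ₀ ∈ Icc a b) (hsub : Icc a b ⊆ H) :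
    ∃ ρ : ℝ, 0 < ρ ∧ ∀ l : ℝ, 0 < l → l ≤ ρ → ∃ I : Set ℝ, MeasurableSet I ∧ I ⊆ H ∧
      volume.real I = l ∧ ∀ τ ∈ I, |τ - τ₀| ≤ l := by
  rcases hτ₀.2.lt_or_eq with hlt | rfl
  · refine ⟨b - τ₀, sub_pos.mpr hlt, fun l hl hlρ => ⟨Icc τ₀ (τ₀ + l), measurableSet_Icc,
      (Icc_subset_Icc hτ₀.1 (by linarith)).trans hsub, ?_, fun τ hτ => ?_⟩⟩
    · rw [Real.volume_real_Icc_of_le (by linarith)]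
      ring
    · rw [abs_le]
      constructor <;> linarith [hτ.1, hτ.2]
  · refine ⟨τ₀ - a, sub_pos.mpr hab, fun l hl hlρ => ⟨Icc (τ₀ - l) τ₀, measurableSet_Icc,
      (Icc_subset_Icc (by linarith) le_rfl).trans hsub, ?_, fun τ hτ => ?_⟩⟩
    · rw [Real.volume_real_Icc_of_le (by linarith)]
      ring
    · rw [abs_le]
      constructor <;> linarith [hτ.1, hτ.2]

lemma strictFloor_le_succ_of_le {a b : ℝ} (ha : 0 < a) (hb : 0 < b) (h : a ≤ b + 1) :
    strictFloor a ≤ strictFloor b + 1 := by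
  have h1 := (strictFloor_spec ha).1
  have h2 := (strictFloor_spec hb).2
  have : (strictFloor a : ℝ) < strictFloor b + 1 + 1 := by linarith
  have : strictFloor a < strictFloor b + 1 + 1 := by exact_mod_cast this
  omega

end Contraction

end BreakModel

/-! ### Choice of constants and conclusion -/

theorem theorem3 {Ω : Type*} [MeasurableSpace Ω] (μ : Measure Ω) [IsProbabilityMeasure μ]
    {dx dz : ℕ} (R : Matrix (Fin dx) (Fin dz) ℝ) (hR : R.rank = dz)
    (X : Set (Fin dx → ℝ)) (x : ℕ → Ω → Fin dx → ℝ) (ε : ℕ → Ω → ℝ)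
    (γ₀ : (Fin dx → ℝ) × (Fin dz → ℝ)) (σ₀sq : ℝ) (SigmaX : Matrix (Fin dx) (Fin dx) ℝ)
    (hdgp : BreakModel.RegularDGP μ X x ε γ₀.2 σ₀sq SigmaX)
    (H : Set ℝ) (hH : MeasurableSet H) (hH01 : H ⊆ Set.Ioo 0 1)
    (τ₀ : ℝ) (hτ₀ : ∃ a b : ℝ, a < b ∧ τ₀ ∈ Set.Icc a b ∧ Set.Icc a b ⊆ H)
    (Θ : Set (BreakModel.Param dx dz)) (prior : BreakModel.Param dx dz × ℝ → ℝ)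
    (hprior : BreakModel.RegularPrior Θ H prior (BreakModel.pseudoTrue μ R x ε γ₀ τ₀)) :
    (∀ (T : ℕ) (ω : Ω),
      IntegrableOn (BreakModel.margLik R prior T
        (BreakModel.response R x ε γ₀ τ₀ T ω) (fun t => x t ω)) H ∧
      0 < ∫ τ in H, BreakModel.margLik R prior T
        (BreakModel.response R x ε γ₀ τ₀ T ω) (fun t => x t ω) τ) ∧
    ∀ η : ℝ, 0 < η → ∀ e : ℝ, 0 < e → ∃ M : ℝ, 0 < M ∧ ∃ k : ℕ, 0 < k ∧ ∀ T : ℕ, k ≤ T →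
      1 - e < μ.real {ω | ∫ τ in H \ Set.Ioo (τ₀ - M / T) (τ₀ + M / T),
        BreakModel.margPosterior R prior H T
          (BreakModel.response R x ε γ₀ τ₀ T ω) (fun t => x t ω) τ < η} := by
  refine ⟨fun T ω => ⟨hprior.margLik_integrable.integrableOn, hprior.margLik_setIntegral_pos⟩,
    fun η hη e he => ?_⟩
  open BreakModel in
  obtain ⟨a₁, b₁, hab, hτab, habH⟩ := hτ₀
  have hτH : τ₀ ∈ H := habH hτab
  obtain ⟨hτ0, hτ1⟩ := hH01 hτH
  have hσ := hdgp.variance_pos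
  have hstar : pseudoTrue μ R x ε γ₀ τ₀ τ₀ = (γ₀, σ₀sq) := pseudoTrue_eq hdgp hR hτ0 hτ1
  have hΘnhds : Θ ∈ 𝓝 (γ₀, σ₀sq) := by
    rw [← hstar]
    exact mem_interior_iff_mem_nhds.mp (hprior.star_mem τ₀ hτH)
  obtain ⟨W, hW, -, lo, hi, hlo, hWprior⟩ := hprior.regular τ₀ hτH
  rw [hstar] at hW
  have hhi : 0 ≤ hi := by
    have := hWprior ((γ₀, σ₀sq), τ₀) ⟨mem_of_mem_nhds hW, mem_of_mem_nhds hΘnhds, hτH⟩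
    linarith
  obtain ⟨V, hV, U, hU, hVU⟩ := mem_nhds_prod_iff.mp hW
  obtain ⟨κ₁, hκ₁, hκ₁U⟩ := Metric.mem_nhds_iff.mp hU
  -- `κ₁` keeps the breaks where the prior is bounded; the quarters leave more than `κT` dates on
  -- either side of any break near `τ₀`.
  set κ := min κ₁ (min (τ₀ / 4) ((1 - τ₀) / 4)) with hκdef
  have hκ : 0 < κ := lt_min hκ₁ (lt_min (by linarith) (by linarith))
  have hκτ : 4 * κ ≤ τ₀ := by
    have : κ ≤ τ₀ / 4 := (min_le_right _ _).trans (min_le_left _ _)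
    linarith
  have hκτ' : 4 * κ ≤ 1 - τ₀ := by
    have : κ ≤ (1 - τ₀) / 4 := (min_le_right _ _).trans (min_le_right _ _)
    linarith
  obtain ⟨r, r', c, ζ, a, hr, hr', hrr, hc, hζ, ha, hball, hsep⟩ :=
    exists_likelihoodSeparated hdgp.secondMoment_posDef hR hdgp.jump_ne_zero hσ hprior.compact
      hprior.variance_pos (mem_of_mem_nhds hΘnhds) (Filter.inter_mem hV hΘnhds) hκ hκτ hκτ'
  -- Three exceptional events of probability at most `e / 4` each leave a strict margin; the set `N`
  -- is null.
  have he4 : 0 < e / 4 := by linarith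
  obtain ⟨M₀, hreg⟩ := hdgp.exists_sampleRegular (κ := 2 * κ) (τ₀ := τ₀) (by linarith)
    (by linarith) hc he4
  obtain ⟨K₁, hK₁, herr⟩ := hdgp.exists_err_bound he4
  obtain ⟨b, hb, hxb⟩ := hdgp.exists_bound
  obtain ⟨s₁, s₂, hs₁, -, hs⟩ :=
    exists_variance_bounds hprior.compact hprior.variance_pos hprior.nonempty
  obtain ⟨B, hB, hw⟩ := exists_coefDev_bound (R := R) (γ₀ := γ₀) hprior.compact
  obtain ⟨ρ, hρ, hI⟩ := exists_subset_near hab hτab habH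
  set K := (K₁ + b * B) ^ 2 / (2 * s₁) with hKdef
  set C₁ := 4 * hi * Real.exp a * Real.exp K / (a * lo) with hC₁
  set C₂ := Real.exp K / (lo * volume.real (Metric.ball (γ₀, σ₀sq) r')) with hC₂
  have hlim₁ : Tendsto (fun m : ℝ => C₁ * Real.exp (-(a / 2 * m))) atTop (𝓝 (C₁ * 0)) :=
    (Real.tendsto_exp_neg_atTop_nhds_zero.comp
      (tendsto_id.const_mul_atTop (half_pos ha))).const_mul C₁
  have hlim₂ : Tendsto (fun T : ℕ => C₂ * ((T : ℝ) * Real.exp (-(ζ * T)))) atTop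
      (𝓝 (C₂ * (ζ⁻¹ * 0))) := by
    have h1 := (Real.tendsto_pow_mul_exp_neg_atTop_nhds_zero 1).comp
      (tendsto_natCast_atTop_atTop.const_mul_atTop hζ)
    refine ((h1.const_mul ζ⁻¹).congr fun T => ?_).const_mul C₂
    simp only [Function.comp, pow_one]
    field_simp
  rw [mul_zero] at hlim₁
  rw [mul_zero, mul_zero] at hlim₂
  obtain ⟨m, hm₁, hm₂⟩ := ((hlim₁.eventually_lt_const (half_pos hη)).and
    (eventually_ge_atTop ((M₀ : ℝ) + 1))).exists
  have hm0 : 0 < m := by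
    have := Nat.cast_nonneg (α := ℝ) M₀
    linarith
  have hκlim : Tendsto (fun T : ℕ => κ * (T : ℝ)) atTop atTop :=
    tendsto_natCast_atTop_atTop.const_mul_atTop hκ
  obtain ⟨k, hk⟩ := eventually_atTop.mp (hreg.and ((hlim₂.eventually_lt_const (half_pos hη)).and
    ((hκlim.eventually_ge_atTop 2).and
      ((tendsto_one_div_atTop_nhds_zero_nat (𝕜 := ℝ)).eventually_le_const hρ))))
  refine ⟨m, hm0, k + 1, by omega, fun T hT => ?_⟩
  obtain ⟨hregT, hT₂, hTκ, hTρ⟩ := hk T (by omega)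
  have hT1 : 1 ≤ T := by omega
  have hT0 : (0 : ℝ) < T := by exact_mod_cast hT1
  have hTκ' : 1 / (T : ℝ) < κ := by
    rw [div_lt_iff₀ hT0]
    linarith
  obtain ⟨I, hIm, hIH, hIvol, hIτ⟩ := hI (1 / T) (by positivity) hTρ
  set n₀ := strictFloor (τ₀ * T) with hn₀
  set G : Set Ω := {ω | ∫ τ in H \ Set.Ioo (τ₀ - m / T) (τ₀ + m / T),
    margPosterior R prior H T (response R x ε γ₀ τ₀ T ω) (fun t => x t ω) τ < η} with hG
  set N : Set Ω := {ω | ¬ ∀ t i, |x t ω i| ≤ b} with hN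
  have hN0 : μ.real N = 0 := by
    rw [measureReal_def, ae_iff.mp hxb, ENNReal.toReal_zero]
  set E₁ : Set Ω := {ω | ¬ SampleRegular SigmaX σ₀sq (2 * κ) c M₀ T n₀ (fun t => x t ω)
    (fun t => ε t ω)} with hE₁
  set E₂ : Set Ω := {ω | K₁ < |ε n₀ ω|} with hE₂
  set E₃ : Set Ω := {ω | K₁ < |ε (n₀ - 1) ω|} with hE₃
  -- A covering and subadditivity bound the measure of `G` from below without requiring `G` to be
  -- measurable.
  have hcover : (univ : Set Ω) ⊆ G ∪ (N ∪ (E₁ ∪ (E₂ ∪ E₃))) := by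
    intro ω _
    by_contra hcon
    simp only [mem_union, not_or] at hcon
    obtain ⟨hωG, hωN, hω₁, hω₂, hω₃⟩ := hcon
    have hx : ∀ t i, |x t ω i| ≤ b := not_not.mp hωN
    have hsr : SampleRegular SigmaX σ₀sq (2 * κ) c M₀ T n₀ (fun t => x t ω) (fun t => ε t ω) :=
      not_not.mp hω₁
    have hε₂ : |ε n₀ ω| ≤ K₁ := not_lt.mp hω₂
    have hε₃ : |ε (n₀ - 1) ω| ≤ K₁ := not_lt.mp hω₃
    refine hωG (lt_of_le_of_lt (margPosterior_setIntegral_le hprior hH hH01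
      (hsep M₀ T _ _ hTκ hsr) hT1 hr' hrr ha (fun θ hθ => (hball hθ).2) hlo hhi ?_ hIm hIH hIvol
      (fun τ hτ => (hIτ τ hτ).trans_lt hTκ') (K := K) ?_ hm₂) (by linarith))
    · intro θ hθ τ hτ hτκ
      refine hWprior (θ, τ) ⟨hVU ⟨(hball hθ).1, hκ₁U ?_⟩, (hball hθ).2, hτ⟩
      rw [Metric.mem_ball, Real.dist_eq]
      exact hτκ.trans_le (min_le_left _ _)
    · intro θ hθ τ hτ
      have hτ01 := hH01 (hIH hτ)
      have hd := hIτ τ hτ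
      have hTabs : |τ - τ₀| * T = |(τ - τ₀) * T| := by rw [abs_mul, abs_of_pos hT0]
      rw [le_div_iff₀ hT0, hTabs, sub_mul] at hd
      obtain ⟨hd1, hd2⟩ := abs_le.mp hd
      have := logLik_sub_logLik_le_of_near (θ := θ) (T := T) (n₀ := n₀)
        (n := strictFloor (τ * T)) (x := fun t => x t ω) (ε := fun t => ε t ω) hs₁
        (hs θ (hball hθ).2).1 (hw θ (hball hθ).2) hx hb.le hε₂ hε₃
        (strictFloor_le_succ_of_le (mul_pos hτ01.1 hT0) (mul_pos hτ0 hT0) (by linarith))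
        (strictFloor_le_succ_of_le (mul_pos hτ0 hT0) (mul_pos hτ01.1 hT0) (by linarith))
        (strictFloor_mul_le hτ01.1 hτ01.2 hT1) (strictFloor_mul_le hτ0 hτ1 hT1)
      linarith
  have h1 := measureReal_mono (μ := μ) hcover
  rw [probReal_univ] at h1
  have h2 := measureReal_union_le (μ := μ) G (N ∪ (E₁ ∪ (E₂ ∪ E₃)))
  have h3 := measureReal_union_le (μ := μ) N (E₁ ∪ (E₂ ∪ E₃))
  have h4 := measureReal_union_le (μ := μ) E₁ (E₂ ∪ E₃)
  have h5 := measureReal_union_le (μ := μ) E₂ E₃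
  have h6 : μ.real E₂ ≤ e / 4 := herr n₀
  have h7 : μ.real E₃ ≤ e / 4 := herr (n₀ - 1)
  linarith

end
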